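/- **Notation.** Let $n\ge 1$. For $f\in\mathcal S(\mathbb R^n)$ put $\widehat f(\xi)=\int e^{-ix\cdot\xi}f(x)\,dx$ and $\check f(x)=(2\pi)^{-n}\int e^{ix\cdot\xi}f(\xi)\,d\xi$. A *Littlewood–Paley partition of unity* on $\mathbb R^d$ is a family $\{\psi_k\}_{k\ge0}$ with $\psi_0=\phi$ and $\psi_k=\psi(\cdot/2^k)$ for $k\ge1$, where $\psi=\phi-\phi(2\,\cdot)$ and $\phi\in\mathcal S(\mathbb R^d)$ satisfies $\phi=1$ on $\{|\xi|\le1\}$ and $\operatorname{supp}\phi\subset\{|\xi|\le2\}$. Let $\{\psi_k\}$ and $\{\Psi_j\}$ be such partitions on $\mathbb R^n$ and on $(\mathbb R^n)^2$, respectively. For $\sigma=\sigma(x,\xi,\eta)\in L^\infty((\mathbb R^n)^3)$, $\boldsymbol k=(k_0,k_1,k_2)\in\mathbb N_0^3$ and $j\in\mathbb N_0$ let $$\Delta_{\boldsymbol k}\sigma=\psi_{k_0}(D_x)\psi_{k_1}(D_\xi)\psi_{k_2}(D_\eta)\sigma=(\check\psi_{k_0}\otimes\check\psi_{k_1}\otimes\check\psi_{k_2})*\sigma,$$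 $$\sigma_j^\rho(x,\xi,\eta)=\sigma(2^{-j\rho}x,2^{j\rho}\xi,2^{j\rho}\eta)\,\Psi_j(2^{j\rho}\xi,2^{j\rho}\eta).$$ With $\|F\|_{L^2_{ul}(\mathbb R^{d})}=\sup_{\nu\in\mathbb Z^{d}}\big(\int_{[-1/2,1/2)^{d}}|F(x+\nu)|^2dx\big)^{1/2}$ and $\boldsymbol s=(s_0,s_1,s_2)\in[0,\infty)^3$, the class $BS^m_{\rho,\rho}(\boldsymbol s;\mathbb R^n)$ consists of all $\sigma\in L^\infty((\mathbb R^n)^3)$ such that $$\|\sigma\|_{BS^m_{\rho,\rho}(\boldsymbol s;\mathbb R^n)}=\sup_{j\in\mathbb N_0}\ \sum_{\boldsymbol k\in\mathbb N_0^3}2^{-jm+k_0s_0+k_1s_1+k_2s_2}\,\|\Delta_{\boldsymbol k}[\sigma_j^\rho]\|_{L^2_{ul}((\mathbb R^n)^3)}<\infty .$$ For $f,g\in\mathcal S(\mathbb R^n)$ let $$T_\sigma(f,g)(x)=\frac1{(2\pi)^{2n}}\int_{(\mathbb R^n)^2}e^{ix\cdot(\xi+\eta)}\sigma(x,\xi,\eta)\widehat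 f(\xi)\widehat g(\eta)\,d\xi\,d\eta .$$ **Theorem.** Let $0\le\rho<1$, $m=-(1-\rho)n/2$, and let $s_0,s_1,s_2\ge n/2$. If $\sigma\in BS^m_{\rho,\rho}(\boldsymbol s;\mathbb R^n)$ (with respect to any choice of the two Littlewood–Paley partitions of unity), then $T_\sigma$ is bounded from $L^2(\mathbb R^n)\times L^2(\mathbb R^n)$ to $L^1(\mathbb R^n)$: there is a constant $C$ such that $$\|T_\sigma(f,g)\|_{L^1}\le C\,\|f\|_{L^2}\|g\|_{L^2}\qquad\text{for all } f,g\in\mathcal S(\mathbb R^n).$$ -/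

import Mathlib

open MeasureTheory
open scoped ENNReal NNReal SchwartzMap

noncomputable section

/-- Euclidean space `ℝⁿ`, with its Euclidean norm, inner product and Lebesgue measure. -/
abbrev Rn (n : ℕ) : Type := EuclideanSpace ℝ (Fin n)

/-- `(ℝⁿ)²` with the Euclidean norm of `ℝ²ⁿ`. -/
abbrev Rn2 (n : ℕ) : Type := WithLp 2 (Rn n × Rn n)

/-- The phase space `(ℝⁿ)³ ∋ (x, ξ, η)`, with the product (Lebesgue) measure. -/
abbrev Phase (n : ℕ) : Type := Rn n × Rn n × Rn n

/-- The Fourier transform `f̂(ξ) = ∫ e^{-i x·ξ} f(x) dx`. -/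
def fourierHat {n : ℕ} (f : Rn n → ℂ) (ξ : Rn n) : ℂ :=
  ∫ x : Rn n, Complex.exp (-(Complex.I * ((inner ℝ x ξ : ℝ) : ℂ))) * f x

/-- The inverse Fourier transform `(2π)⁻ⁿ ∫ e^{i x·ξ} m(ξ) dξ`. -/
def fourierCheck {n : ℕ} (m : Rn n → ℂ) (x : Rn n) : ℂ :=
  (1 / (2 * (Real.pi : ℂ)) ^ n) *
    ∫ ξ : Rn n, Complex.exp (Complex.I * ((inner ℝ x ξ : ℝ) : ℂ)) * m ξ

/-- The bilinear pseudo-differential operator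
`T_σ(f,g)(x) = (2π)^{-2n} ∫∫ e^{i x·(ξ+η)} σ(x,ξ,η) f̂(ξ) ĝ(η) dξ dη`. -/
def bilinearPDO {n : ℕ} (σ : Phase n → ℂ) (f g : 𝓢(Rn n, ℂ)) (x : Rn n) : ℂ :=
  (1 / (2 * (Real.pi : ℂ)) ^ (2 * n)) *
    ∫ p : Rn n × Rn n,
      Complex.exp (Complex.I * ((inner ℝ x (p.1 + p.2) : ℝ) : ℂ)) * σ (x, p.1, p.2) *
        fourierHat f p.1 * fourierHat g p.2

/-- A bilinear operator on Schwartz functions is bounded from `L^p × L^q` to `L^r`. -/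
def BoundedLpLqLr {n : ℕ} (T : 𝓢(Rn n, ℂ) → 𝓢(Rn n, ℂ) → Rn n → ℂ) (p q r : ℝ≥0∞) : Prop :=
  ∃ C : ℝ≥0, ∀ f g : 𝓢(Rn n, ℂ),
    MemLp (T f g) r volume ∧
      eLpNorm (T f g) r volume ≤ C * eLpNorm f p volume * eLpNorm g q volume

/-- `φ` generates a Littlewood–Paley partition of unity: `φ = 1` on `|ξ| ≤ 1` and
`supp φ ⊆ {|ξ| ≤ 2}`. -/
structure IsLPGenerator {V : Type*} [NormedAddCommGroup V] [NormedSpace ℝ V]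
    (φ : 𝓢(V, ℂ)) : Prop where
  eq_one : ∀ ξ : V, ‖ξ‖ ≤ 1 → φ ξ = 1
  supp : tsupport φ ⊆ Metric.closedBall 0 2

/-- The Littlewood–Paley partition of unity generated by `φ`: `ψ₀ = φ` and
`ψ_k = ψ(· / 2^k)` for `k ≥ 1`, where `ψ = φ - φ(2 ·)`. -/
def lpPiece {V : Type*} [NormedAddCommGroup V] [NormedSpace ℝ V]
    (φ : 𝓢(V, ℂ)) (k : ℕ) (ξ : V) : ℂ :=
  if k = 0 then φ ξ
  else φ (((2 : ℝ) ^ k)⁻¹ • ξ) - φ ((2 : ℝ) • ((2 : ℝ) ^ k)⁻¹ • ξ)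

/-- `Δ_k F = ψ_{k₀}(D_x) ψ_{k₁}(D_ξ) ψ_{k₂}(D_η) F`, i.e. the convolution of `F` with the tensor
product of the inverse Fourier transforms of `ψ_{k₀}`, `ψ_{k₁}`, `ψ_{k₂}`. -/
def deltaBlock {n : ℕ} (φ : 𝓢(Rn n, ℂ)) (k : ℕ × ℕ × ℕ) (F : Phase n → ℂ) (X : Phase n) : ℂ :=
  ∫ Y : Phase n,
    fourierCheck (lpPiece φ k.1) Y.1 * fourierCheck (lpPiece φ k.2.1) Y.2.1 *
      fourierCheck (lpPiece φ k.2.2) Y.2.2 * F (X - Y)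

/-- `σ_j^ρ(x,ξ,η) = σ(2^{-jρ}x, 2^{jρ}ξ, 2^{jρ}η) Ψ_j(2^{jρ}ξ, 2^{jρ}η)`, where `Ψ_j` is the
Littlewood–Paley partition of unity of `(ℝⁿ)²` generated by `Φ`. -/
def rescaledPiece {n : ℕ} (Φ : 𝓢(Rn2 n, ℂ)) (ρ : ℝ) (j : ℕ) (σ : Phase n → ℂ)
    (X : Phase n) : ℂ :=
  σ ((2 : ℝ) ^ (-(j * ρ)) • X.1, (2 : ℝ) ^ (j * ρ) • X.2.1, (2 : ℝ) ^ (j * ρ) • X.2.2) *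
    lpPiece Φ j
      (WithLp.toLp 2 ((2 : ℝ) ^ (j * ρ) • X.2.1, (2 : ℝ) ^ (j * ρ) • X.2.2))

/-- The unit cube `[-1/2, 1/2)ⁿ`. -/
def unitCube (n : ℕ) : Set (Rn n) := {x | ∀ i, x i ∈ Set.Ico (-1 / 2 : ℝ) (1 / 2)}

/-- The integer point of `ℝⁿ` with coordinates `ν`. -/
def latticePoint {n : ℕ} (ν : Fin n → ℤ) : Rn n := WithLp.toLp 2 fun i => (ν i : ℝ)

/-- The uniformly local `L²` norm on `(ℝⁿ)³ = ℝ³ⁿ`: the supremum over `ν ∈ ℤ³ⁿ` of the `L²` norms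
of `F(· + ν)` over the unit cube of `ℝ³ⁿ`. -/
def normL2ul {n : ℕ} (F : Phase n → ℂ) : ℝ≥0∞ :=
  ⨆ ν : (Fin n → ℤ) × (Fin n → ℤ) × (Fin n → ℤ),
    (∫⁻ X in unitCube n ×ˢ unitCube n ×ˢ unitCube n,
      ‖F (X + (latticePoint ν.1, latticePoint ν.2.1, latticePoint ν.2.2))‖ₑ ^ 2) ^ (1 / 2 : ℝ)

/-- The norm of `BS^m_{ρ,ρ}(s; ℝⁿ)`, formed with the Littlewood–Paley partitions of unity generated
by `φ` on `ℝⁿ` and by `Φ` on `(ℝⁿ)²`: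
`sup_j ∑_k 2^{-jm + k·s} ‖Δ_k[σ_j^ρ]‖_{L²_ul}`. -/
def normBS {n : ℕ} (φ : 𝓢(Rn n, ℂ)) (Φ : 𝓢(Rn2 n, ℂ)) (ρ m s₀ s₁ s₂ : ℝ)
    (σ : Phase n → ℂ) : ℝ≥0∞ :=
  ⨆ j : ℕ, ∑' k : ℕ × ℕ × ℕ,
    ENNReal.ofReal ((2 : ℝ) ^ (-(j * m) + (k.1 * s₀ + k.2.1 * s₁ + k.2.2 * s₂))) *
      normL2ul (deltaBlock φ k (rescaledPiece Φ ρ j σ))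

/-- `σ ∈ BS^m_{ρ,ρ}(s; ℝⁿ)`: `σ ∈ L^∞((ℝⁿ)³)` and its norm is finite. -/
def MemBS {n : ℕ} (φ : 𝓢(Rn n, ℂ)) (Φ : 𝓢(Rn2 n, ℂ)) (ρ m s₀ s₁ s₂ : ℝ)
    (σ : Phase n → ℂ) : Prop :=
  MemLp σ ∞ volume ∧ normBS φ Φ ρ m s₀ s₁ s₂ σ < ∞

end

noncomputable section
variable {n : ℕ}

/-! Everything happens on the frequency side: `freqOp` acts on the transforms `a`, `b` of the two
inputs, and Plancherel returns to `f`, `g` only at the end.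

The core is `exists_lintegral_freqOp_le`: a symbol F band limited at scales 2^k₀, 2^k₁, 2^k₂ in x,
ξ, η obeys an L¹ bound that costs only 2^{n(k₀+k₁+k₂)/2} times its uniformly local L² norm. To see
this, restrict x to a unit cube around p and pair with a function U supported there, |U| ≤ 1. The
reproducing identity in x moves the kernel from the symbol onto U, leaving the integral of F(y,ξ,η)
G_y(ξ+η) a(ξ) b(η), where G_y is the Fourier transform of a function supported in one unit cube.
Such a transform is essentially constant at unit scale. Hence Cauchy–Schwarz on unit cubes of phase
space isolates F, and a weighted Cauchy–Schwarz in (ξ,η) exploits that the remaining kernel depends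
on ξ+η alone (`lintegral_trilinear_le`). Plancherel and decay of the kernel give 2^{nk₀/2}
(`exists_local_dominant`). Band limitation in ξ and η allows the inputs to be cut off to distance
about 2^k₁, 2^k₂ from p (`freqOp_localize`); integrating over p by Cauchy–Schwarz then costs
2^{nk₁/2} and 2^{nk₂/2}. Adding the blocks (`exists_lintegral_freqOp_le_blockNorm`) explains the
threshold n/2 for the smoothness exponents.

For the sum over j, dilate by 2^{jρ}, so that the j-th piece lives at frequencies of size at most
about N = 2^{j(1-ρ)}. The weighted estimate then loses N^{n/2}, which the critical order m cancels
exactly, leaving no decay in j. One of ξ, η has size about 2^j, so the corresponding input is square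
summable over annuli; the other ranges over a whole ball, where plain L² norms do not sum. The
weight `scaleWeight` repairs this: its inverse still has integral at most a multiple of N^n, yet it
is small far below frequency N, so that its rescaled copies on the dyadic balls have bounded sum
(`exists_sum_indicator_scaleWeight_le`). Cauchy–Schwarz in j and Fatou's lemma finish the proof. -/

/-! ### Exponentials, dilations and inverse Fourier transforms of Schwartz functions -/

/-- The unimodular exponential `e^{it}`. -/
def osc (t : ℝ) : ℂ := Complex.exp (Complex.I * (t : ℂ))

lemma osc_add (s t : ℝ) : osc (s + t) = osc s * osc t := by
  simp only [osc, ← Complex.exp_add]; congr 1; push_cast; ring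

lemma norm_osc (t : ℝ) : ‖osc t‖ = 1 := by
  rw [osc, mul_comm, Complex.norm_exp_ofReal_mul_I]

lemma osc_zero : osc 0 = 1 := by simp [osc]

@[fun_prop]
lemma continuous_osc : Continuous osc := by
  unfold osc; fun_prop

lemma measurable_osc : Measurable osc := continuous_osc.measurable

lemma enorm_osc (t : ℝ) : ‖osc t‖ₑ = 1 := by
  rw [← ofReal_norm, norm_osc]; simp

lemma finrank_Rn : Module.finrank ℝ (Rn n) = n := by simp

lemma lintegral_comp_smul_Rn {f : Rn n → ℝ≥0∞} (hf : Measurable f) {R : ℝ} (hR : R ≠ 0) :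
    ∫⁻ x, f (R • x) = ENNReal.ofReal |(R ^ n)⁻¹| * ∫⁻ x, f x := by
  have h := Measure.map_addHaar_smul (volume : Measure (Rn n)) hR
  rw [finrank_Rn] at h
  rw [← lintegral_map (f := f) (g := fun x => R • x) hf (by fun_prop), h, lintegral_smul_measure]
  rfl

lemma integral_comp_smul_Rn (f : Rn n → ℂ) (R : ℝ) :
    ∫ x, f (R • x) = (|(R ^ n)⁻¹| : ℝ) • ∫ x, f x := by
  have := Measure.integral_comp_smul (volume : Measure (Rn n)) f R
  rwa [finrank_Rn] at this

/-- Dilation by a nonzero factor, as a continuous linear equivalence. -/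
def dilEquiv (n : ℕ) (c : ℝ) (hc : c ≠ 0) : Rn n ≃L[ℝ] Rn n :=
  ContinuousLinearEquiv.smulLeft (Units.mk0 c hc)

/-- The dilate `u(2^{-k} ·)` of a Schwartz function. -/
def dil (k : ℕ) (u : 𝓢(Rn n, ℂ)) : 𝓢(Rn n, ℂ) :=
  SchwartzMap.compCLMOfContinuousLinearEquiv ℂ (dilEquiv n ((2 : ℝ) ^ k)⁻¹ (by positivity)) u

lemma dil_apply (k : ℕ) (u : 𝓢(Rn n, ℂ)) (x : Rn n) : dil k u x = u (((2 : ℝ) ^ k)⁻¹ • x) := rfl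

open scoped FourierTransform in
/-- The inverse Fourier transform `fourierCheck u` of a Schwartz function, as a Schwartz function. -/
def checkS (u : 𝓢(Rn n, ℂ)) : 𝓢(Rn n, ℂ) :=
  ((1 / (2 * (Real.pi : ℂ)) ^ n) : ℂ) •
    SchwartzMap.compCLMOfContinuousLinearEquiv ℂ
      (dilEquiv n (2 * Real.pi)⁻¹ (by positivity)) (𝓕⁻ u)

open scoped FourierTransform in
lemma checkS_apply (u : 𝓢(Rn n, ℂ)) (x : Rn n) : checkS u x = fourierCheck u x := by
  have h : checkS u x = (1 / (2 * (Real.pi : ℂ)) ^ n) *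
    (𝓕⁻ (u : Rn n → ℂ)) ((2 * Real.pi)⁻¹ • x) := by
      rw [← SchwartzMap.fourierInv_coe]; rfl
  rw [h, fourierCheck, Real.fourierInv_eq']
  congr 1
  refine integral_congr_ae (.of_forall fun ξ => ?_)
  simp only [smul_eq_mul, inner_smul_right]
  congr 2
  rw [real_inner_comm]
  push_cast
  have : (Real.pi : ℂ) ≠ 0 := by exact_mod_cast Real.pi_ne_zero
  field_simp

open scoped FourierTransform in
lemma integral_osc_checkS (u : 𝓢(Rn n, ℂ)) (t : Rn n) :
    ∫ s, osc (-inner ℝ s t) * checkS u s = u t := by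
  -- The dilation by 2π passes from the phase e^{ix·ξ} to the phase e^{2πix·ξ} of `𝓕`; its Jacobian
  -- is the prefactor of `checkS`.
  have h2 : ∫ s, osc (-inner ℝ ((2 * Real.pi) • s) t) * checkS u ((2 * Real.pi) • s) =
      (1 / (2 * (Real.pi : ℂ)) ^ n) * u t := by
    have h3 : (𝓕 (𝓕⁻ u) : 𝓢(Rn n, ℂ)) t = u t := by simp
    rw [SchwartzMap.fourier_coe, Real.fourier_eq'] at h3
    rw [← h3, ← integral_const_mul]
    refine integral_congr_ae (.of_forall fun s => ?_)
    have : checkS u ((2 * Real.pi) • s) = (1 / (2 * (Real.pi : ℂ)) ^ n) * (𝓕⁻ u) s := by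
      have : checkS u ((2 * Real.pi) • s) = (1 / (2 * (Real.pi : ℂ)) ^ n) *
        (𝓕⁻ u) ((2 * Real.pi)⁻¹ • (2 * Real.pi) • s) := rfl
      rw [this, smul_smul, inv_mul_cancel₀ (by positivity), one_smul]
    simp only [this, smul_eq_mul, osc, inner_smul_left]
    simp only [← mul_assoc]
    rw [mul_comm (Complex.exp _)]
    congr 3
    push_cast
    simp
    ring
  have h1 := integral_comp_smul_Rn (fun s => osc (-inner ℝ s t) * checkS u s) (2 * Real.pi)
  rw [h2] at h1
  have hp : (0 : ℝ) < (2 * Real.pi) ^ n := by positivity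
  rw [abs_of_pos (by positivity), Complex.real_smul] at h1
  push_cast at h1
  have hne : (2 * (Real.pi : ℂ)) ^ n ≠ 0 := by exact_mod_cast hp.ne'
  field_simp at h1
  exact h1.symm

lemma checkS_eq (u : 𝓢(Rn n, ℂ)) (x : Rn n) :
    checkS u x = (1 / (2 * (Real.pi : ℂ)) ^ n) * ∫ ξ, osc (inner ℝ x ξ) * u ξ :=
  checkS_apply u x

/-- If `v(· + q) = 1` on the support of `u`, then convolution with the modulation of `v̌` by
`e^{-iq·s}` reproduces `ǔ`. -/
lemma modulated_reproducing (u v : 𝓢(Rn n, ℂ)) (q x : Rn n) (h : ∀ ξ, v (ξ + q) * u ξ = u ξ) :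
    ∫ s, osc (-inner ℝ q s) * checkS v s * checkS u (x - s) = checkS u x := by
  have hint : Integrable (Function.uncurry fun (s ξ : Rn n) =>
      (checkS v s * u ξ) * (osc (-inner ℝ q s) * osc (inner ℝ (x - s) ξ)))
      ((volume : Measure (Rn n)).prod volume) := by
    refine ((checkS v).integrable.mul_prod u.integrable).mul_bdd (c := 1) ?_ ?_
    · exact Continuous.aestronglyMeasurable (by fun_prop)
    · exact .of_forall fun p => by simp [norm_osc]
  calc ∫ s, osc (-inner ℝ q s) * checkS v s * checkS u (x - s)
      = ∫ s, (1 / (2 * (Real.pi : ℂ)) ^ n) *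
          ∫ ξ, (checkS v s * u ξ) * (osc (-inner ℝ q s) * osc (inner ℝ (x - s) ξ)) := by
        refine integral_congr_ae (.of_forall fun s => ?_)
        simp only [checkS_eq u]
        rw [← mul_assoc, mul_comm _ (1 / (2 * (Real.pi : ℂ)) ^ n), mul_assoc, ← integral_const_mul]
        congr 1
        refine integral_congr_ae (.of_forall fun ξ => ?_)
        simp only; ring
    _ = (1 / (2 * (Real.pi : ℂ)) ^ n) *
          ∫ ξ, ∫ s, (checkS v s * u ξ) * (osc (-inner ℝ q s) * osc (inner ℝ (x - s) ξ)) := by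
        rw [integral_const_mul, integral_integral_swap hint]
    _ = (1 / (2 * (Real.pi : ℂ)) ^ n) * ∫ ξ, osc (inner ℝ x ξ) * u ξ := by
        congr 1
        refine integral_congr_ae (.of_forall fun ξ => ?_)
        have : ∀ s, (checkS v s * u ξ) * (osc (-inner ℝ q s) * osc (inner ℝ (x - s) ξ)) =
            (osc (inner ℝ x ξ) * u ξ) * (osc (-inner ℝ s (ξ + q)) * checkS v s) := by
          intro s
          have : osc (-inner ℝ q s) * osc (inner ℝ (x - s) ξ) =
              osc (inner ℝ x ξ) * osc (-inner ℝ s (ξ + q)) := by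
            rw [← osc_add, ← osc_add]; congr 1
            rw [inner_sub_left, inner_add_right, real_inner_comm q s]; ring
          rw [this]; ring
        simp only [this]
        rw [integral_const_mul, integral_osc_checkS, mul_assoc, mul_comm (u ξ), h]
    _ = checkS u x := (checkS_eq u x).symm

lemma reproducing (u v : 𝓢(Rn n, ℂ)) (x : Rn n) (h : ∀ ξ, v ξ * u ξ = u ξ) :
    ∫ s, checkS v s * checkS u (x - s) = checkS u x := by
  simpa [osc_zero] using modulated_reproducing u v 0 x (by simpa using h)

lemma checkS_dil (k : ℕ) (u : 𝓢(Rn n, ℂ)) (x : Rn n) :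
    checkS (dil k u) x = ((2 : ℂ) ^ k) ^ n * checkS u ((2 : ℝ) ^ k • x) := by
  rw [checkS_eq, checkS_eq]
  have h1 := integral_comp_smul_Rn (fun ξ => osc (inner ℝ x ((2 : ℝ) ^ k • ξ)) * u ξ)
    ((2 : ℝ) ^ k)⁻¹
  rw [abs_of_pos (by positivity)] at h1
  have h2 : ∀ ξ : Rn n, ((2 : ℝ) ^ k) • ((2 : ℝ) ^ k)⁻¹ • ξ = ξ := fun ξ => by
    rw [smul_smul, mul_inv_cancel₀ (by positivity), one_smul]
  simp only [h2] at h1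
  simp only [dil_apply, h1, inner_smul_left, inner_smul_right, Complex.real_smul]
  push_cast
  simp
  ring

/-! ### Weighted L² bounds for the kernels -/

lemma checkS_decay (u : 𝓢(Rn n, ℂ)) (K : ℕ) :
    ∃ C : ℝ, 0 ≤ C ∧ ∀ x, ‖checkS u x‖ ≤ C * ((1 + ‖x‖) ^ K)⁻¹ := by
  have h := fun x => SchwartzMap.one_add_le_sup_seminorm_apply (𝕜 := ℂ) (m := (K, 0)) (k := K)
    (n := 0) le_rfl le_rfl (checkS u) x
  simp only [norm_iteratedFDeriv_zero] at h
  refine ⟨2 ^ K * ((Finset.Iic (K, 0)).sup fun m => SchwartzMap.seminorm ℂ m.1 m.2) (checkS u),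
    ?_, fun x => ?_⟩
  · positivity
  · rw [← div_eq_mul_inv, le_div_iff₀ (by positivity), mul_comm]
    exact h x

lemma lintegral_one_add_norm_inv_lt_top {K : ℕ} (hK : n < K) :
    ∫⁻ x : Rn n, ENNReal.ofReal (((1 + ‖x‖) ^ K)⁻¹) < ∞ := by
  have h := finite_integral_one_add_norm (μ := (volume : Measure (Rn n))) (r := (K : ℝ))
    (by rw [finrank_Rn]; exact_mod_cast hK)
  refine lt_of_le_of_lt (lintegral_mono fun x => ?_) h
  rw [Real.rpow_neg (by positivity), Real.rpow_natCast]

lemma lintegral_checkS_sq_weight_lt_top (u : 𝓢(Rn n, ℂ)) (K : ℕ) :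
    ∫⁻ s, ‖checkS u s‖ₑ ^ 2 * ENNReal.ofReal ((1 + ‖s‖) ^ K) < ∞ := by
  -- After squaring, one factor of this order absorbs the weight and leaves (1+‖s‖)^{-(n+1)}; the
  -- other is simply at most 1.
  obtain ⟨C, hC0, hC⟩ := checkS_decay u (K + n + 1)
  have hle : ∀ s : Rn n, ‖checkS u s‖ₑ ^ 2 * ENNReal.ofReal ((1 + ‖s‖) ^ K) ≤
      ENNReal.ofReal (C ^ 2) * ENNReal.ofReal (((1 + ‖s‖) ^ (n + 1))⁻¹) := by
    intro s
    rw [← ofReal_norm, ← ENNReal.ofReal_pow (norm_nonneg _),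
      ← ENNReal.ofReal_mul (by positivity), ← ENNReal.ofReal_mul (by positivity)]
    refine ENNReal.ofReal_le_ofReal ?_
    have h1 : 1 ≤ 1 + ‖s‖ := by linarith [norm_nonneg s]
    have hp : 0 < 1 + ‖s‖ := by linarith
    have h2 := hC s
    calc ‖checkS u s‖ ^ 2 * (1 + ‖s‖) ^ K
        ≤ (C * ((1 + ‖s‖) ^ (K + n + 1))⁻¹) ^ 2 * (1 + ‖s‖) ^ K := by gcongr
      _ = C ^ 2 * (((1 + ‖s‖) ^ (n + 1))⁻¹ * ((1 + ‖s‖) ^ (K + n + 1))⁻¹) := by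
          field_simp; ring
      _ ≤ C ^ 2 * (((1 + ‖s‖) ^ (n + 1))⁻¹ * 1) := by
          gcongr; exact inv_le_one_of_one_le₀ (one_le_pow₀ h1)
      _ = _ := by ring
  refine lt_of_le_of_lt (lintegral_mono hle) ?_
  rw [lintegral_const_mul' _ _ ENNReal.ofReal_ne_top]
  exact ENNReal.mul_lt_top ENNReal.ofReal_lt_top (lintegral_one_add_norm_inv_lt_top (by omega))

/-- The dilated kernel has height 2^{kn} and width 2^{-k}, so its squared L² norm grows like 2^{kn}.
Concentration towards the origin only helps the weight, so no further power of 2^k appears. -/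
lemma lintegral_checkS_dil_sq_weight_le (u : 𝓢(Rn n, ℂ)) (k K : ℕ) :
    ∫⁻ s, ‖checkS (dil k u) s‖ₑ ^ 2 * ENNReal.ofReal ((1 + ‖s‖) ^ K) ≤
      ENNReal.ofReal (((2 : ℝ) ^ k) ^ n) *
        ∫⁻ s, ‖checkS u s‖ₑ ^ 2 * ENNReal.ofReal ((1 + ‖s‖) ^ K) := by
  set g : Rn n → ℝ≥0∞ := fun s => ‖checkS u s‖ₑ ^ 2 * ENNReal.ofReal ((1 + ‖s‖) ^ K) with hg
  have hgm : Measurable g := by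
    have := (checkS u).continuous.measurable
    fun_prop
  have h2 : (0 : ℝ) < (2 : ℝ) ^ k := by positivity
  have hle : ∀ s : Rn n, ‖checkS (dil k u) s‖ₑ ^ 2 * ENNReal.ofReal ((1 + ‖s‖) ^ K) ≤
      ENNReal.ofReal ((((2 : ℝ) ^ k) ^ n) ^ 2) * g ((2 : ℝ) ^ k • s) := by
    intro s
    rw [hg, checkS_dil, enorm_mul, mul_pow]
    have : ‖((2 : ℂ) ^ k) ^ n‖ₑ = ENNReal.ofReal (((2 : ℝ) ^ k) ^ n) := by
      rw [← ofReal_norm]; simp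
    rw [this, ← ENNReal.ofReal_pow (by positivity), mul_assoc]
    gcongr
    beta_reduce
    gcongr
    rw [norm_smul, Real.norm_of_nonneg h2.le]
    exact le_mul_of_one_le_left (norm_nonneg _) (one_le_pow₀ one_le_two)
  refine (lintegral_mono hle).trans (le_of_eq ?_)
  rw [lintegral_const_mul' _ _ ENNReal.ofReal_ne_top, lintegral_comp_smul_Rn hgm h2.ne', ← mul_assoc,
    ← ENNReal.ofReal_mul (by positivity)]
  congr 2
  rw [abs_of_pos (by positivity)]
  field_simp

/-! ### Plancherel's theorem -/

open scoped FourierTransform in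
/-- Plancherel's theorem for integrable functions in `L²`, Mathlib's normalization. -/
lemma lintegral_enorm_fourier_sq {u : Rn n → ℂ} (hu : Integrable u) (hu2 : MemLp u 2) :
    ∫⁻ ξ, ‖𝓕 u ξ‖ₑ ^ 2 = ∫⁻ x, ‖u x‖ₑ ^ 2 := by
  have hcont : Continuous (𝓕 u) := VectorFourier.fourierIntegral_continuous Real.continuous_fourierChar
    (by exact continuous_inner) hu
  set U : Lp ℂ 2 (volume : Measure (Rn n)) := hu2.toLp u with hU
  -- The integral transform and the L² transform agree because both move onto a smooth compactly
  -- supported test function, the first by Fubini and the second by definition as a distribution.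
  have hae : ∀ᵐ ξ, 𝓕 u ξ = (𝓕 U : Lp ℂ 2 (volume : Measure (Rn n))) ξ := by
    refine ae_eq_of_integral_contDiff_smul_eq hcont.locallyIntegrable
      ((Lp.memLp _).locallyIntegrable (by norm_num)) fun g hg hgc => ?_
    have hgc' : HasCompactSupport (fun x => (g x : ℂ)) := hgc.comp_left (g := Complex.ofReal) (by simp)
    have hg' : ContDiff ℝ (⊤ : ℕ∞) (fun x => (g x : ℂ)) := Complex.ofRealCLM.contDiff.comp hg
    set G : 𝓢(Rn n, ℂ) := hgc'.toSchwartzMap hg' with hG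
    have hGa : ∀ x, G x = g x := fun x => rfl
    have h1 := congrArg (fun T => T G) (Lp.fourier_toTemperedDistribution_eq U)
    simp only [TemperedDistribution.fourier_apply, Lp.toTemperedDistribution_apply] at h1
    have h2 : ∫ x, g x • 𝓕 u x = ∫ x, G x • 𝓕 u x := by
      simp [hGa]
    have h3 : ∫ x, g x • (𝓕 U : Lp ℂ 2 (volume : Measure (Rn n))) x =
        ∫ x, G x • (𝓕 U : Lp ℂ 2 (volume : Measure (Rn n))) x := by
      simp [hGa]
    rw [h2, h3, ← h1]
    have h4 : ∫ x, (𝓕 G) x • U x = ∫ x, (𝓕 G) x • u x := by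
      refine integral_congr_ae ?_
      filter_upwards [hu2.coeFn_toLp] with x hx
      rw [hx]
    rw [h4, SchwartzMap.fourier_coe]
    have h5 := VectorFourier.integral_fourierIntegral_smul_eq_flip (L := innerₗ (Rn n))
      (f := (G : Rn n → ℂ)) (g := u) (μ := volume) (ν := volume) Real.continuous_fourierChar
      (by exact continuous_inner) G.integrable hu
    rw [flip_innerₗ] at h5
    exact h5.symm
  have h6 : eLpNorm (𝓕 u) 2 = eLpNorm u 2 := by
    rw [eLpNorm_congr_ae hae, ← eLpNorm_congr_ae hu2.coeFn_toLp]
    have := Lp.norm_fourier_eq U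
    simp only [Lp.norm_def] at this
    exact (ENNReal.toReal_eq_toReal_iff' (Lp.eLpNorm_ne_top _) (Lp.eLpNorm_ne_top _)).1 this
  have h7 := fun v : Rn n → ℂ => eLpNorm_eq_lintegral_rpow_enorm_toReal (f := v) (μ := volume) (p := 2)
    (by norm_num) (by norm_num)
  rw [h7, h7] at h6
  have := (ENNReal.rpow_left_injective (x := 1 / (2 : ℝ≥0∞).toReal) (by norm_num)) h6
  simpa using this

/-- Plancherel's theorem with the phase `e^{ip·s}`. -/
lemma lintegral_enorm_osc_sq {u : Rn n → ℂ} (hu : Integrable u) (hu2 : MemLp u 2) :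
    ∫⁻ p, ‖∫ s, osc (inner ℝ p s) * u s‖ₑ ^ 2 =
      ENNReal.ofReal ((2 * Real.pi) ^ n) * ∫⁻ s, ‖u s‖ₑ ^ 2 := by
  rw [← lintegral_enorm_fourier_sq hu hu2]
  set g : Rn n → ℝ≥0∞ := fun p => ‖∫ s, osc (inner ℝ p s) * u s‖ₑ ^ 2
  have hc : Continuous fun p : Rn n => ∫ s, osc (inner ℝ p s) * u s := by
    refine continuous_of_dominated (bound := fun s => ‖u s‖) (fun p => ?_) (fun p => ?_) hu.norm ?_
    · exact (Continuous.aestronglyMeasurable (by fun_prop)).mul hu.aestronglyMeasurable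
    · exact .of_forall fun s => by simp [norm_osc]
    · exact .of_forall fun s => by fun_prop
  have hg : Measurable g := by
    have := hc.measurable
    fun_prop
  have h := lintegral_comp_smul_Rn hg (R := -(2 * Real.pi)) (by simp [Real.pi_ne_zero])
  have h2 : ∀ ξ : Rn n, g ((-(2 * Real.pi)) • ξ) = ‖FourierTransform.fourier u ξ‖ₑ ^ 2 := by
    intro ξ
    simp only [g, Real.fourier_eq']
    congr 2
    refine integral_congr_ae (.of_forall fun s => ?_)
    simp only [osc, smul_eq_mul, inner_smul_left]
    rw [real_inner_comm, mul_comm Complex.I]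
    simp
  simp only [h2] at h
  rw [h, ← mul_assoc, ← ENNReal.ofReal_mul (by positivity), abs_inv, abs_pow, abs_neg,
    abs_of_pos (by positivity), mul_inv_cancel₀ (by positivity), ENNReal.ofReal_one, one_mul]

/-! ### Unit cubes and averaging over translates -/

lemma measurableSet_unitCube : MeasurableSet (unitCube n) := by
  have : unitCube n = ⋂ i, {x : Rn n | x i ∈ Set.Ico (-1 / 2 : ℝ) (1 / 2)} := by
    ext x; simp [unitCube]
  rw [this]
  refine MeasurableSet.iInter fun i => ?_
  have : Measurable fun x : Rn n => x i := by fun_prop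
  exact this measurableSet_Ico

lemma volume_unitCube : volume (unitCube n) = 1 := by
  have h := (EuclideanSpace.volume_preserving_symm_measurableEquiv_toLp (Fin n)).symm
  have h2 : unitCube n = (MeasurableEquiv.toLp 2 (Fin n → ℝ)).symm ⁻¹'
      (Set.univ.pi fun _ => Set.Ico (-1 / 2 : ℝ) (1 / 2)) := by
    ext x; simp [unitCube]
  rw [h2, (EuclideanSpace.volume_preserving_symm_measurableEquiv_toLp (Fin n)).measure_preimage
    (MeasurableSet.univ_pi fun _ => measurableSet_Ico).nullMeasurableSet, Real.volume_pi_Ico]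
  norm_num

lemma norm_le_of_mem_unitCube {x : Rn n} (hx : x ∈ unitCube n) : ‖x‖ ≤ n := by
  have h1 : ‖x‖ ^ 2 ≤ (n : ℝ) ^ 2 := by
    rw [EuclideanSpace.norm_sq_eq]
    calc ∑ i, ‖x i‖ ^ 2 ≤ ∑ _i : Fin n, (1 : ℝ) := by
          refine Finset.sum_le_sum fun i _ => ?_
          have := hx i
          rw [Real.norm_eq_abs, sq_abs]
          nlinarith [this.1, this.2]
      _ = n := by simp
      _ ≤ (n : ℝ) ^ 2 := by exact_mod_cast Nat.le_self_pow two_ne_zero n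
  exact abs_le_of_sq_le_sq' h1 (Nat.cast_nonneg n) |>.2

/-- The unit cube of the phase space. -/
abbrev phaseCube (n : ℕ) : Set (Phase n) := unitCube n ×ˢ unitCube n ×ˢ unitCube n

lemma measurableSet_phaseCube : MeasurableSet (phaseCube n) :=
  measurableSet_unitCube.prod (measurableSet_unitCube.prod measurableSet_unitCube)

lemma volume_phaseCube : volume (phaseCube n) = 1 := by
  rw [Measure.volume_eq_prod, Measure.prod_prod, Measure.volume_eq_prod, Measure.prod_prod]
  simp [volume_unitCube]

instance isAddHaarMeasure_Rn_prod : (volume : Measure (Rn n × Rn n)).IsAddHaarMeasure :=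
  inferInstanceAs (((volume : Measure (Rn n)).prod (volume : Measure (Rn n))).IsAddHaarMeasure)

instance isAddHaarMeasure_phase : (volume : Measure (Phase n)).IsAddHaarMeasure :=
  Measure.prod.instIsAddHaarMeasure (volume : Measure (Rn n))
    ((volume : Measure (Rn n)).prod (volume : Measure (Rn n)))

/-- Tonelli and translation invariance. This continuous average replaces a tiling by lattice cubes,
so sums over cubes become integrals over their centres. -/
lemma lintegral_eq_lintegral_average {G : Type*} [AddCommGroup G] [MeasurableSpace G]
    [MeasurableAdd₂ G] {μ : Measure G} [SFinite μ] [μ.IsAddLeftInvariant]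
    {S : Set G} (hS : μ S = 1) {f : G → ℝ≥0∞} (hf : Measurable f) :
    ∫⁻ x, f x ∂μ = ∫⁻ p, ∫⁻ x in S, f (p + x) ∂μ ∂μ := by
  rw [lintegral_lintegral_swap (by fun_prop)]
  simp_rw [add_comm _ (_ : G), lintegral_add_left_eq_self]
  simp [hS]

/-! ### Cauchy–Schwarz on cubes and the trilinear estimate -/

lemma rpow_half_sq (x : ℝ≥0∞) : (x ^ (1 / 2 : ℝ)) ^ 2 = x := by
  rw [← ENNReal.rpow_natCast, ← ENNReal.rpow_mul]; norm_num

lemma sq_rpow_half (x : ℝ≥0∞) : (x ^ 2) ^ (1 / 2 : ℝ) = x := by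
  rw [← ENNReal.rpow_natCast, ← ENNReal.rpow_mul]; norm_num

lemma lintegral_mul_le_sqrt {α : Type*} [MeasurableSpace α] {μ : Measure α} {f g : α → ℝ≥0∞}
    (hf : AEMeasurable f μ) (hg : AEMeasurable g μ) :
    ∫⁻ a, f a * g a ∂μ ≤ (∫⁻ a, f a ^ 2 ∂μ) ^ (1 / 2 : ℝ) * (∫⁻ a, g a ^ 2 ∂μ) ^ (1 / 2 : ℝ) := by
  have := ENNReal.lintegral_mul_le_Lp_mul_Lq μ Real.HolderConjugate.two_two hf hg
  simpa using this

/-- Weighted Cauchy–Schwarz inequality for the trilinear form with kernel `Γ(μ+ν)`. -/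
lemma lintegral_sqrt_convolution_le {α β Γ w v : Rn n → ℝ≥0∞} (hα : Measurable α)
    (hβ : Measurable β) (hΓ : Measurable Γ) (hw : Measurable w) (hv : Measurable v)
    (hw0 : ∀ x, w x ≠ 0) (hw1 : ∀ x, w x ≠ ∞) (hv0 : ∀ x, v x ≠ 0) (hv1 : ∀ x, v x ≠ ∞)
    {D : ℝ≥0∞} (hD : ∀ τ, ∫⁻ μ, (w μ)⁻¹ * (v (τ - μ))⁻¹ ≤ D) :
    ∫⁻ p : Rn n × Rn n, (Γ (p.1 + p.2) * (α p.1 * β p.2)) ^ (1 / 2 : ℝ) ≤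
      ((∫⁻ μ, w μ * α μ) * ∫⁻ ν, v ν * β ν) ^ (1 / 2 : ℝ) * (D * ∫⁻ τ, Γ τ) ^ (1 / 2 : ℝ) := by
  have h1 : ∀ p : Rn n × Rn n, (Γ (p.1 + p.2) * (α p.1 * β p.2)) ^ (1 / 2 : ℝ) =
      ((w p.1 * α p.1) * (v p.2 * β p.2)) ^ (1 / 2 : ℝ) *
        (Γ (p.1 + p.2) * ((w p.1)⁻¹ * (v p.2)⁻¹)) ^ (1 / 2 : ℝ) := by
    intro p
    rw [← ENNReal.mul_rpow_of_nonneg _ _ (by norm_num : (0 : ℝ) ≤ 1 / 2)]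
    congr 1
    calc Γ (p.1 + p.2) * (α p.1 * β p.2)
        = (w p.1 * (w p.1)⁻¹) * (v p.2 * (v p.2)⁻¹) * (Γ (p.1 + p.2) * (α p.1 * β p.2)) := by
          rw [ENNReal.mul_inv_cancel (hw0 _) (hw1 _), ENNReal.mul_inv_cancel (hv0 _) (hv1 _)]; simp
      _ = _ := by ring
  simp_rw [h1]
  refine (lintegral_mul_le_sqrt (by fun_prop) (by fun_prop)).trans ?_
  simp_rw [rpow_half_sq]
  rw [Measure.volume_eq_prod, lintegral_prod_mul (f := fun x => w x * α x)
    (g := fun x => v x * β x) (by fun_prop) (by fun_prop)]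
  gcongr
  rw [lintegral_prod _ (by fun_prop)]
  -- With τ = μ + ν the kernel separates, and the inverse weights appear as a convolution at τ.
  calc ∫⁻ μ, ∫⁻ ν, Γ (μ + ν) * ((w μ)⁻¹ * (v ν)⁻¹)
      = ∫⁻ μ, ∫⁻ τ, Γ τ * ((w μ)⁻¹ * (v (τ - μ))⁻¹) := by
        refine lintegral_congr fun μ => ?_
        rw [← lintegral_add_left_eq_self (μ := volume) (fun τ => Γ τ * ((w μ)⁻¹ * (v (τ - μ))⁻¹)) μ]
        simp
    _ = ∫⁻ τ, ∫⁻ μ, Γ τ * ((w μ)⁻¹ * (v (τ - μ))⁻¹) := lintegral_lintegral_swap (by fun_prop)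
    _ = ∫⁻ τ, Γ τ * ∫⁻ μ, (w μ)⁻¹ * (v (τ - μ))⁻¹ := by
        refine lintegral_congr fun τ => ?_
        rw [lintegral_const_mul _ (by fun_prop)]
    _ ≤ ∫⁻ τ, Γ τ * D := by gcongr with τ; exact hD τ
    _ = D * ∫⁻ τ, Γ τ := by rw [lintegral_mul_const _ hΓ, mul_comm]

/-- The trilinear estimate on unit cubes: `F` enters only through its uniformly local `L²` norm. -/
lemma lintegral_trilinear_le {F : Phase n → ℝ≥0∞} {G Γ : Rn n → Rn n → ℝ≥0∞}
    {a b w v : Rn n → ℝ≥0∞} (hF : Measurable F) (hG : Measurable (Function.uncurry G))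
    (hΓm : Measurable (Function.uncurry Γ)) (ha : Measurable a) (hb : Measurable b)
    (hw : Measurable w) (hv : Measurable v)
    (hw0 : ∀ x, w x ≠ 0) (hw1 : ∀ x, w x ≠ ∞) (hv0 : ∀ x, v x ≠ 0) (hv1 : ∀ x, v x ≠ ∞)
    {D M : ℝ≥0∞} (hD : ∀ τ, ∫⁻ μ, (w μ)⁻¹ * (v (τ - μ))⁻¹ ≤ D)
    (hM : ∀ Z, ∫⁻ Y in phaseCube n, F (Z + Y) ^ 2 ≤ M ^ 2)
    (hΓ : ∀ y ζ e, ‖e‖ ≤ 2 * n → G y (ζ + e) ^ 2 ≤ Γ y ζ) :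
    ∫⁻ X : Phase n, F X * (G X.1 (X.2.1 + X.2.2) * (a X.2.1 * b X.2.2)) ≤
      M * (((∫⁻ μ, w μ * ∫⁻ x in unitCube n, a (μ + x) ^ 2) *
        ∫⁻ ν, v ν * ∫⁻ x in unitCube n, b (ν + x) ^ 2) ^ (1 / 2 : ℝ) * D ^ (1 / 2 : ℝ)) *
        ∫⁻ z, (∫⁻ y in unitCube n, ∫⁻ τ, Γ (z + y) τ) ^ (1 / 2 : ℝ) := by
  set α : Rn n → ℝ≥0∞ := fun μ => ∫⁻ x in unitCube n, a (μ + x) ^ 2 with hα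
  set β : Rn n → ℝ≥0∞ := fun μ => ∫⁻ x in unitCube n, b (μ + x) ^ 2 with hβ
  set T : Rn n → Rn n → ℝ≥0∞ := fun z τ => ∫⁻ y in unitCube n, Γ (z + y) τ with hT
  have hαm : Measurable α := Measurable.lintegral_prod_right' (f := fun p : Rn n × Rn n =>
    a (p.1 + p.2) ^ 2) (by fun_prop)
  have hβm : Measurable β := Measurable.lintegral_prod_right' (f := fun p : Rn n × Rn n =>
    b (p.1 + p.2) ^ 2) (by fun_prop)
  have hTm : Measurable (Function.uncurry T) := Measurable.lintegral_prod_right'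
    (f := fun p : (Rn n × Rn n) × Rn n => Γ (p.1.1 + p.2) p.1.2)
    (hΓm.comp (f := fun p : (Rn n × Rn n) × Rn n => (p.1.1 + p.2, p.1.2)) (by fun_prop))
  have hGm : Measurable fun X : Phase n => G X.1 (X.2.1 + X.2.2) :=
    hG.comp (f := fun X : Phase n => (X.1, X.2.1 + X.2.2)) (by fun_prop)
  have hR : Measurable fun X : Phase n => G X.1 (X.2.1 + X.2.2) * (a X.2.1 * b X.2.2) := by
    fun_prop
  have hloc : ∀ Z : Phase n, ∫⁻ Y in phaseCube n,
      (G (Z + Y).1 ((Z + Y).2.1 + (Z + Y).2.2) * (a (Z + Y).2.1 * b (Z + Y).2.2)) ^ 2 ≤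
        T Z.1 (Z.2.1 + Z.2.2) * (α Z.2.1 * β Z.2.2) := by
    intro Z
    calc ∫⁻ Y in phaseCube n,
      (G (Z + Y).1 ((Z + Y).2.1 + (Z + Y).2.2) * (a (Z + Y).2.1 * b (Z + Y).2.2)) ^ 2
        ≤ ∫⁻ Y in phaseCube n, Γ (Z.1 + Y.1) (Z.2.1 + Z.2.2) *
            (a (Z.2.1 + Y.2.1) ^ 2 * b (Z.2.2 + Y.2.2) ^ 2) := by
          refine setLIntegral_mono' measurableSet_phaseCube fun Y hY => ?_
          rw [mul_pow, mul_pow]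
          refine mul_le_mul_left ?_ _
          -- The two offsets inside the frequency cubes add up to a vector of norm at most `2 * n`,
          -- which explains the range of `e` in `hΓ`.
          have := hΓ (Z.1 + Y.1) (Z.2.1 + Z.2.2) (Y.2.1 + Y.2.2) ?_
          · simpa [add_add_add_comm] using this
          · calc ‖Y.2.1 + Y.2.2‖ ≤ ‖Y.2.1‖ + ‖Y.2.2‖ := norm_add_le _ _
              _ ≤ n + n := add_le_add (norm_le_of_mem_unitCube hY.2.1)
                  (norm_le_of_mem_unitCube hY.2.2)
              _ = 2 * n := by ring
      _ = T Z.1 (Z.2.1 + Z.2.2) * (α Z.2.1 * β Z.2.2) := by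
          rw [Measure.volume_eq_prod, ← Measure.prod_restrict, Measure.volume_eq_prod,
            ← Measure.prod_restrict]
          rw [lintegral_prod_mul (f := fun y => Γ (Z.1 + y) (Z.2.1 + Z.2.2))
            (g := fun y : Rn n × Rn n => a (Z.2.1 + y.1) ^ 2 * b (Z.2.2 + y.2) ^ 2)
            (Measurable.aemeasurable (hΓm.comp (f := fun y => (Z.1 + y, Z.2.1 + Z.2.2))
              (by fun_prop))) (by fun_prop)]
          rw [lintegral_prod_mul (f := fun y => a (Z.2.1 + y) ^ 2) (g := fun y => b (Z.2.2 + y) ^ 2)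
            (by fun_prop) (by fun_prop)]
  have hTm2 : ∀ z, Measurable (T z) := fun z => hTm.comp (f := fun τ => (z, τ)) (by fun_prop)
  have hTm3 : Measurable fun Z : Phase n => T Z.1 (Z.2.1 + Z.2.2) :=
    hTm.comp (f := fun X : Phase n => (X.1, X.2.1 + X.2.2)) (by fun_prop)
  have hTint : ∀ z, ∫⁻ τ, T z τ = ∫⁻ y in unitCube n, ∫⁻ τ, Γ (z + y) τ := fun z =>
    lintegral_lintegral_swap (Measurable.aemeasurable
      (hΓm.comp (f := fun p : Rn n × Rn n => (z + p.2, p.1)) (by fun_prop)))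
  rw [lintegral_eq_lintegral_average volume_phaseCube (by fun_prop)]
  calc ∫⁻ Z : Phase n, ∫⁻ Y in phaseCube n, F (Z + Y) *
        (G (Z + Y).1 ((Z + Y).2.1 + (Z + Y).2.2) * (a (Z + Y).2.1 * b (Z + Y).2.2))
      ≤ ∫⁻ Z : Phase n, M * (T Z.1 (Z.2.1 + Z.2.2) * (α Z.2.1 * β Z.2.2)) ^ (1 / 2 : ℝ) := by
        refine lintegral_mono fun Z => ?_
        refine (lintegral_mul_le_sqrt (Measurable.aemeasurable (by fun_prop))
          (hR.comp (measurable_const_add Z)).aemeasurable).trans ?_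
        refine mul_le_mul' ?_ (ENNReal.rpow_le_rpow (hloc Z) (by norm_num))
        rw [← sq_rpow_half M]
        exact ENNReal.rpow_le_rpow (hM Z) (by norm_num)
    _ = M * ∫⁻ z, ∫⁻ p : Rn n × Rn n,
          (T z (p.1 + p.2) * (α p.1 * β p.2)) ^ (1 / 2 : ℝ) := by
        rw [lintegral_const_mul _ (by fun_prop), Measure.volume_eq_prod,
          lintegral_prod _ (Measurable.aemeasurable (by fun_prop))]
    _ ≤ M * ∫⁻ z, ((∫⁻ μ, w μ * α μ) * ∫⁻ ν, v ν * β ν) ^ (1 / 2 : ℝ) *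
          (D * ∫⁻ τ, T z τ) ^ (1 / 2 : ℝ) := by
        gcongr with z
        exact lintegral_sqrt_convolution_le hαm hβm (hTm2 z) hw hv hw0 hw1 hv0 hv1 hD
    _ = _ := by
        simp_rw [ENNReal.mul_rpow_of_nonneg _ _ (by norm_num : (0 : ℝ) ≤ 1 / 2), ← mul_assoc]
        have hmeas : Measurable fun z => ∫⁻ τ, T z τ := Measurable.lintegral_prod_right' hTm
        rw [lintegral_const_mul _ (by fun_prop)]
        simp_rw [hTint]
        ring

/-- The square roots of the local averages of `g` around `p` sum to a weighted `L²` norm of `g`. -/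
lemma lintegral_sqrt_local_le {g : Rn n → ℝ≥0∞} (hg : Measurable g) (p : Rn n) :
    ∫⁻ z, (∫⁻ y in unitCube n, ∫⁻ x in unitCube n, g (p + x - (z + y))) ^ (1 / 2 : ℝ) ≤
      ((∫⁻ x : Rn n, ENNReal.ofReal (((1 + ‖x‖) ^ (n + 1))⁻¹)) *
        (ENNReal.ofReal ((1 + 2 * n) ^ (n + 1)) *
          ∫⁻ u, g u * ENNReal.ofReal ((1 + ‖u‖) ^ (n + 1)))) ^ (1 / 2 : ℝ) := by
  set W : Rn n → ℝ≥0∞ := fun x => ENNReal.ofReal ((1 + ‖x‖) ^ (n + 1)) with hW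
  have hWm : Measurable W := by fun_prop
  have hWpos : ∀ x : Rn n, 0 < (1 + ‖x‖) ^ (n + 1) := fun x => by positivity
  have hW0 : ∀ x, W x ≠ 0 := fun x => by simpa [hW] using hWpos x
  have hW1 : ∀ x, W x ≠ ∞ := fun x => ENNReal.ofReal_ne_top
  have hWinv : ∀ x : Rn n, ENNReal.ofReal (((1 + ‖x‖) ^ (n + 1))⁻¹) = (W x)⁻¹ := fun x =>
    ENNReal.ofReal_inv_of_pos (hWpos x)
  set H : Rn n → ℝ≥0∞ := fun z => ∫⁻ y in unitCube n, ∫⁻ x in unitCube n, g (p + x - (z + y)) with hH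
  have hm1 : Measurable fun q : Rn n × Rn n => ∫⁻ x in unitCube n, g (p + x - (q.1 + q.2)) :=
    Measurable.lintegral_prod_right' (f := fun r : (Rn n × Rn n) × Rn n =>
      g (p + r.2 - (r.1.1 + r.1.2))) (by fun_prop)
  have hHm : Measurable H := Measurable.lintegral_prod_right' hm1
  -- Inserting W(z-p) and its inverse trades the integral of a square root for a weighted integral
  -- of `H`, since the inverse weight is integrable.
  calc ∫⁻ z, H z ^ (1 / 2 : ℝ)
      = ∫⁻ z, ((W (z - p))⁻¹) ^ (1 / 2 : ℝ) * (H z * W (z - p)) ^ (1 / 2 : ℝ) := by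
        refine lintegral_congr fun z => ?_
        rw [← ENNReal.mul_rpow_of_nonneg _ _ (by norm_num : (0 : ℝ) ≤ 1 / 2)]
        congr 1
        rw [mul_comm (H z), ← mul_assoc, ENNReal.inv_mul_cancel (hW0 _) (hW1 _), one_mul]
    _ ≤ (∫⁻ z, (W (z - p))⁻¹) ^ (1 / 2 : ℝ) * (∫⁻ z, H z * W (z - p)) ^ (1 / 2 : ℝ) := by
        refine (lintegral_mul_le_sqrt (by fun_prop) (by fun_prop)).trans ?_
        simp_rw [rpow_half_sq]
        rfl
    _ ≤ _ := by
        rw [← ENNReal.mul_rpow_of_nonneg _ _ (by norm_num : (0 : ℝ) ≤ 1 / 2)]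
        refine ENNReal.rpow_le_rpow ?_ (by norm_num)
        rw [lintegral_sub_right_eq_self (fun z => (W z)⁻¹) p]
        simp_rw [hWinv]
        gcongr
        calc ∫⁻ z, H z * W (z - p)
            = ∫⁻ z, ∫⁻ y in unitCube n, ∫⁻ x in unitCube n, g (p + x - (z + y)) * W (z - p) := by
              refine lintegral_congr fun z => ?_
              have hm2 : Measurable fun y => ∫⁻ x in unitCube n, g (p + x - (z + y)) :=
                hm1.comp (f := fun y => (z, y)) (by fun_prop)
              simp only [hH]
              rw [← lintegral_mul_const _ hm2]
              refine lintegral_congr fun y => ?_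
              rw [lintegral_mul_const _ (by fun_prop)]
          _ = ∫⁻ y in unitCube n, ∫⁻ z, ∫⁻ x in unitCube n, g (p + x - (z + y)) * W (z - p) := by
              refine lintegral_lintegral_swap (Measurable.aemeasurable ?_)
              exact Measurable.lintegral_prod_right' (f := fun r : (Rn n × Rn n) × Rn n =>
                g (p + r.2 - (r.1.1 + r.1.2)) * W (r.1.1 - p)) (by fun_prop)
          _ = ∫⁻ y in unitCube n, ∫⁻ x in unitCube n, ∫⁻ z, g (p + x - (z + y)) * W (z - p) := by
              refine lintegral_congr fun y => ?_
              exact lintegral_lintegral_swap (Measurable.aemeasurable (by fun_prop))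
          _ ≤ ∫⁻ y in unitCube n, ∫⁻ x in unitCube n,
                ENNReal.ofReal ((1 + 2 * n) ^ (n + 1)) * ∫⁻ u, g u * W u := by
              refine setLIntegral_mono' measurableSet_unitCube fun y hy => ?_
              refine setLIntegral_mono' measurableSet_unitCube fun x hx => ?_
              -- The reflection makes the argument of `g` equal to z and that of the weight equal to
              -- x-y-z. As x and y lie in the unit cube, this costs the factor 1+2n.
              rw [← lintegral_const_mul _ (by fun_prop),
                ← lintegral_sub_left_eq_self _ (p + x - y)]
              refine lintegral_mono fun z => ?_
              have hz : p + x - (p + x - y - z + y) = z := by abel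
              have hz2 : p + x - y - z - p = x - y - z := by abel
              rw [hz, hz2]
              rw [mul_left_comm]
              refine mul_le_mul' le_rfl ?_
              rw [hW, ← ENNReal.ofReal_mul (by positivity), ← mul_pow]
              refine ENNReal.ofReal_le_ofReal ?_
              gcongr
              have h1 := norm_le_of_mem_unitCube hx
              have h2 := norm_le_of_mem_unitCube hy
              have h3 : ‖x - y - z‖ ≤ ‖x‖ + ‖y‖ + ‖z‖ :=
                (norm_sub_le _ _).trans (add_le_add (norm_sub_le _ _) le_rfl)
              nlinarith [norm_nonneg z]
          _ = _ := by simp [volume_unitCube, hW]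

/-! ### Convolutions, and Fourier transforms of functions supported in a unit cube -/

lemma Integrable.mul_comp_sub {f g : Rn n → ℂ} (hf : Integrable f) (hg : Integrable g) :
    Integrable (fun p : Rn n × Rn n => f p.2 * g (p.1 - p.2))
      ((volume : Measure (Rn n)).prod volume) := by
  have h := (measurePreserving_sub_prod (volume : Measure (Rn n))
    (volume : Measure (Rn n))).integrable_comp_of_integrable (hg.mul_prod hf)
  refine h.congr (.of_forall fun p => ?_)
  simp [mul_comm]

lemma Integrable.mul_comp_add {f g : Rn n → ℂ} (hf : Integrable f) (hg : Integrable g) :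
    Integrable (fun p : Rn n × Rn n => f p.2 * g (p.1 + p.2))
      ((volume : Measure (Rn n)).prod volume) := by
  have h := (measurePreserving_add_prod (volume : Measure (Rn n))
    (volume : Measure (Rn n))).integrable_comp_of_integrable (hg.mul_prod hf)
  refine h.congr (.of_forall fun p => ?_)
  simp [mul_comm]

/-- The oscillatory integral `∫ e^{ix·ζ} u(x) dx`. -/
def oscInt (u : Rn n → ℂ) (ζ : Rn n) : ℂ := ∫ x, osc (inner ℝ x ζ) * u x

lemma continuous_oscInt {u : Rn n → ℂ} (hu : Integrable u) : Continuous (oscInt u) := by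
  refine continuous_of_dominated (bound := fun s => ‖u s‖) (fun p => ?_) (fun p => ?_) hu.norm ?_
  · exact (Continuous.aestronglyMeasurable (by fun_prop)).mul hu.aestronglyMeasurable
  · exact .of_forall fun s => by simp [norm_osc]
  · exact .of_forall fun s => by fun_prop

/-- A function supported in a unit cube has a Fourier transform which is reproduced by convolution
with an integrable kernel. -/
lemma oscInt_eq_convolution {u : Rn n → ℂ} (hu : Integrable u) {p : Rn n}
    (hsupp : ∀ x, u x ≠ 0 → x - p ∈ unitCube n) {v : 𝓢(Rn n, ℂ)} (hv : ∀ x, ‖x‖ ≤ n → v x = 1)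
    (ζ : Rn n) :
    oscInt u ζ = ∫ s, osc (inner ℝ p s) * checkS v s * oscInt u (ζ - s) := by
  have hint : Integrable (Function.uncurry fun (s x : Rn n) =>
      (checkS v s * u x) * (osc (inner ℝ p s) * osc (inner ℝ x (ζ - s))))
      ((volume : Measure (Rn n)).prod volume) := by
    refine ((checkS v).integrable.mul_prod hu).mul_bdd (c := 1) ?_ ?_
    · exact Continuous.aestronglyMeasurable (by fun_prop)
    · exact .of_forall fun p => by simp [norm_osc]
  calc oscInt u ζ = ∫ x, ∫ s, (checkS v s * u x) * (osc (inner ℝ p s) * osc (inner ℝ x (ζ - s))) := by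
        refine integral_congr_ae (.of_forall fun x => ?_)
        have : ∀ s, (checkS v s * u x) * (osc (inner ℝ p s) * osc (inner ℝ x (ζ - s))) =
            (osc (inner ℝ x ζ) * u x) * (osc (-inner ℝ s (x - p)) * checkS v s) := by
          intro s
          have : osc (inner ℝ p s) * osc (inner ℝ x (ζ - s)) =
              osc (inner ℝ x ζ) * osc (-inner ℝ s (x - p)) := by
            rw [← osc_add, ← osc_add]; congr 1
            rw [inner_sub_right, inner_sub_right, real_inner_comm p s, real_inner_comm x s]; ring
          rw [this]; ring
        simp only [this]
        rw [integral_const_mul, integral_osc_checkS]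
        by_cases hx : u x = 0
        · simp [hx]
        · rw [hv _ (norm_le_of_mem_unitCube (hsupp x hx)), mul_one]
    _ = ∫ s, ∫ x, (checkS v s * u x) * (osc (inner ℝ p s) * osc (inner ℝ x (ζ - s))) :=
        (integral_integral_swap hint).symm
    _ = _ := by
        refine integral_congr_ae (.of_forall fun s => ?_)
        simp only [oscInt]
        rw [← integral_const_mul]
        refine integral_congr_ae (.of_forall fun x => ?_)
        simp only; ring

/-- Local suprema of the Fourier transform of a function supported in a unit cube are dominated by
averages against a rapidly decreasing weight. -/
lemma exists_enorm_oscInt_add_sq_le {v : 𝓢(Rn n, ℂ)} (hv : ∀ x, ‖x‖ ≤ n → v x = 1) :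
    ∃ C : ℝ≥0, ∀ (u : Rn n → ℂ) (p : Rn n), Integrable u → (∀ x, u x ≠ 0 → x - p ∈ unitCube n) →
      ∀ ζ e : Rn n, ‖e‖ ≤ 2 * n → ‖oscInt u (ζ + e)‖ₑ ^ 2 ≤
        C * ∫⁻ s, ENNReal.ofReal (((1 + ‖s‖) ^ (n + 1))⁻¹) * ‖oscInt u (ζ - s)‖ₑ ^ 2 := by
  obtain ⟨C₀, hC0, hC⟩ := checkS_decay v (n + 1)
  set ω : Rn n → ℝ≥0∞ := fun s => ENNReal.ofReal (((1 + ‖s‖) ^ (n + 1))⁻¹) with hω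
  have hωm : Measurable ω := by fun_prop
  have hfin : ∫⁻ s, ω s < ∞ := lintegral_one_add_norm_inv_lt_top (Nat.lt_succ_self n)
  set C₁ : ℝ := C₀ * (1 + 2 * n) ^ (n + 1) with hC1
  refine ⟨((ENNReal.ofReal C₁) ^ 2 * ∫⁻ s, ω s).toNNReal, fun u p hu hsupp ζ e he => ?_⟩
  rw [ENNReal.coe_toNNReal (ENNReal.mul_ne_top (by simp) hfin.ne)]
  have hcont := continuous_oscInt hu
  have hm : Measurable fun s => ‖oscInt u (ζ - s)‖ₑ := by
    have := hcont.measurable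
    fun_prop
  have h1 : ‖oscInt u (ζ + e)‖ₑ ≤ ∫⁻ s, ‖checkS v (s + e)‖ₑ * ‖oscInt u (ζ - s)‖ₑ := by
    rw [oscInt_eq_convolution hu hsupp hv (ζ + e)]
    refine (enorm_integral_le_lintegral_enorm _).trans ?_
    rw [← lintegral_add_right_eq_self _ e]
    refine lintegral_mono fun s => ?_
    simp [enorm_mul, enorm_osc]
  have h2 : ∀ s, ‖checkS v (s + e)‖ₑ ≤ ENNReal.ofReal C₁ * ω s := by
    intro s
    rw [← ofReal_norm, hω, ← ENNReal.ofReal_mul (by positivity)]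
    refine ENNReal.ofReal_le_ofReal ((hC _).trans ?_)
    rw [hC1, mul_assoc]
    gcongr
    -- Shifting by a vector of norm at most 2n changes the weight only by a constant factor, so a
    -- single average controls all offsets `e`.
    have h3 : 1 + ‖s‖ ≤ (1 + 2 * n) * (1 + ‖s + e‖) := by
      have : ‖s‖ ≤ ‖s + e‖ + ‖e‖ := by simpa using norm_sub_le (s + e) e
      nlinarith [norm_nonneg (s + e), norm_nonneg e]
    rw [← div_eq_mul_inv, le_div_iff₀ (by positivity), inv_mul_le_iff₀ (by positivity), ← mul_pow,
      mul_comm (1 + ‖s + e‖)]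
    gcongr
  have h4 : ‖oscInt u (ζ + e)‖ₑ ≤ ENNReal.ofReal C₁ *
      ∫⁻ s, ω s ^ (1 / 2 : ℝ) * (ω s * ‖oscInt u (ζ - s)‖ₑ ^ 2) ^ (1 / 2 : ℝ) := by
    refine h1.trans ?_
    rw [← lintegral_const_mul _ (by fun_prop)]
    refine lintegral_mono fun s => ?_
    rw [← ENNReal.mul_rpow_of_nonneg _ _ (by norm_num : (0 : ℝ) ≤ 1 / 2), ← mul_assoc, ← sq,
      ← mul_pow, sq_rpow_half, ← mul_assoc]
    exact mul_le_mul_left (h2 s) _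
  calc ‖oscInt u (ζ + e)‖ₑ ^ 2
      ≤ (ENNReal.ofReal C₁ * ((∫⁻ s, ω s) ^ (1 / 2 : ℝ) *
          (∫⁻ s, ω s * ‖oscInt u (ζ - s)‖ₑ ^ 2) ^ (1 / 2 : ℝ))) ^ 2 := by
        gcongr
        refine h4.trans ?_
        gcongr
        refine (lintegral_mul_le_sqrt (by fun_prop) (by fun_prop)).trans ?_
        simp_rw [rpow_half_sq]
        rfl
    _ = _ := by
        rw [mul_pow, mul_pow, rpow_half_sq, rpow_half_sq, mul_assoc]

/-- The average is a convolution with an integrable weight, so its integral factors, and Plancherel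
evaluates the second factor. -/
lemma lintegral_oscInt_average {u : Rn n → ℂ} (hu : Integrable u) (hu2 : MemLp u 2) :
    ∫⁻ ζ, ∫⁻ s, ENNReal.ofReal (((1 + ‖s‖) ^ (n + 1))⁻¹) * ‖oscInt u (ζ - s)‖ₑ ^ 2 =
      (∫⁻ s : Rn n, ENNReal.ofReal (((1 + ‖s‖) ^ (n + 1))⁻¹)) *
        (ENNReal.ofReal ((2 * Real.pi) ^ n) * ∫⁻ x, ‖u x‖ₑ ^ 2) := by
  have hcont := continuous_oscInt hu
  have hm := hcont.measurable
  rw [lintegral_lintegral_swap (by fun_prop)]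
  have h : ∀ s, ∫⁻ ζ, ENNReal.ofReal (((1 + ‖s‖) ^ (n + 1))⁻¹) * ‖oscInt u (ζ - s)‖ₑ ^ 2 =
      ENNReal.ofReal (((1 + ‖s‖) ^ (n + 1))⁻¹) *
        (ENNReal.ofReal ((2 * Real.pi) ^ n) * ∫⁻ x, ‖u x‖ₑ ^ 2) := by
    intro s
    rw [lintegral_const_mul _ (by fun_prop),
      lintegral_sub_right_eq_self (fun ζ => ‖oscInt u ζ‖ₑ ^ 2) s, ← lintegral_enorm_osc_sq hu hu2]
    simp_rw [oscInt, real_inner_comm]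
  simp_rw [h]
  rw [lintegral_mul_const _ (by fun_prop)]

/-! ### Localization of the inputs around a centre -/

/-- Localization of the Fourier inverse of `a` around `p`, performed on the frequency side. -/
def localize (χ : 𝓢(Rn n, ℂ)) (p : Rn n) (a : Rn n → ℂ) (ξ : Rn n) : ℂ :=
  ∫ s, osc (inner ℝ p s) * (checkS χ s * a (ξ + s))

lemma measurable_localize (χ : 𝓢(Rn n, ℂ)) {a : Rn n → ℂ} (ha : Measurable a) :
    Measurable fun q : Rn n × Rn n => localize χ q.1 a q.2 := by
  have hχ := (checkS χ).continuous.measurable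
  have : Measurable fun q : (Rn n × Rn n) × Rn n =>
      osc (inner ℝ q.1.1 q.2) * (checkS χ q.2 * a (q.1.2 + q.2)) := by
    have := measurable_osc
    fun_prop
  exact (StronglyMeasurable.integral_prod_right' this.stronglyMeasurable).measurable

lemma integrable_localize (χ : 𝓢(Rn n, ℂ)) (p : Rn n) {a : Rn n → ℂ} (ha : Integrable a) :
    Integrable (localize χ p a) := by
  have h := Integrable.mul_comp_add (checkS χ).integrable ha
  have h2 := h.bdd_mul (c := 1) (f := fun q : Rn n × Rn n => osc (inner ℝ p q.2))
    (Continuous.aestronglyMeasurable (by fun_prop)) (.of_forall fun s => by simp [norm_osc])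
  exact h2.integral_prod_left

/-- For fixed ξ the localization is, as a function of p, the Fourier transform of s ↦ χ̌(s) a(ξ+s);
Plancherel applies because boundedness of `a` puts this product in L¹ ∩ L². -/
lemma lintegral_localize_sq (χ : 𝓢(Rn n, ℂ)) {a : Rn n → ℂ} (ha : Measurable a)
    {A : ℝ} (hA : ∀ x, ‖a x‖ ≤ A) (ξ : Rn n) :
    ∫⁻ p, ‖localize χ p a ξ‖ₑ ^ 2 =
      ENNReal.ofReal ((2 * Real.pi) ^ n) * ∫⁻ s, ‖checkS χ s‖ₑ ^ 2 * ‖a (ξ + s)‖ₑ ^ 2 := by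
  have hA' : AEStronglyMeasurable (fun s => a (ξ + s)) (volume : Measure (Rn n)) :=
    (ha.comp (measurable_const_add ξ)).aestronglyMeasurable
  have h1 : Integrable (fun s => checkS χ s * a (ξ + s)) :=
    (checkS χ).integrable.mul_bdd (c := A) hA' (.of_forall fun s => hA _)
  have h2 : MemLp (fun s => checkS χ s * a (ξ + s)) 2 := by
    have := (memLp_top_of_bound hA' A (.of_forall fun s => hA _)).mul ((checkS χ).memLp 2)
      (r := 2)
    exact this
  have := lintegral_enorm_osc_sq h1 h2
  simp only [enorm_mul] at this
  simp_rw [mul_pow (‖_‖ₑ)] at this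
  exact this

/-- Weighted `L²` bound for the localizations, integrated over all centres. -/
lemma lintegral_localize_weight_le (χ : 𝓢(Rn n, ℂ)) {a : Rn n → ℂ} (ha : Measurable a)
    {A : ℝ} (hA : ∀ x, ‖a x‖ ≤ A) {w : Rn n → ℝ≥0∞} (hw : Measurable w)
    {K : ℕ} (hwK : ∀ ξ s, w (ξ - s) ≤ ENNReal.ofReal ((1 + ‖s‖) ^ K) * w ξ) :
    ∫⁻ p, ∫⁻ μ, w μ * ∫⁻ x in unitCube n, ‖localize χ p a (μ + x)‖ₑ ^ 2 ≤
      ENNReal.ofReal ((1 + n) ^ K) * (ENNReal.ofReal ((2 * Real.pi) ^ n) *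
        ((∫⁻ s, ‖checkS χ s‖ₑ ^ 2 * ENNReal.ofReal ((1 + ‖s‖) ^ K)) * ∫⁻ ξ, w ξ * ‖a ξ‖ₑ ^ 2)) := by
  have hχ := (checkS χ).continuous.measurable
  have hL := measurable_localize χ ha
  have hL2 : ∀ p, Measurable (localize χ p a) := fun p => hL.comp (f := fun ξ => (p, ξ)) (by fun_prop)
  have h1 : ∀ p, ∫⁻ μ, w μ * ∫⁻ x in unitCube n, ‖localize χ p a (μ + x)‖ₑ ^ 2 ≤
      ENNReal.ofReal ((1 + n) ^ K) * ∫⁻ ξ, w ξ * ‖localize χ p a ξ‖ₑ ^ 2 := by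
    intro p
    have hLp := hL2 p
    calc ∫⁻ μ, w μ * ∫⁻ x in unitCube n, ‖localize χ p a (μ + x)‖ₑ ^ 2
        = ∫⁻ μ, ∫⁻ x in unitCube n, w μ * ‖localize χ p a (μ + x)‖ₑ ^ 2 := by
          refine lintegral_congr fun μ => ?_
          rw [lintegral_const_mul _ (by fun_prop)]
      _ = ∫⁻ x in unitCube n, ∫⁻ μ, w μ * ‖localize χ p a (μ + x)‖ₑ ^ 2 :=
          lintegral_lintegral_swap (by fun_prop)
      _ ≤ ∫⁻ x in unitCube n, ENNReal.ofReal ((1 + n) ^ K) *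
            ∫⁻ ξ, w ξ * ‖localize χ p a ξ‖ₑ ^ 2 := by
          refine setLIntegral_mono' measurableSet_unitCube fun x hx => ?_
          -- The average over the cube is undone by moving the shift onto the weight, which is
          -- moderate.
          rw [← lintegral_sub_right_eq_self _ x, ← lintegral_const_mul _ (by fun_prop)]
          refine lintegral_mono fun ξ => ?_
          rw [sub_add_cancel, ← mul_assoc]
          refine mul_le_mul_left ((hwK ξ x).trans ?_) _
          gcongr
          exact norm_le_of_mem_unitCube hx
      _ = _ := by simp [volume_unitCube]
  calc ∫⁻ p, ∫⁻ μ, w μ * ∫⁻ x in unitCube n, ‖localize χ p a (μ + x)‖ₑ ^ 2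
      ≤ ∫⁻ p, ENNReal.ofReal ((1 + n) ^ K) * ∫⁻ ξ, w ξ * ‖localize χ p a ξ‖ₑ ^ 2 := lintegral_mono h1
    _ = ENNReal.ofReal ((1 + n) ^ K) * ∫⁻ p, ∫⁻ ξ, w ξ * ‖localize χ p a ξ‖ₑ ^ 2 := by
        rw [lintegral_const_mul' _ _ ENNReal.ofReal_ne_top]
    _ = ENNReal.ofReal ((1 + n) ^ K) * ∫⁻ ξ, w ξ * ∫⁻ p, ‖localize χ p a ξ‖ₑ ^ 2 := by
        rw [lintegral_lintegral_swap (by fun_prop)]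
        congr 1
        refine lintegral_congr fun ξ => ?_
        rw [lintegral_const_mul _ (by fun_prop)]
    _ = ENNReal.ofReal ((1 + n) ^ K) * (ENNReal.ofReal ((2 * Real.pi) ^ n) *
          ∫⁻ ξ, ∫⁻ s, ‖checkS χ s‖ₑ ^ 2 * (w ξ * ‖a (ξ + s)‖ₑ ^ 2)) := by
        congr 1
        rw [← lintegral_const_mul' _ _ ENNReal.ofReal_ne_top]
        refine lintegral_congr fun ξ => ?_
        rw [lintegral_localize_sq χ ha hA, mul_left_comm, ← lintegral_const_mul _ (by fun_prop)]
        congr 1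
        refine lintegral_congr fun s => ?_
        ring
    _ = ENNReal.ofReal ((1 + n) ^ K) * (ENNReal.ofReal ((2 * Real.pi) ^ n) *
          ∫⁻ s, ∫⁻ ξ, ‖checkS χ s‖ₑ ^ 2 * (w ξ * ‖a (ξ + s)‖ₑ ^ 2)) := by
        rw [lintegral_lintegral_swap (by fun_prop)]
    _ ≤ ENNReal.ofReal ((1 + n) ^ K) * (ENNReal.ofReal ((2 * Real.pi) ^ n) *
          ∫⁻ s, ‖checkS χ s‖ₑ ^ 2 * ENNReal.ofReal ((1 + ‖s‖) ^ K) * ∫⁻ ξ, w ξ * ‖a ξ‖ₑ ^ 2) := by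
        gcongr with s
        rw [lintegral_const_mul _ (by fun_prop), mul_assoc]
        gcongr
        rw [← lintegral_sub_right_eq_self _ s, ← lintegral_const_mul _ (by fun_prop)]
        refine lintegral_mono fun ξ => ?_
        rw [sub_add_cancel, ← mul_assoc]
        exact mul_le_mul_left (hwK ξ s) _
    _ = _ := by rw [lintegral_mul_const _ (by fun_prop)]

/-- A bounded function which is reproduced by `ǔ` is reproduced by modulations of `v̌`. -/
lemma modulated_reproducing_bounded {m : Rn n → ℂ} (hm : Measurable m) {A : ℝ}
    (hA : ∀ x, ‖m x‖ ≤ A) {u v : 𝓢(Rn n, ℂ)} (hu : ∀ ξ, m ξ = ∫ y, checkS u y * m (ξ - y))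
    {q : Rn n} (h : ∀ ξ, v (ξ + q) * u ξ = u ξ) (ζ : Rn n) :
    ∫ s, osc (-inner ℝ q s) * checkS v s * m (ζ - s) = m ζ := by
  have hint : Integrable (Function.uncurry fun (t s : Rn n) =>
      osc (-inner ℝ q s) * ((checkS v s * checkS u (t - s)) * m (ζ - t)))
      ((volume : Measure (Rn n)).prod volume) := by
    have h1 := Integrable.mul_comp_sub (checkS v).integrable (checkS u).integrable
    refine (h1.mul_bdd (c := A) ?_ (.of_forall fun p => hA (ζ - p.1))).bdd_mul (c := 1) ?_ ?_
    · exact (hm.comp (f := fun p : Rn n × Rn n => ζ - p.1) (by fun_prop)).aestronglyMeasurable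
    · exact Continuous.aestronglyMeasurable (by fun_prop)
    · exact .of_forall fun p => by simp [norm_osc]
  calc ∫ s, osc (-inner ℝ q s) * checkS v s * m (ζ - s)
      = ∫ s, ∫ t, osc (-inner ℝ q s) * ((checkS v s * checkS u (t - s)) * m (ζ - t)) := by
        refine integral_congr_ae (.of_forall fun s => ?_)
        simp only
        rw [hu (ζ - s), ← integral_const_mul,
          ← integral_sub_right_eq_self (μ := volume) _ s]
        refine integral_congr_ae (.of_forall fun t => ?_)
        simp only
        rw [show ζ - s - (t - s) = ζ - t by abel]; ring
    _ = ∫ t, ∫ s, osc (-inner ℝ q s) * ((checkS v s * checkS u (t - s)) * m (ζ - t)) :=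
        (integral_integral_swap hint).symm
    _ = ∫ t, checkS u t * m (ζ - t) := by
        refine integral_congr_ae (.of_forall fun t => ?_)
        simp only
        rw [← modulated_reproducing u v q t h, ← integral_mul_const]
        refine integral_congr_ae (.of_forall fun s => ?_)
        simp only; ring
    _ = m ζ := (hu ζ).symm

/-- Transposing the localization puts it on e^{ix·ξ} m(ξ), where it becomes convolution of `m` with
v̌ modulated by x-p. Since v = 1 on the support of `u` shifted by x-p, this convolution returns `m`:
only the part of the input near p is seen from x. -/
lemma integral_osc_mul_localize {m : Rn n → ℂ} (hm : Measurable m) {A : ℝ}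
    (hA : ∀ x, ‖m x‖ ≤ A) {u v : 𝓢(Rn n, ℂ)} (hu : ∀ ξ, m ξ = ∫ y, checkS u y * m (ξ - y))
    {x p : Rn n} (h : ∀ ξ, v (ξ + (x - p)) * u ξ = u ξ) {a : Rn n → ℂ} (ha : Integrable a) :
    ∫ ξ, osc (inner ℝ x ξ) * m ξ * localize v p a ξ = ∫ ξ, osc (inner ℝ x ξ) * m ξ * a ξ := by
  have hint : Integrable (Function.uncurry fun (ζ s : Rn n) =>
      osc (inner ℝ x (ζ - s)) * osc (inner ℝ p s) * (m (ζ - s) * (a ζ * checkS v s)))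
      ((volume : Measure (Rn n)).prod volume) := by
    have h1 := ha.mul_prod ((checkS v).integrable (μ := volume))
    refine (h1.bdd_mul (c := A) ?_ (.of_forall fun p => hA (p.1 - p.2))).bdd_mul (c := 1) ?_ ?_
    · exact (hm.comp (f := fun p : Rn n × Rn n => p.1 - p.2) (by fun_prop)).aestronglyMeasurable
    · exact Continuous.aestronglyMeasurable (by fun_prop)
    · exact .of_forall fun p => by simp [norm_osc]
  have hint2 : Integrable (Function.uncurry fun (ξ s : Rn n) =>
      osc (inner ℝ x ξ) * osc (inner ℝ p s) * (m ξ * (a (ξ + s) * checkS v s)))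
      ((volume : Measure (Rn n)).prod volume) := by
    refine ((measurePreserving_add_prod (volume : Measure (Rn n))
      (volume : Measure (Rn n))).integrable_comp_of_integrable hint).congr (.of_forall fun q => ?_)
    simp [Function.uncurry]
  calc ∫ ξ, osc (inner ℝ x ξ) * m ξ * localize v p a ξ
      = ∫ ξ, ∫ s, osc (inner ℝ x ξ) * osc (inner ℝ p s) * (m ξ * (a (ξ + s) * checkS v s)) := by
        refine integral_congr_ae (.of_forall fun ξ => ?_)
        simp only [localize]
        rw [← integral_const_mul]
        refine integral_congr_ae (.of_forall fun s => ?_)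
        simp only; ring
    _ = ∫ s, ∫ ξ, osc (inner ℝ x ξ) * osc (inner ℝ p s) * (m ξ * (a (ξ + s) * checkS v s)) :=
        integral_integral_swap hint2
    _ = ∫ s, ∫ ζ, osc (inner ℝ x (ζ - s)) * osc (inner ℝ p s) *
          (m (ζ - s) * (a ζ * checkS v s)) := by
        refine integral_congr_ae (.of_forall fun s => ?_)
        simp only
        rw [← integral_sub_right_eq_self (μ := volume) _ s]
        simp
    _ = ∫ ζ, ∫ s, osc (inner ℝ x (ζ - s)) * osc (inner ℝ p s) *
          (m (ζ - s) * (a ζ * checkS v s)) := (integral_integral_swap hint).symm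
    _ = _ := by
        refine integral_congr_ae (.of_forall fun ζ => ?_)
        simp only
        conv_rhs => rw [← modulated_reproducing_bounded hm hA hu h ζ]
        rw [← integral_const_mul, ← integral_mul_const]
        refine integral_congr_ae (.of_forall fun s => ?_)
        have : osc (inner ℝ x (ζ - s)) * osc (inner ℝ p s) =
            osc (inner ℝ x ζ) * osc (-inner ℝ (x - p) s) := by
          rw [← osc_add, ← osc_add]; congr 1
          rw [inner_sub_left, inner_sub_right]; ring
        simp only [this]; ring

/-! ### The bilinear operator on the frequency side and duality -/

/-- The bilinear operator with symbol `F`, acting on Fourier transforms. -/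
def freqOp (F : Phase n → ℂ) (a b : Rn n → ℂ) (x : Rn n) : ℂ :=
  ∫ p : Rn n × Rn n, osc (inner ℝ x (p.1 + p.2)) * F (x, p.1, p.2) * a p.1 * b p.2

lemma integrable_freqOp_integrand {F : Phase n → ℂ} (hF : Measurable F) {A : ℝ}
    (hA : ∀ X, ‖F X‖ ≤ A) {a b : Rn n → ℂ} (ha : Integrable a) (hb : Integrable b) (x : Rn n) :
    Integrable (fun p : Rn n × Rn n => osc (inner ℝ x (p.1 + p.2)) * F (x, p.1, p.2) * a p.1 * b p.2)
      ((volume : Measure (Rn n)).prod volume) := by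
  have h1 := ha.mul_prod hb
  refine ((h1.bdd_mul (c := A) ?_ (.of_forall fun p => hA (x, p.1, p.2))).bdd_mul (c := 1)
    (f := fun p : Rn n × Rn n => osc (inner ℝ x (p.1 + p.2))) ?_ ?_).congr
      (.of_forall fun p => ?_)
  · exact (hF.comp (f := fun p : Rn n × Rn n => (x, p.1, p.2)) (by fun_prop)).aestronglyMeasurable
  · exact Continuous.aestronglyMeasurable (by fun_prop)
  · exact .of_forall fun p => by simp [norm_osc]
  · simp only; ring

/-- The one-variable statement is applied to ξ with η frozen and then to η with ξ frozen, Fubini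
changing the order between the two. -/
lemma freqOp_localize {F : Phase n → ℂ} (hF : Measurable F) {A : ℝ}
    (hA : ∀ X, ‖F X‖ ≤ A) {u₁ u₂ v₁ v₂ : 𝓢(Rn n, ℂ)}
    (h₁ : ∀ x ξ η, F (x, ξ, η) = ∫ y, checkS u₁ y * F (x, ξ - y, η))
    (h₂ : ∀ x ξ η, F (x, ξ, η) = ∫ y, checkS u₂ y * F (x, ξ, η - y))
    {x p : Rn n} (hv₁ : ∀ ξ, v₁ (ξ + (x - p)) * u₁ ξ = u₁ ξ)
    (hv₂ : ∀ ξ, v₂ (ξ + (x - p)) * u₂ ξ = u₂ ξ)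
    {a b : Rn n → ℂ} (ha : Integrable a) (hb : Integrable b) :
    freqOp F (localize v₁ p a) (localize v₂ p b) x = freqOp F a b x := by
  have ha' := integrable_localize v₁ p ha
  have hb' := integrable_localize v₂ p hb
  have hm : ∀ a b : Rn n → ℂ, ∀ ξ η, osc (inner ℝ x (ξ + η)) * F (x, ξ, η) * a ξ * b η =
      (osc (inner ℝ x η) * b η) * (osc (inner ℝ x ξ) * F (x, ξ, η) * a ξ) := by
    intro a b ξ η
    rw [inner_add_right, osc_add]; ring
  have hm' : ∀ a b : Rn n → ℂ, ∀ ξ η, osc (inner ℝ x (ξ + η)) * F (x, ξ, η) * a ξ * b η =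
      (osc (inner ℝ x ξ) * a ξ) * (osc (inner ℝ x η) * F (x, ξ, η) * b η) := by
    intro a b ξ η
    rw [inner_add_right, osc_add]; ring
  calc freqOp F (localize v₁ p a) (localize v₂ p b) x
      = ∫ η, ∫ ξ, osc (inner ℝ x (ξ + η)) * F (x, ξ, η) * localize v₁ p a ξ * localize v₂ p b η :=
        integral_prod_symm _ (integrable_freqOp_integrand hF hA ha' hb' x)
    _ = ∫ η, ∫ ξ, osc (inner ℝ x (ξ + η)) * F (x, ξ, η) * a ξ * localize v₂ p b η := by
        refine integral_congr_ae (.of_forall fun η => ?_)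
        simp only [hm (localize v₁ p a) (localize v₂ p b), hm a (localize v₂ p b)]
        rw [integral_const_mul, integral_const_mul]
        congr 1
        exact integral_osc_mul_localize (m := fun ξ => F (x, ξ, η))
          (hF.comp (f := fun ξ => (x, ξ, η)) (by fun_prop)) (fun ξ => hA _) (fun ξ => h₁ x ξ η) hv₁ ha
    _ = ∫ ξ, ∫ η, osc (inner ℝ x (ξ + η)) * F (x, ξ, η) * a ξ * localize v₂ p b η :=
        (integral_prod_symm _ (integrable_freqOp_integrand hF hA ha hb' x)).symm.trans
          (integral_prod _ (integrable_freqOp_integrand hF hA ha hb' x))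
    _ = ∫ ξ, ∫ η, osc (inner ℝ x (ξ + η)) * F (x, ξ, η) * a ξ * b η := by
        refine integral_congr_ae (.of_forall fun ξ => ?_)
        simp only [hm' a (localize v₂ p b), hm' a b]
        rw [integral_const_mul, integral_const_mul]
        congr 1
        exact integral_osc_mul_localize (m := fun η => F (x, ξ, η))
          (hF.comp (f := fun η => (x, ξ, η)) (by fun_prop)) (fun η => hA _) (fun η => h₂ x ξ η) hv₂ hb
    _ = freqOp F a b x := (integral_prod _ (integrable_freqOp_integrand hF hA ha hb x)).symm

lemma measurable_oscInt_mul_translate {U θ : Rn n → ℂ} (hU : Measurable U) (hθ : Measurable θ) :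
    Measurable fun q : Rn n × Rn n => oscInt (fun x => U x * θ (x - q.1)) q.2 := by
  have : Measurable fun q : (Rn n × Rn n) × Rn n =>
      osc (inner ℝ q.2 q.1.2) * (U q.2 * θ (q.2 - q.1.1)) := by
    have := measurable_osc
    fun_prop
  exact (StronglyMeasurable.integral_prod_right' this.stronglyMeasurable).measurable

/-- Substituting the reproducing identity in x and renaming the convolution variable evaluates F at
y. The only remaining dependence on x is U(x) ǔ(x-y) e^{ix·(ξ+η)}, whose x-integral is an `oscInt`
at ξ+η. Absolute values are taken only after this cancellation has been used. -/
lemma enorm_integral_mul_freqOp_le {F : Phase n → ℂ} (hF : Measurable F) {A : ℝ}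
    (hA : ∀ X, ‖F X‖ ≤ A) {u : 𝓢(Rn n, ℂ)}
    (h₀ : ∀ x ξ η, F (x, ξ, η) = ∫ y, checkS u y * F (x - y, ξ, η))
    {U a b : Rn n → ℂ} (hU : Measurable U) (hUi : Integrable U)
    (ham : Measurable a) (hbm : Measurable b) (ha : Integrable a) (hb : Integrable b) :
    ‖∫ x, U x * freqOp F a b x‖ₑ ≤ ∫⁻ X : Phase n, ‖F X‖ₑ *
      (‖oscInt (fun x => U x * checkS u (x - X.1)) (X.2.1 + X.2.2)‖ₑ * (‖a X.2.1‖ₑ * ‖b X.2.2‖ₑ)) := by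
  have hθ := (checkS u).continuous.measurable
  have hG := measurable_oscInt_mul_translate hU hθ
  have hint : Integrable (Function.uncurry fun (x : Rn n) (p : Rn n × Rn n) =>
      osc (inner ℝ x (p.1 + p.2)) * (F (x, p.1, p.2) * (U x * (a p.1 * b p.2))))
      ((volume : Measure (Rn n)).prod volume) := by
    have h1 : Integrable (fun z : Rn n × Rn n × Rn n => U z.1 * (a z.2.1 * b z.2.2))
        ((volume : Measure (Rn n)).prod volume) := hUi.mul_prod (ha.mul_prod hb)
    refine (h1.bdd_mul (c := A) hF.aestronglyMeasurable (.of_forall fun p => hA _)).bdd_mul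
      (c := 1) ?_ ?_
    · exact Continuous.aestronglyMeasurable (by fun_prop)
    · exact .of_forall fun p => by simp [norm_osc]
  have hinner : ∀ p : Rn n × Rn n, ∫ x, osc (inner ℝ x (p.1 + p.2)) *
      (F (x, p.1, p.2) * (U x * (a p.1 * b p.2))) = ∫ y, F (y, p.1, p.2) *
        (oscInt (fun x => U x * checkS u (x - y)) (p.1 + p.2) * (a p.1 * b p.2)) := by
    intro p
    have hint2 : Integrable (Function.uncurry fun (x y : Rn n) =>
        osc (inner ℝ x (p.1 + p.2)) * ((U x * checkS u (x - y)) * F (y, p.1, p.2)))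
        ((volume : Measure (Rn n)).prod volume) := by
      have h1 : Integrable (fun q : Rn n × Rn n => U q.1 * checkS u (q.1 - q.2))
          ((volume : Measure (Rn n)).prod volume) := by
        have h2 := (measurePreserving_prod_sub (volume : Measure (Rn n))
          (volume : Measure (Rn n))).integrable_comp_of_integrable
            (hUi.mul_prod ((checkS u).integrable.comp_neg (μ := volume)))
        refine h2.congr (.of_forall fun q => ?_)
        simp
      refine (h1.mul_bdd (c := A) ?_ (.of_forall fun q => hA (q.2, p.1, p.2))).bdd_mul (c := 1) ?_ ?_
      · exact (hF.comp (f := fun q : Rn n × Rn n => (q.2, p.1, p.2)) (by fun_prop)).aestronglyMeasurable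
      · exact Continuous.aestronglyMeasurable (by fun_prop)
      · exact .of_forall fun p => by simp [norm_osc]
    calc ∫ x, osc (inner ℝ x (p.1 + p.2)) * (F (x, p.1, p.2) * (U x * (a p.1 * b p.2)))
        = ∫ x, (∫ y, osc (inner ℝ x (p.1 + p.2)) * ((U x * checkS u (x - y)) * F (y, p.1, p.2))) *
            (a p.1 * b p.2) := by
          refine integral_congr_ae (.of_forall fun x => ?_)
          simp only
          rw [h₀ x p.1 p.2, ← integral_sub_left_eq_self _ _ x, ← integral_mul_const,
            ← integral_const_mul, ← integral_mul_const]
          refine integral_congr_ae (.of_forall fun y => ?_)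
          simp only [sub_sub_cancel]; ring
      _ = (∫ y, ∫ x, osc (inner ℝ x (p.1 + p.2)) * ((U x * checkS u (x - y)) * F (y, p.1, p.2))) *
            (a p.1 * b p.2) := by
          rw [integral_mul_const, integral_integral_swap hint2]
      _ = _ := by
          rw [← integral_mul_const]
          refine integral_congr_ae (.of_forall fun y => ?_)
          have : ∫ x, osc (inner ℝ x (p.1 + p.2)) * ((U x * checkS u (x - y)) * F (y, p.1, p.2)) =
              F (y, p.1, p.2) * oscInt (fun x => U x * checkS u (x - y)) (p.1 + p.2) := by
            rw [oscInt, ← integral_const_mul]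
            refine integral_congr_ae (.of_forall fun x => ?_)
            simp only; ring
          simp only [this]; ring
  calc ‖∫ x, U x * freqOp F a b x‖ₑ
      = ‖∫ x, ∫ p : Rn n × Rn n, osc (inner ℝ x (p.1 + p.2)) *
          (F (x, p.1, p.2) * (U x * (a p.1 * b p.2)))‖ₑ := by
        congr 1
        refine integral_congr_ae (.of_forall fun x => ?_)
        simp only [freqOp]
        rw [← integral_const_mul]
        refine integral_congr_ae (.of_forall fun p => ?_)
        simp only; ring
    _ = ‖∫ p : Rn n × Rn n, ∫ x, osc (inner ℝ x (p.1 + p.2)) *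
          (F (x, p.1, p.2) * (U x * (a p.1 * b p.2)))‖ₑ := by
        rw [integral_integral_swap hint]
    _ ≤ ∫⁻ p : Rn n × Rn n, ∫⁻ y, ‖F (y, p.1, p.2)‖ₑ *
        (‖oscInt (fun x => U x * checkS u (x - y)) (p.1 + p.2)‖ₑ * (‖a p.1‖ₑ * ‖b p.2‖ₑ)) := by
        refine (enorm_integral_le_lintegral_enorm _).trans (lintegral_mono fun p => ?_)
        rw [hinner]
        refine (enorm_integral_le_lintegral_enorm _).trans (le_of_eq ?_)
        simp only [enorm_mul]
    _ = _ := by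
        have hG' : Measurable fun X : Phase n =>
            oscInt (fun x => U x * checkS u (x - X.1)) (X.2.1 + X.2.2) :=
          hG.comp (f := fun X : Phase n => (X.1, X.2.1 + X.2.2)) (by fun_prop)
        rw [Measure.volume_eq_prod (Rn n) (Rn n × Rn n), lintegral_prod_symm _ (by fun_prop)]

/-- L¹–L^∞ duality attained explicitly: U is the conjugate phase of `g`, cut off to S. Where g
vanishes the quotient is 0 by the convention for division by zero, which is harmless. -/
lemma lintegral_enorm_eq_enorm_integral {g : Rn n → ℂ} (hg : Measurable g) {A : ℝ}
    (hA : ∀ x, ‖g x‖ ≤ A) {S : Set (Rn n)} (hS : MeasurableSet S) (hS' : volume S ≠ ∞) :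
    ∃ U : Rn n → ℂ, Measurable U ∧ (∀ x, ‖U x‖ ≤ S.indicator 1 x) ∧
      ∫⁻ x in S, ‖g x‖ₑ = ‖∫ x, U x * g x‖ₑ := by
  refine ⟨S.indicator fun x => star (g x) / ‖g x‖, Measurable.indicator ?_ hS, fun x => ?_, ?_⟩
  · have : Measurable fun x => star (g x) := continuous_star.measurable.comp hg
    fun_prop
  · by_cases hx : x ∈ S
    · simp only [Set.indicator_of_mem hx, norm_div, norm_star, Complex.norm_real, norm_norm,
        Pi.one_apply]
      exact div_self_le_one _
    · simp [hx]
  · have h1 : ∀ x, S.indicator (fun x => star (g x) / (‖g x‖ : ℂ)) x * g x =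
        ((S.indicator (fun x => ‖g x‖) x : ℝ) : ℂ) := by
      intro x
      by_cases hx : x ∈ S
      · simp only [Set.indicator_of_mem hx]
        by_cases h0 : g x = 0
        · simp [h0]
        · have : (‖g x‖ : ℂ) ≠ 0 := by simpa using h0
          rw [div_mul_eq_mul_div, div_eq_iff this]
          have := Complex.conj_mul' (g x)
          rw [sq] at this
          exact this
      · simp [hx]
    simp_rw [h1]
    have hi : IntegrableOn (fun x => ‖g x‖) S :=
      Measure.integrableOn_of_bounded (M := A) hS' hg.norm.aestronglyMeasurable
        (.of_forall fun x => by simpa using hA x)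
    rw [integral_complex_ofReal, integral_indicator hS, ← ofReal_norm, Complex.norm_real,
      Real.norm_of_nonneg (integral_nonneg fun x => norm_nonneg _),
      ofReal_integral_eq_lintegral_ofReal hi (.of_forall fun x => norm_nonneg _)]
    simp_rw [ofReal_norm]

/-! ### The estimate for a band-limited symbol -/

lemma ofReal_two_pow_pow (k : ℕ) : ENNReal.ofReal (((2 : ℝ) ^ k) ^ n) = (2 : ℝ≥0∞) ^ (n * k) := by
  rw [← pow_mul, mul_comm, ENNReal.ofReal_pow (by norm_num)]; simp

/-- This supplies the majorant needed by the trilinear estimate. Plancherel turns its integral in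
frequency into the L² mass of the kernel on the cube at p, translated by y;
`lintegral_sqrt_local_le` then integrates the square roots of these masses, at the price of one
weighted L² norm of the kernel. Hence the factor 2^{nk/2}, uniformly in p and U. -/
lemma exists_local_dominant {φ : 𝓢(Rn n, ℂ)} (hφ : IsLPGenerator φ) :
    ∃ C : ℝ≥0, ∀ (k : ℕ) (p : Rn n) (U : Rn n → ℂ), Measurable U →
      (∀ x, ‖U x‖ ≤ {x | x - p ∈ unitCube n}.indicator 1 x) →
      ∃ Γ : Rn n → Rn n → ℝ≥0∞, Measurable (Function.uncurry Γ) ∧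
        (∀ y ζ e, ‖e‖ ≤ 2 * n →
          ‖oscInt (fun x => U x * checkS (dil k φ) (x - y)) (ζ + e)‖ₑ ^ 2 ≤ Γ y ζ) ∧
        ∫⁻ z, (∫⁻ y in unitCube n, ∫⁻ τ, Γ (z + y) τ) ^ (1 / 2 : ℝ) ≤
          C * ((2 : ℝ≥0∞) ^ (n * k)) ^ (1 / 2 : ℝ) := by
  -- Points of the unit cube have norm at most n < 2^n, so the scale n suffices for a cutoff equal
  -- to 1 there.
  have hv : ∀ x : Rn n, ‖x‖ ≤ n → dil n φ x = 1 := by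
    intro x hx
    rw [dil_apply]
    refine hφ.eq_one _ ?_
    rw [norm_smul, norm_inv, norm_pow, Real.norm_of_nonneg zero_le_two, inv_mul_le_iff₀ (by positivity),
      mul_one]
    exact hx.trans (by exact_mod_cast (Nat.lt_two_pow_self).le)
  obtain ⟨C₁, hC₁⟩ := exists_enorm_oscInt_add_sq_le hv
  set ω : Rn n → ℝ≥0∞ := fun s => ENNReal.ofReal (((1 + ‖s‖) ^ (n + 1))⁻¹) with hω
  have hωm : Measurable ω := by fun_prop
  set Ω := ∫⁻ s, ω s with hΩ
  have hfin : Ω < ∞ := lintegral_one_add_norm_inv_lt_top (Nat.lt_succ_self n)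
  set E := ∫⁻ s, ‖checkS φ s‖ₑ ^ 2 * ENNReal.ofReal ((1 + ‖s‖) ^ (n + 1)) with hE
  have hEfin : E < ∞ := lintegral_checkS_sq_weight_lt_top φ (n + 1)
  set P := ENNReal.ofReal ((2 * Real.pi) ^ n)
  set R := ENNReal.ofReal ((1 + 2 * n) ^ (n + 1))
  set C₂ : ℝ≥0∞ := (C₁ * (Ω * P)) ^ (1 / 2 : ℝ) * (Ω * (R * E)) ^ (1 / 2 : ℝ) with hC₂
  have hC₂fin : C₂ ≠ ∞ := by
    refine ENNReal.mul_ne_top (ENNReal.rpow_ne_top_of_nonneg (by norm_num) ?_)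
      (ENNReal.rpow_ne_top_of_nonneg (by norm_num) ?_)
    · exact ENNReal.mul_ne_top ENNReal.coe_ne_top (ENNReal.mul_ne_top hfin.ne ENNReal.ofReal_ne_top)
    · exact ENNReal.mul_ne_top hfin.ne (ENNReal.mul_ne_top ENNReal.ofReal_ne_top hEfin.ne)
  refine ⟨C₂.toNNReal, fun k p U hU hU1 => ?_⟩
  rw [ENNReal.coe_toNNReal hC₂fin]
  have hθ := (checkS (dil k φ)).continuous.measurable
  have hG := measurable_oscInt_mul_translate hU hθ
  have hUb : ∀ x, ‖U x‖ ≤ 1 := fun x => (hU1 x).trans (Set.indicator_le_self' (by simp) x)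
  have hui : ∀ y, Integrable (fun x => U x * checkS (dil k φ) (x - y)) := fun y =>
    ((checkS (dil k φ)).integrable.comp_sub_right y).bdd_mul (c := 1) hU.aestronglyMeasurable
      (.of_forall hUb)
  have hui2 : ∀ y, MemLp (fun x => U x * checkS (dil k φ) (x - y)) 2 := fun y =>
    MemLp.mul (p := ∞) (q := 2) (((checkS (dil k φ)).memLp 2).comp_measurePreserving
      (measurePreserving_sub_right volume y))
      (memLp_top_of_bound hU.aestronglyMeasurable 1 (.of_forall hUb))
  refine ⟨fun y ζ => C₁ * ∫⁻ s, ω s *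
    ‖oscInt (fun x => U x * checkS (dil k φ) (x - y)) (ζ - s)‖ₑ ^ 2, ?_, ?_, ?_⟩
  · have h1 : Measurable fun q : (Rn n × Rn n) × Rn n =>
        oscInt (fun x => U x * checkS (dil k φ) (x - q.1.1)) (q.1.2 - q.2) :=
      hG.comp (f := fun q : (Rn n × Rn n) × Rn n => (q.1.1, q.1.2 - q.2)) (by fun_prop)
    have h2 : Measurable fun q : (Rn n × Rn n) × Rn n =>
        ω q.2 * ‖oscInt (fun x => U x * checkS (dil k φ) (x - q.1.1)) (q.1.2 - q.2)‖ₑ ^ 2 := by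
      fun_prop
    exact (Measurable.lintegral_prod_right' h2).const_mul _
  · intro y ζ e he
    refine hC₁ _ p (hui y) (fun x hx => ?_) ζ e he
    by_contra h
    have := hU1 x
    rw [Set.indicator_of_notMem (s := {x | x - p ∈ unitCube n}) h] at this
    exact hx (by rw [norm_le_zero_iff.1 this, zero_mul])
  · have hint : ∀ y, ∫⁻ τ, C₁ * ∫⁻ s, ω s *
        ‖oscInt (fun x => U x * checkS (dil k φ) (x - y)) (τ - s)‖ₑ ^ 2 ≤
        (C₁ * (Ω * P)) * ∫⁻ x in unitCube n, ‖checkS (dil k φ) (p + x - y)‖ₑ ^ 2 := by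
      intro y
      rw [lintegral_const_mul' _ _ ENNReal.coe_ne_top, lintegral_oscInt_average (hui y) (hui2 y),
        mul_assoc, mul_assoc]
      refine mul_le_mul_right (mul_le_mul_right (mul_le_mul_right ?_ _) _) _
      rw [← lintegral_indicator measurableSet_unitCube, ← lintegral_sub_right_eq_self
        ((unitCube n).indicator fun x => ‖checkS (dil k φ) (p + x - y)‖ₑ ^ 2) p]
      refine lintegral_mono fun x => ?_
      by_cases hx : x - p ∈ unitCube n
      · rw [Set.indicator_of_mem hx, enorm_mul, add_sub_cancel, mul_pow]
        refine mul_le_of_le_one_left' (pow_le_one₀ (by simp) ?_)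
        rw [← ofReal_norm]
        exact ENNReal.ofReal_le_one.2 (hUb x)
      · have := hU1 x
        rw [Set.indicator_of_notMem (s := {x | x - p ∈ unitCube n}) hx] at this
        simp [norm_le_zero_iff.1 this]
    calc ∫⁻ z, (∫⁻ y in unitCube n, ∫⁻ τ, C₁ * ∫⁻ s, ω s *
            ‖oscInt (fun x => U x * checkS (dil k φ) (x - (z + y))) (τ - s)‖ₑ ^ 2) ^ (1 / 2 : ℝ)
        ≤ ∫⁻ z, (∫⁻ y in unitCube n, (C₁ * (Ω * P)) *
            ∫⁻ x in unitCube n, ‖checkS (dil k φ) (p + x - (z + y))‖ₑ ^ 2) ^ (1 / 2 : ℝ) := by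
          gcongr with z y
          exact hint _
      _ = (C₁ * (Ω * P)) ^ (1 / 2 : ℝ) * ∫⁻ z, (∫⁻ y in unitCube n,
            ∫⁻ x in unitCube n, ‖checkS (dil k φ) (p + x - (z + y))‖ₑ ^ 2) ^ (1 / 2 : ℝ) := by
          have hne : (C₁ * (Ω * P)) ≠ ∞ := ENNReal.mul_ne_top ENNReal.coe_ne_top
            (ENNReal.mul_ne_top hfin.ne ENNReal.ofReal_ne_top)
          rw [← lintegral_const_mul' _ _ (ENNReal.rpow_ne_top_of_nonneg (by norm_num) hne)]
          refine lintegral_congr fun z => ?_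
          rw [lintegral_const_mul' _ _ hne, ENNReal.mul_rpow_of_nonneg _ _ (by norm_num)]
      _ ≤ (C₁ * (Ω * P)) ^ (1 / 2 : ℝ) * (Ω * (R * ((2 : ℝ≥0∞) ^ (n * k) * E))) ^ (1 / 2 : ℝ) := by
          gcongr
          refine (lintegral_sqrt_local_le (g := fun x => ‖checkS (dil k φ) x‖ₑ ^ 2)
            (by fun_prop) p).trans ?_
          gcongr
          rw [← ofReal_two_pow_pow]
          exact lintegral_checkS_dil_sq_weight_le φ k (n + 1)
      _ = _ := by
          rw [hC₂, mul_assoc]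
          congr 1
          rw [← ENNReal.mul_rpow_of_nonneg _ _ (by norm_num : (0 : ℝ) ≤ 1 / 2)]
          congr 1
          ring

lemma dil_apply_eq_one {φ : 𝓢(Rn n, ℂ)} (hφ : IsLPGenerator φ) {k : ℕ} {x : Rn n}
    (hx : ‖x‖ ≤ 2 ^ k) : dil k φ x = 1 := by
  rw [dil_apply]
  refine hφ.eq_one _ ?_
  rwa [norm_smul, norm_inv, norm_pow, Real.norm_of_nonneg zero_le_two,
    inv_mul_le_iff₀ (by positivity), mul_one]

lemma norm_le_of_dil_apply_ne_zero {φ : 𝓢(Rn n, ℂ)} (hφ : IsLPGenerator φ) {k : ℕ} {x : Rn n}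
    (hx : dil k φ x ≠ 0) : ‖x‖ ≤ 2 ^ (k + 1) := by
  have h := hφ.supp (subset_tsupport _ (by simpa [dil_apply] using hx))
  rw [mem_closedBall_zero_iff, norm_smul, norm_inv, norm_pow, Real.norm_of_nonneg zero_le_two,
    inv_mul_le_iff₀ (by positivity)] at h
  rwa [pow_succ]

/-- The margin `1 + n` in the scale leaves room for the support radius 2^{k+1} and for a shift of
norm at most n, since 2^{k+1} + n ≤ 2^{k+1+n}. -/
lemma dil_mul_dil_of_mem_unitCube {φ : 𝓢(Rn n, ℂ)} (hφ : IsLPGenerator φ) (k : ℕ) {q : Rn n}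
    (hq : q ∈ unitCube n) (ξ : Rn n) : dil (k + 1 + n) φ (ξ + q) * dil k φ ξ = dil k φ ξ := by
  by_cases h : dil k φ ξ = 0
  · simp [h]
  · rw [dil_apply_eq_one hφ, one_mul]
    have h1 := norm_le_of_dil_apply_ne_zero hφ h
    have h2 := norm_le_of_mem_unitCube hq
    have h3 : (n : ℝ) + 1 ≤ 2 ^ n := by exact_mod_cast Nat.lt_two_pow_self
    have h4 : (1 : ℝ) ≤ 2 ^ (k + 1) := one_le_pow₀ one_le_two
    calc ‖ξ + q‖ ≤ 2 ^ (k + 1) + n := (norm_add_le _ _).trans (add_le_add h1 h2)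
      _ ≤ 2 ^ (k + 1) * (n + 1) := by nlinarith [Nat.cast_nonneg (α := ℝ) n]
      _ ≤ 2 ^ (k + 1) * 2 ^ n := by gcongr
      _ = 2 ^ (k + 1 + n) := (pow_add _ _ _).symm

/-- `F` is bounded by `A` and reproduced by the low-frequency kernels at the scales `2 ^ k`. -/
structure IsBandLimited (φ : 𝓢(Rn n, ℂ)) (k : ℕ × ℕ × ℕ) (F : Phase n → ℂ) (A : ℝ) : Prop where
  measurable : Measurable F
  bound : ∀ X, ‖F X‖ ≤ A
  reproducing₀ : ∀ x ξ η, F (x, ξ, η) = ∫ y, checkS (dil (k.1 + 1) φ) y * F (x - y, ξ, η)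
  reproducing₁ : ∀ x ξ η, F (x, ξ, η) = ∫ y, checkS (dil (k.2.1 + 1) φ) y * F (x, ξ - y, η)
  reproducing₂ : ∀ x ξ η, F (x, ξ, η) = ∫ y, checkS (dil (k.2.2 + 1) φ) y * F (x, ξ, η - y)

/-- Positive weights of polynomial growth of order `K`. -/
structure IsModerateWeight (K : ℕ) (w : Rn n → ℝ≥0∞) : Prop where
  measurable : Measurable w
  ne_zero : ∀ x, w x ≠ 0
  ne_top : ∀ x, w x ≠ ∞
  moderate : ∀ ξ s, w (ξ - s) ≤ ENNReal.ofReal ((1 + ‖s‖) ^ K) * w ξ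

/-- Bounded integrable measurable functions. -/
structure IsBoundedIntegrable (a : Rn n → ℂ) (B : ℝ) : Prop where
  measurable : Measurable a
  integrable : Integrable a
  bound : ∀ x, ‖a x‖ ≤ B

/-- The weighted `L²` norm squared of the localization of `a` at `p`. -/
def localWeightNorm (χ : 𝓢(Rn n, ℂ)) (w : Rn n → ℝ≥0∞) (a : Rn n → ℂ) (p : Rn n) : ℝ≥0∞ :=
  ∫⁻ μ, w μ * ∫⁻ x in unitCube n, ‖localize χ p a (μ + x)‖ₑ ^ 2

lemma measurable_localWeightNorm (χ : 𝓢(Rn n, ℂ)) {w : Rn n → ℝ≥0∞} {a : Rn n → ℂ}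
    (hw : Measurable w) (ha : Measurable a) : Measurable (localWeightNorm χ w a) := by
  have hL := measurable_localize χ ha
  have h1 : Measurable fun q : Rn n × Rn n => ∫⁻ x in unitCube n, ‖localize χ q.1 a (q.2 + x)‖ₑ ^ 2 := by
    refine Measurable.lintegral_prod_right' (f := fun r : (Rn n × Rn n) × Rn n =>
      ‖localize χ r.1.1 a (r.1.2 + r.2)‖ₑ ^ 2) ?_
    have : Measurable fun r : (Rn n × Rn n) × Rn n => localize χ r.1.1 a (r.1.2 + r.2) :=
      hL.comp (f := fun r : (Rn n × Rn n) × Rn n => (r.1.1, r.1.2 + r.2)) (by fun_prop)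
    fun_prop
  exact Measurable.lintegral_prod_right' (f := fun q : Rn n × Rn n => w q.2 * ∫⁻ x in unitCube n,
    ‖localize χ q.1 a (q.2 + x)‖ₑ ^ 2) (by fun_prop)

/-- Integrating over all centres produces the weighted L² norm of the cutoff's kernel, which grows
with its scale; the fixed excess `2 + n` of the scale over i goes into R. -/
lemma exists_lintegral_localWeightNorm_le (φ : 𝓢(Rn n, ℂ)) (K : ℕ) :
    ∃ R : ℝ≥0, ∀ (i : ℕ) (w : Rn n → ℝ≥0∞) (a : Rn n → ℂ) (B : ℝ), IsModerateWeight K w →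
      IsBoundedIntegrable a B → ∫⁻ p, localWeightNorm (dil (i + 1 + 1 + n) φ) w a p ≤
        R * (2 : ℝ≥0∞) ^ (n * i) * ∫⁻ ξ, w ξ * ‖a ξ‖ₑ ^ 2 := by
  set E := ∫⁻ s, ‖checkS φ s‖ₑ ^ 2 * ENNReal.ofReal ((1 + ‖s‖) ^ K) with hE
  have hEfin : E < ∞ := lintegral_checkS_sq_weight_lt_top φ K
  set R : ℝ≥0∞ := ENNReal.ofReal ((1 + n) ^ K) * ENNReal.ofReal ((2 * Real.pi) ^ n) *
    (2 : ℝ≥0∞) ^ (n * (2 + n)) * E with hR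
  have hRfin : R ≠ ∞ := by
    refine ENNReal.mul_ne_top (ENNReal.mul_ne_top (ENNReal.mul_ne_top ENNReal.ofReal_ne_top
      ENNReal.ofReal_ne_top) (by simp)) hEfin.ne
  refine ⟨R.toNNReal, fun i w a B hw ha => ?_⟩
  rw [ENNReal.coe_toNNReal hRfin]
  refine (lintegral_localize_weight_le _ ha.measurable ha.bound hw.measurable hw.moderate).trans ?_
  have h1 := lintegral_checkS_dil_sq_weight_le φ (i + 1 + 1 + n) K
  rw [ofReal_two_pow_pow] at h1
  calc _ ≤ ENNReal.ofReal ((1 + n) ^ K) * (ENNReal.ofReal ((2 * Real.pi) ^ n) *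
        (((2 : ℝ≥0∞) ^ (n * (i + 1 + 1 + n)) * E) * ∫⁻ ξ, w ξ * ‖a ξ‖ₑ ^ 2)) := by gcongr
    _ = _ := by rw [hR]; ring

lemma measurable_freqOp {F : Phase n → ℂ} {a b : Rn n → ℂ} (hF : Measurable F)
    (ha : Measurable a) (hb : Measurable b) : Measurable (freqOp F a b) := by
  have : Measurable fun q : Rn n × Rn n × Rn n =>
      osc (inner ℝ q.1 (q.2.1 + q.2.2)) * F q * a q.2.1 * b q.2.2 := by
    have := measurable_osc
    fun_prop
  exact (StronglyMeasurable.integral_prod_right' this.stronglyMeasurable).measurable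

lemma norm_freqOp_le {F : Phase n → ℂ} {A : ℝ} (hA : ∀ X, ‖F X‖ ≤ A) {a b : Rn n → ℂ}
    (ha : Integrable a) (hb : Integrable b) (x : Rn n) :
    ‖freqOp F a b x‖ ≤ ∫ q : Rn n × Rn n, A * ‖a q.1 * b q.2‖ := by
  refine norm_integral_le_of_norm_le ((ha.mul_prod hb).norm.const_mul A) (.of_forall fun q => ?_)
  rw [norm_mul, norm_mul, norm_mul, norm_osc, one_mul, mul_assoc, norm_mul]
  gcongr
  exact hA _

/-- On one unit cube in x: duality, transfer of the kernel to the dual function, then the trilinear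
estimate with the majorant from `exists_local_dominant`. -/
lemma exists_lintegral_translate_freqOp_le {φ : 𝓢(Rn n, ℂ)} (hφ : IsLPGenerator φ) :
    ∃ C : ℝ≥0, ∀ (k : ℕ × ℕ × ℕ) (F : Phase n → ℂ) (A : ℝ) (M : ℝ≥0∞) (a b : Rn n → ℂ) (p : Rn n),
      IsBandLimited φ k F A → (∀ Z, ∫⁻ Y in phaseCube n, ‖F (Z + Y)‖ₑ ^ 2 ≤ M ^ 2) →
      Measurable a → Measurable b → Integrable a → Integrable b →
      ∀ (w v : Rn n → ℝ≥0∞) (K : ℕ) (D : ℝ≥0∞), IsModerateWeight K w → IsModerateWeight K v →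
      (∀ τ, ∫⁻ μ, (w μ)⁻¹ * (v (τ - μ))⁻¹ ≤ D) →
      ∫⁻ x in {x | x - p ∈ unitCube n}, ‖freqOp F a b x‖ₑ ≤
        M * (((∫⁻ μ, w μ * ∫⁻ x in unitCube n, ‖a (μ + x)‖ₑ ^ 2) *
          ∫⁻ ν, v ν * ∫⁻ x in unitCube n, ‖b (ν + x)‖ₑ ^ 2) ^ (1 / 2 : ℝ) * D ^ (1 / 2 : ℝ)) *
            (C * ((2 : ℝ≥0∞) ^ (n * (k.1 + 1))) ^ (1 / 2 : ℝ)) := by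
  obtain ⟨C, hC⟩ := exists_local_dominant hφ
  refine ⟨C, fun k F A M a b p hF hM ha hb hai hbi w v K D hw hv hD => ?_⟩
  set S : Set (Rn n) := {x | x - p ∈ unitCube n} with hS
  have hSm : MeasurableSet S := measurable_id.sub_const p measurableSet_unitCube
  have hSv : volume S = 1 := by
    have := (measurePreserving_sub_right (volume : Measure (Rn n)) p).measure_preimage
      (measurableSet_unitCube (n := n)).nullMeasurableSet
    rwa [volume_unitCube] at this
  obtain ⟨U, hUm, hU1, hU2⟩ := lintegral_enorm_eq_enorm_integral
    (measurable_freqOp hF.measurable ha hb) (norm_freqOp_le hF.bound hai hbi) hSm (by simp [hSv])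
  have hUi : Integrable U := by
    refine Integrable.mono' (g := S.indicator 1) ?_ hUm.aestronglyMeasurable (.of_forall hU1)
    exact (integrable_indicator_iff hSm).2 (integrableOn_const (by simp [hSv]))
  obtain ⟨Γ, hΓm, hΓ, hΓint⟩ := hC (k.1 + 1) p U hUm hU1
  have hθ := (checkS (dil (k.1 + 1) φ)).continuous.measurable
  have hGm := measurable_oscInt_mul_translate hUm hθ
  have htri := lintegral_trilinear_le (F := fun X => ‖F X‖ₑ)
    (G := fun y ζ => ‖oscInt (fun x => U x * checkS (dil (k.1 + 1) φ) (x - y)) ζ‖ₑ)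
    (a := fun x => ‖a x‖ₑ) (b := fun x => ‖b x‖ₑ)
    hF.measurable.enorm hGm.enorm hΓm ha.enorm hb.enorm hw.measurable hv.measurable hw.ne_zero
    hw.ne_top hv.ne_zero hv.ne_top hD hM hΓ
  rw [hU2]
  refine (enorm_integral_mul_freqOp_le hF.measurable hF.bound hF.reproducing₀ hUm hUi ha hb
    hai hbi).trans (htri.trans ?_)
  exact mul_le_mul_right hΓint _

/-- Bilinear estimate for a symbol which is band limited at the scales `2 ^ k`: only its uniformly
local `L²` norm enters. -/
theorem exists_lintegral_freqOp_le {φ : 𝓢(Rn n, ℂ)} (hφ : IsLPGenerator φ) (K : ℕ) :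
    ∃ C : ℝ≥0, ∀ (k : ℕ × ℕ × ℕ) (F : Phase n → ℂ) (A : ℝ) (M D : ℝ≥0∞) (a b : Rn n → ℂ)
      (B : ℝ) (w v : Rn n → ℝ≥0∞), IsBandLimited φ k F A →
      (∀ Z, ∫⁻ Y in phaseCube n, ‖F (Z + Y)‖ₑ ^ 2 ≤ M ^ 2) →
      IsBoundedIntegrable a B → IsBoundedIntegrable b B →
      IsModerateWeight K w → IsModerateWeight K v → (∀ τ, ∫⁻ μ, (w μ)⁻¹ * (v (τ - μ))⁻¹ ≤ D) →
      ∫⁻ x, ‖freqOp F a b x‖ₑ ≤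
        C * ((2 : ℝ≥0∞) ^ (n * (k.1 + k.2.1 + k.2.2))) ^ (1 / 2 : ℝ) * M * D ^ (1 / 2 : ℝ) *
          ((∫⁻ ξ, w ξ * ‖a ξ‖ₑ ^ 2) * ∫⁻ η, v η * ‖b η‖ₑ ^ 2) ^ (1 / 2 : ℝ) := by
  obtain ⟨C₁, hC₁⟩ := exists_lintegral_translate_freqOp_le hφ
  obtain ⟨R, hR⟩ := exists_lintegral_localWeightNorm_le φ K
  set C₂ : ℝ≥0∞ := C₁ * ((2 : ℝ≥0∞) ^ n) ^ (1 / 2 : ℝ) * R with hC₂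
  have hC₂fin : C₂ ≠ ∞ := ENNReal.mul_ne_top (ENNReal.mul_ne_top ENNReal.coe_ne_top
    (ENNReal.rpow_ne_top_of_nonneg (by norm_num) (by simp))) ENNReal.coe_ne_top
  refine ⟨C₂.toNNReal, fun k F A M D a b B w v hF hM ha hb hw hv hD => ?_⟩
  rw [ENNReal.coe_toNNReal hC₂fin]
  -- The kernels in `IsBandLimited` have scale one above the block; the further `1 + n` is the
  -- margin for x-p ranging over the unit cube.
  set χ₁ := dil (k.2.1 + 1 + 1 + n) φ with hχ₁
  set χ₂ := dil (k.2.2 + 1 + 1 + n) φ with hχ₂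
  set X : Rn n → ℝ≥0∞ := localWeightNorm χ₁ w a with hX
  set Y : Rn n → ℝ≥0∞ := localWeightNorm χ₂ v b with hY
  have hXm : Measurable X := measurable_localWeightNorm χ₁ hw.measurable ha.measurable
  have hYm : Measurable Y := measurable_localWeightNorm χ₂ hv.measurable hb.measurable
  set Q : ℝ≥0∞ := M * (D ^ (1 / 2 : ℝ) * (C₁ * ((2 : ℝ≥0∞) ^ (n * (k.1 + 1))) ^ (1 / 2 : ℝ))) with hQ
  have hmain : ∀ p, ∫⁻ x in unitCube n, ‖freqOp F a b (p + x)‖ₑ ≤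
      Q * (X p ^ (1 / 2 : ℝ) * Y p ^ (1 / 2 : ℝ)) := by
    intro p
    have hSm : MeasurableSet {x : Rn n | x - p ∈ unitCube n} :=
      measurable_id.sub_const p measurableSet_unitCube
    calc ∫⁻ x in unitCube n, ‖freqOp F a b (p + x)‖ₑ
        = ∫⁻ x in {x : Rn n | x - p ∈ unitCube n}, ‖freqOp F a b x‖ₑ := by
          rw [← lintegral_indicator hSm, ← lintegral_indicator measurableSet_unitCube,
            ← lintegral_add_left_eq_self ({x : Rn n | x - p ∈ unitCube n}.indicator _) p]
          refine lintegral_congr fun x => ?_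
          by_cases hx : x ∈ unitCube n <;> simp [Set.indicator, hx]
      _ = ∫⁻ x in {x : Rn n | x - p ∈ unitCube n},
            ‖freqOp F (localize χ₁ p a) (localize χ₂ p b) x‖ₑ := by
          refine setLIntegral_congr_fun hSm fun x hx => ?_
          rw [freqOp_localize hF.measurable hF.bound hF.reproducing₁ hF.reproducing₂
            (dil_mul_dil_of_mem_unitCube hφ _ hx) (dil_mul_dil_of_mem_unitCube hφ _ hx)
            ha.integrable hb.integrable]
      _ ≤ M * ((X p * Y p) ^ (1 / 2 : ℝ) * D ^ (1 / 2 : ℝ)) *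
            (C₁ * ((2 : ℝ≥0∞) ^ (n * (k.1 + 1))) ^ (1 / 2 : ℝ)) :=
          hC₁ k F A M _ _ p hF hM
            ((measurable_localize χ₁ ha.measurable).comp (f := fun ξ => (p, ξ)) (by fun_prop))
            ((measurable_localize χ₂ hb.measurable).comp (f := fun ξ => (p, ξ)) (by fun_prop))
            (integrable_localize χ₁ p ha.integrable) (integrable_localize χ₂ p hb.integrable)
            w v K D hw hv hD
      _ = _ := by
          rw [ENNReal.mul_rpow_of_nonneg _ _ (by norm_num : (0 : ℝ) ≤ 1 / 2), hQ]; ring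
  rw [lintegral_eq_lintegral_average (volume_unitCube (n := n))
    (measurable_freqOp hF.measurable ha.measurable hb.measurable).enorm]
  calc ∫⁻ p, ∫⁻ x in unitCube n, ‖freqOp F a b (p + x)‖ₑ
      ≤ ∫⁻ p, Q * (X p ^ (1 / 2 : ℝ) * Y p ^ (1 / 2 : ℝ)) := lintegral_mono hmain
    -- Both localized inputs enter through L² norms, so Cauchy–Schwarz in the centre p recombines
    -- them. This is where an L¹ bound comes out of two L² inputs.
    _ ≤ Q * ((∫⁻ p, X p) ^ (1 / 2 : ℝ) * (∫⁻ p, Y p) ^ (1 / 2 : ℝ)) := by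
        rw [lintegral_const_mul _ (by fun_prop)]
        gcongr
        refine (lintegral_mul_le_sqrt (by fun_prop) (by fun_prop)).trans ?_
        simp_rw [rpow_half_sq]
        rfl
    _ ≤ Q * ((R * (2 : ℝ≥0∞) ^ (n * k.2.1) * ∫⁻ ξ, w ξ * ‖a ξ‖ₑ ^ 2) ^ (1 / 2 : ℝ) *
          (R * (2 : ℝ≥0∞) ^ (n * k.2.2) * ∫⁻ ξ, v ξ * ‖b ξ‖ₑ ^ 2) ^ (1 / 2 : ℝ)) := by
        gcongr
        · exact hR k.2.1 w a B hw ha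
        · exact hR k.2.2 v b B hv hb
    _ = _ := by
        have hRR : (R : ℝ≥0∞) ^ (1 / 2 : ℝ) * (R : ℝ≥0∞) ^ (1 / 2 : ℝ) = R := by
          rw [← sq, rpow_half_sq]
        have hk : n * (k.1 + k.2.1 + k.2.2) = n * k.1 + n * k.2.1 + n * k.2.2 := by ring
        have hk2 : n * (k.1 + 1) = n * k.1 + n := by ring
        rw [hC₂, hQ, hk, hk2, pow_add, pow_add, pow_add]
        simp_rw [ENNReal.mul_rpow_of_nonneg _ _ (by norm_num : (0 : ℝ) ≤ 1 / 2)]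
        conv_rhs => rw [← hRR]
        ring

/-! ### Littlewood–Paley blocks and recovery of the symbol -/

/-- The Littlewood–Paley piece `lpPiece φ k` as a Schwartz function. -/
def lpS (φ : 𝓢(Rn n, ℂ)) : ℕ → 𝓢(Rn n, ℂ)
  | 0 => dil 0 φ
  | k + 1 => dil (k + 1) φ - dil k φ

lemma lpS_apply (φ : 𝓢(Rn n, ℂ)) (k : ℕ) : ⇑(lpS φ k) = lpPiece φ k := by
  ext ξ
  cases k with
  | zero => simp [lpS, lpPiece, dil_apply]
  | succ k =>
    have : (2 : ℝ) • ((2 : ℝ) ^ (k + 1))⁻¹ • ξ = ((2 : ℝ) ^ k)⁻¹ • ξ := by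
      rw [smul_smul]; congr 1; rw [pow_succ]; field_simp
    simp [lpS, lpPiece, dil_apply, this]

lemma sum_lpS (φ : 𝓢(Rn n, ℂ)) (K : ℕ) : ∑ k ∈ Finset.range (K + 1), lpS φ k = dil K φ := by
  induction K with
  | zero => simp [lpS]
  | succ K ih => rw [Finset.sum_range_succ, ih]; simp [lpS]

lemma dil_mul_lpS {φ : 𝓢(Rn n, ℂ)} (hφ : IsLPGenerator φ) (k : ℕ) (ξ : Rn n) :
    dil (k + 1) φ ξ * lpS φ k ξ = lpS φ k ξ := by
  by_cases h : ‖ξ‖ ≤ 2 ^ (k + 1)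
  · rw [dil_apply_eq_one hφ h, one_mul]
  · have h0 : ∀ j ≤ k, dil j φ ξ = 0 := by
      intro j hj
      by_contra h1
      exact h ((norm_le_of_dil_apply_ne_zero hφ h1).trans (by gcongr; norm_num))
    have : lpS φ k ξ = 0 := by
      cases k with
      | zero => exact h0 0 le_rfl
      | succ k => simp [lpS, h0 (k + 1) le_rfl, h0 k (by omega)]
    simp [this]

lemma checkS_sum (s : Finset ℕ) (u : ℕ → 𝓢(Rn n, ℂ)) (x : Rn n) :
    checkS (∑ k ∈ s, u k) x = ∑ k ∈ s, checkS (u k) x := by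
  have h1 : ∀ k, Integrable fun ξ => osc (inner ℝ x ξ) * u k ξ := fun k =>
    (u k).integrable.bdd_mul (c := 1) (Continuous.aestronglyMeasurable (by fun_prop))
      (.of_forall fun s => by simp [norm_osc])
  simp only [checkS_eq]
  rw [← Finset.mul_sum, ← integral_finsetSum _ fun k _ => h1 k]
  congr 2
  ext ξ
  rw [sum_apply, Finset.mul_sum]

/-- The tensor product of the inverse Fourier transforms of three Schwartz functions. -/
def tensorCheck (u₀ u₁ u₂ : 𝓢(Rn n, ℂ)) (Y : Phase n) : ℂ :=
  checkS u₀ Y.1 * checkS u₁ Y.2.1 * checkS u₂ Y.2.2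

lemma continuous_tensorCheck (u₀ u₁ u₂ : 𝓢(Rn n, ℂ)) : Continuous (tensorCheck u₀ u₁ u₂) := by
  unfold tensorCheck; fun_prop

lemma integrable_tensorCheck (u₀ u₁ u₂ : 𝓢(Rn n, ℂ)) : Integrable (tensorCheck u₀ u₁ u₂) := by
  have : Integrable (fun Y : Rn n × Rn n × Rn n => checkS u₀ Y.1 * (checkS u₁ Y.2.1 * checkS u₂ Y.2.2))
      ((volume : Measure (Rn n)).prod ((volume : Measure (Rn n)).prod volume)) :=
    (checkS u₀).integrable.mul_prod ((checkS u₁).integrable.mul_prod (checkS u₂).integrable)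
  refine this.congr (.of_forall fun Y => ?_)
  simp [tensorCheck, mul_assoc]

/-- Convolution on the phase space with a tensor product kernel. -/
def tensorConv (u₀ u₁ u₂ : 𝓢(Rn n, ℂ)) (τ : Phase n → ℂ) (X : Phase n) : ℂ :=
  ∫ Y, tensorCheck u₀ u₁ u₂ Y * τ (X - Y)

lemma deltaBlock_eq (φ : 𝓢(Rn n, ℂ)) (k : ℕ × ℕ × ℕ) (τ : Phase n → ℂ) :
    deltaBlock φ k τ = tensorConv (lpS φ k.1) (lpS φ k.2.1) (lpS φ k.2.2) τ := by
  ext X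
  simp only [deltaBlock, tensorConv, tensorCheck, checkS_apply, lpS_apply]

lemma integrable_mul_comp_sub_bounded {T τ : Phase n → ℂ} (hT : Integrable T) (hτ : Measurable τ)
    {A : ℝ} (hA : ∀ X, ‖τ X‖ ≤ A) (X : Phase n) : Integrable fun Y => T Y * τ (X - Y) :=
  hT.mul_bdd (c := A) (hτ.comp (measurable_const.sub measurable_id)).aestronglyMeasurable
    (.of_forall fun _ => hA _)

/-- Associativity of convolution, by Fubini after a measure-preserving shear. The map ι allows the
kernel `g` to act in any one of the three phase-space variables. -/
lemma conv_reproducing {T τ : Phase n → ℂ} (hT : Integrable T) {g : Rn n → ℂ} (hg : Integrable g)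
    (hτ : Measurable τ) {A : ℝ} (hA : ∀ X, ‖τ X‖ ≤ A) {ι : Rn n → Phase n} (hι : Measurable ι)
    (h : ∀ Y, ∫ y, g y * T (Y - ι y) = T Y) (X : Phase n) :
    ∫ y, g y * ∫ Y, T Y * τ (X - ι y - Y) = ∫ Y, T Y * τ (X - Y) := by
  have hint : Integrable (Function.uncurry fun (y : Rn n) (Y : Phase n) =>
      g y * T (Y - ι y) * τ (X - Y)) ((volume : Measure (Rn n)).prod volume) := by
    have hmp : MeasurePreserving (fun q : Rn n × Phase n => (q.1, q.2 - ι q.1))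
        ((volume : Measure (Rn n)).prod volume) ((volume : Measure (Rn n)).prod volume) :=
      (MeasurePreserving.id _).skew_product (g := fun y Y => Y - ι y) (by
        unfold Function.uncurry; fun_prop)
        (.of_forall fun y => (measurePreserving_sub_right volume (ι y)).map_eq)
    have h1 : Integrable (fun q : Rn n × Phase n => g q.1 * T (q.2 - ι q.1))
        ((volume : Measure (Rn n)).prod volume) :=
      hmp.integrable_comp_of_integrable (hg.mul_prod hT)
    exact h1.mul_bdd (c := A) (hτ.comp (f := fun q : Rn n × Phase n => X - q.2)
      (by fun_prop)).aestronglyMeasurable (.of_forall fun q => hA _)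
  calc ∫ y, g y * ∫ Y, T Y * τ (X - ι y - Y)
      = ∫ y, ∫ Y, g y * T (Y - ι y) * τ (X - Y) := by
        refine integral_congr_ae (.of_forall fun y => ?_)
        simp only
        rw [← integral_sub_right_eq_self _ (ι y), ← integral_const_mul]
        refine integral_congr_ae (.of_forall fun Y => ?_)
        simp only
        rw [show X - ι y - (Y - ι y) = X - Y by abel]; ring
    _ = ∫ Y, ∫ y, g y * T (Y - ι y) * τ (X - Y) := integral_integral_swap hint
    _ = _ := by
        refine integral_congr_ae (.of_forall fun Y => ?_)
        simp only
        rw [integral_mul_const, h]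

/-- The generator at scale k+1 is 1 on the support of the k-th piece, so its kernel reproduces the
block in each variable. The size of `A'` is immaterial: it only guarantees integrability. -/
lemma isBandLimited_deltaBlock {φ : 𝓢(Rn n, ℂ)} (hφ : IsLPGenerator φ) (k : ℕ × ℕ × ℕ)
    {τ : Phase n → ℂ} (hτ : Measurable τ) {A : ℝ} (hA : ∀ X, ‖τ X‖ ≤ A) :
    ∃ A', IsBandLimited φ k (deltaBlock φ k τ) A' := by
  rw [deltaBlock_eq]
  have hT := integrable_tensorCheck (lpS φ k.1) (lpS φ k.2.1) (lpS φ k.2.2)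
  have hTc := continuous_tensorCheck (lpS φ k.1) (lpS φ k.2.1) (lpS φ k.2.2)
  have hTm := hTc.measurable
  refine ⟨∫ Y, A * ‖tensorCheck (lpS φ k.1) (lpS φ k.2.1) (lpS φ k.2.2) Y‖, ?_, ?_, ?_, ?_, ?_⟩
  · have : Measurable fun q : Phase n × Phase n =>
        tensorCheck (lpS φ k.1) (lpS φ k.2.1) (lpS φ k.2.2) q.2 * τ (q.1 - q.2) := by fun_prop
    exact (StronglyMeasurable.integral_prod_right' this.stronglyMeasurable).measurable
  · intro X
    refine norm_integral_le_of_norm_le (hT.norm.const_mul A) (.of_forall fun Y => ?_)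
    rw [norm_mul, mul_comm]
    gcongr
    exact hA _
  · intro x ξ η
    have := conv_reproducing hT (checkS (dil (k.1 + 1) φ)).integrable hτ hA
      (ι := fun y => (y, 0, 0)) (by fun_prop) (fun Y => ?_) (x, ξ, η)
    · simpa [tensorConv] using this.symm
    · simp only [tensorCheck, Prod.fst_sub, Prod.snd_sub, sub_zero, ← mul_assoc]
      rw [integral_mul_const, integral_mul_const, reproducing _ _ _ (dil_mul_lpS hφ _)]
  · intro x ξ η
    have := conv_reproducing hT (checkS (dil (k.2.1 + 1) φ)).integrable hτ hA
      (ι := fun y => (0, y, 0)) (by fun_prop) (fun Y => ?_) (x, ξ, η)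
    · simpa [tensorConv] using this.symm
    · simp only [tensorCheck, Prod.fst_sub, Prod.snd_sub, sub_zero, ← mul_assoc]
      simp only [mul_right_comm _ (checkS (lpS φ k.1) Y.1)]
      rw [integral_mul_const, integral_mul_const, reproducing _ _ _ (dil_mul_lpS hφ _)]
      ring
  · intro x ξ η
    have := conv_reproducing hT (checkS (dil (k.2.2 + 1) φ)).integrable hτ hA
      (ι := fun y => (0, 0, y)) (by fun_prop) (fun Y => ?_) (x, ξ, η)
    · simpa [tensorConv] using this.symm
    · simp only [tensorCheck, Prod.fst_sub, Prod.snd_sub, sub_zero]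
      have : ∀ y, checkS (dil (k.2.2 + 1) φ) y * (checkS (lpS φ k.1) Y.1 * checkS (lpS φ k.2.1) Y.2.1 *
          checkS (lpS φ k.2.2) (Y.2.2 - y)) = (checkS (lpS φ k.1) Y.1 * checkS (lpS φ k.2.1) Y.2.1) *
          (checkS (dil (k.2.2 + 1) φ) y * checkS (lpS φ k.2.2) (Y.2.2 - y)) := fun y => by ring
      simp only [this]
      rw [integral_const_mul, reproducing _ _ _ (dil_mul_lpS hφ _)]

lemma sum_deltaBlock (φ : 𝓢(Rn n, ℂ)) {τ : Phase n → ℂ} (hτ : Measurable τ) {A : ℝ}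
    (hA : ∀ X, ‖τ X‖ ≤ A) (K : ℕ) (X : Phase n) :
    ∑ k ∈ Finset.range (K + 1) ×ˢ Finset.range (K + 1) ×ˢ Finset.range (K + 1), deltaBlock φ k τ X =
      tensorConv (dil K φ) (dil K φ) (dil K φ) τ X := by
  simp only [deltaBlock_eq, tensorConv]
  rw [← integral_finsetSum _ fun k _ =>
    integrable_mul_comp_sub_bounded (integrable_tensorCheck _ _ _) hτ hA X]
  refine integral_congr_ae (.of_forall fun Y => ?_)
  simp only
  rw [← Finset.sum_mul]
  congr 1
  simp only [tensorCheck, ← sum_lpS φ K, checkS_sum]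
  rw [Finset.sum_mul_sum, Finset.sum_mul, Finset.sum_product]
  simp_rw [Finset.sum_product, Finset.sum_mul_sum]

/-- Continuity of translations in `L¹`, tested against a bounded function. -/
lemma tendsto_integral_translate {W τ : Phase n → ℂ} (hW : Integrable W) (hτ : Measurable τ)
    {A : ℝ} (hA : ∀ X, ‖τ X‖ ≤ A) {h : ℕ → Phase n} (hh : Filter.Tendsto h Filter.atTop (nhds 0)) :
    Filter.Tendsto (fun K => ∫ X, W X * τ (X - h K)) Filter.atTop (nhds (∫ X, W X * τ X)) := by
  set L : Lp ℂ 1 (volume : Measure (Phase n)) := hW.toL1 W with hL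
  let g : Phase n → C(Phase n, Phase n) := fun c => ⟨fun X => X + c, by fun_prop⟩
  have hg : Continuous g := ContinuousMap.continuous_of_continuous_uncurry _
    (by unfold Function.uncurry; exact continuous_snd.add continuous_fst)
  have hmp : ∀ c, MeasurePreserving (g c) (volume : Measure (Phase n)) volume := fun c =>
    measurePreserving_add_right volume c
  have h1 : Continuous fun c => Lp.compMeasurePreserving (g c) (hmp c) L :=
    continuous_const.compMeasurePreservingLp hg hmp (by norm_num)
  have h2 : Continuous fun f : Lp ℂ 1 (volume : Measure (Phase n)) => ∫ X, f X * τ X := by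
    have hA0 : 0 ≤ A := (norm_nonneg _).trans (hA 0)
    refine (LipschitzWith.of_dist_le_mul (K := A.toNNReal) fun f g => ?_).continuous
    have hf := L1.integrable_coeFn f
    have hg := L1.integrable_coeFn g
    have hτ' : AEStronglyMeasurable τ (volume : Measure (Phase n)) := hτ.aestronglyMeasurable
    rw [dist_eq_norm, dist_eq_norm, L1.norm_eq_integral_norm,
      ← integral_sub (hf.mul_bdd (c := A) hτ' (.of_forall hA))
        (hg.mul_bdd (c := A) hτ' (.of_forall hA)), Real.coe_toNNReal A hA0, ← integral_const_mul]
    refine norm_integral_le_of_norm_le ((L1.integrable_coeFn (f - g)).norm.const_mul A) ?_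
    filter_upwards [Lp.coeFn_sub f g] with X hX
    rw [hX, Pi.sub_apply, ← sub_mul, norm_mul, mul_comm]
    gcongr
    exact hA X
  have h3 := ((h2.comp h1).tendsto 0).comp hh
  have h4 : ∀ c, ∫ X, (Lp.compMeasurePreserving (g c) (hmp c) L : Lp ℂ 1 volume) X * τ X =
      ∫ X, W X * τ (X - c) := by
    intro c
    calc _ = ∫ X, W (X + c) * τ X := by
          refine integral_congr_ae ?_
          filter_upwards [Lp.coeFn_compMeasurePreserving L (hmp c),
            (hmp c).quasiMeasurePreserving.ae (Integrable.coeFn_toL1 hW)] with X hX hX2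
          rw [hX, Function.comp_apply, hL, hX2]
          rfl
      _ = _ := by
          rw [← integral_sub_right_eq_self _ c]
          simp
  simp only [Function.comp_def, h4] at h3
  simpa using h3

lemma finrank_phase : Module.finrank ℝ (Phase n) = n + (n + n) := by simp

/-- The dilated tensor kernels form an approximate identity, tested against `L¹` functions. -/
lemma tendsto_integral_tensorConv {φ : 𝓢(Rn n, ℂ)} (hφ : IsLPGenerator φ) {W τ : Phase n → ℂ}
    (hW : Integrable W) (hτ : Measurable τ) {A : ℝ} (hA : ∀ X, ‖τ X‖ ≤ A) :
    Filter.Tendsto (fun K => ∫ X, W X * tensorConv (dil K φ) (dil K φ) (dil K φ) τ X)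
      Filter.atTop (nhds (∫ X, W X * τ X)) := by
  set T := tensorCheck φ φ φ with hT
  have hTi : Integrable T := integrable_tensorCheck φ φ φ
  have hT1 : ∫ Y, T Y = 1 := by
    have h1 : ∫ x, checkS φ x = 1 := by
      have := integral_osc_checkS φ 0
      simpa [osc_zero, hφ.eq_one 0 (by simp)] using this
    have h2 : ∀ Y : Phase n, T Y = checkS φ Y.1 * (checkS φ Y.2.1 * checkS φ Y.2.2) := fun Y => by
      rw [hT, tensorCheck, mul_assoc]
    simp only [h2]
    rw [Measure.volume_eq_prod, integral_prod_mul (f := fun x => checkS φ x)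
      (g := fun y : Rn n × Rn n => checkS φ y.1 * checkS φ y.2), Measure.volume_eq_prod,
      integral_prod_mul (f := fun x => checkS φ x) (g := fun x => checkS φ x), h1]
    simp
  have hconv : ∀ K X, tensorConv (dil K φ) (dil K φ) (dil K φ) τ X =
      ∫ Y, T Y * τ (X - ((2 : ℝ) ^ K)⁻¹ • Y) := by
    intro K X
    have h1 := Measure.integral_comp_smul (volume : Measure (Phase n))
      (fun Y => T Y * τ (X - ((2 : ℝ) ^ K)⁻¹ • Y)) ((2 : ℝ) ^ K)
    rw [finrank_phase, abs_of_pos (by positivity), Complex.real_smul] at h1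
    have h2 : ((((2 : ℝ) ^ K) ^ (n + (n + n)) : ℝ) : ℂ) ≠ 0 := by
      exact_mod_cast (by positivity : ((2 : ℝ) ^ K) ^ (n + (n + n)) ≠ 0)
    rw [Complex.ofReal_inv, eq_comm, inv_mul_eq_iff_eq_mul₀ h2, ← integral_const_mul] at h1
    rw [h1, tensorConv]
    refine integral_congr_ae (.of_forall fun Y => ?_)
    have h3 : ((2 : ℝ) ^ K)⁻¹ • (2 : ℝ) ^ K • Y = Y := by
      rw [smul_smul, inv_mul_cancel₀ (by positivity), one_smul]
    simp only [h3, hT, tensorCheck, checkS_dil, Prod.smul_fst, Prod.smul_snd]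
    push_cast
    ring
  have hswap : ∀ K, ∫ X, W X * tensorConv (dil K φ) (dil K φ) (dil K φ) τ X =
      ∫ Y, T Y * ∫ X, W X * τ (X - ((2 : ℝ) ^ K)⁻¹ • Y) := by
    intro K
    have hint : Integrable (Function.uncurry fun (X Y : Phase n) =>
        W X * T Y * τ (X - ((2 : ℝ) ^ K)⁻¹ • Y)) ((volume : Measure (Phase n)).prod volume) :=
      (hW.mul_prod hTi).mul_bdd (c := A) (hτ.comp (f := fun q : Phase n × Phase n =>
        q.1 - ((2 : ℝ) ^ K)⁻¹ • q.2) (by fun_prop)).aestronglyMeasurable (.of_forall fun q => hA _)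
    calc _ = ∫ X, ∫ Y, W X * T Y * τ (X - ((2 : ℝ) ^ K)⁻¹ • Y) := by
          refine integral_congr_ae (.of_forall fun X => ?_)
          simp only
          rw [hconv, ← integral_const_mul]
          simp only [mul_assoc]
      _ = ∫ Y, ∫ X, W X * T Y * τ (X - ((2 : ℝ) ^ K)⁻¹ • Y) := integral_integral_swap hint
      _ = _ := by
          refine integral_congr_ae (.of_forall fun Y => ?_)
          simp only
          rw [← integral_const_mul]
          refine integral_congr_ae (.of_forall fun X => ?_)
          simp only; ring
  simp only [hswap]
  have hlim : ∫ X, W X * τ X = ∫ Y, T Y * ∫ X, W X * τ X := by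
    rw [integral_mul_const, hT1, one_mul]
  rw [hlim]
  refine tendsto_integral_of_dominated_convergence (fun Y => ‖T Y‖ * ∫ X, ‖W X‖ * A) ?_
    (hTi.norm.mul_const _) ?_ ?_
  · intro K
    refine hTi.aestronglyMeasurable.mul ?_
    have : AEStronglyMeasurable (fun q : Phase n × Phase n => W q.2 * τ (q.2 - ((2 : ℝ) ^ K)⁻¹ • q.1))
        ((volume : Measure (Phase n)).prod volume) :=
      hW.aestronglyMeasurable.comp_snd.mul (hτ.comp (f := fun q : Phase n × Phase n =>
        q.2 - ((2 : ℝ) ^ K)⁻¹ • q.1) (by fun_prop)).aestronglyMeasurable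
    exact this.integral_prod_right'
  · intro K
    refine .of_forall fun Y => ?_
    rw [norm_mul]
    gcongr
    refine norm_integral_le_of_norm_le (hW.norm.mul_const A) (.of_forall fun X => ?_)
    rw [norm_mul]
    gcongr
    exact hA _
  · refine .of_forall fun Y => ?_
    refine (tendsto_integral_translate hW hτ hA ?_).const_mul _
    have : Filter.Tendsto (fun K : ℕ => ((2 : ℝ) ^ K)⁻¹) Filter.atTop (nhds 0) := by
      simp_rw [← inv_pow]
      exact tendsto_pow_atTop_nhds_zero_of_lt_one (by norm_num) (by norm_num)
    simpa using this.smul_const Y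

/-! ### Uniformly local L² norms over arbitrary translates -/

/-- The lattice points whose unit cubes may meet `z + unitCube n`. -/
def nearLattice (z : Rn n) : Finset (Fin n → ℤ) :=
  Fintype.piFinset fun i => Finset.Icc (⌊z i + 1 / 2⌋ - 1) (⌊z i + 1 / 2⌋ + 1)

lemma card_nearLattice (z : Rn n) : (nearLattice z).card = 3 ^ n := by
  rw [nearLattice, Fintype.card_piFinset]
  have : ∀ i, (Finset.Icc (⌊z i + 1 / 2⌋ - 1) (⌊z i + 1 / 2⌋ + 1)).card = 3 := fun i => by
    rw [Int.card_Icc]; omega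
  rw [Finset.prod_congr rfl fun i _ => this i]; simp

/-- The lattice point is z+y rounded coordinatewise; as y has coordinates in [-1/2, 1/2), each
rounding differs from that of z by at most 1. -/
lemma exists_mem_nearLattice (z : Rn n) {y : Rn n} (hy : y ∈ unitCube n) :
    ∃ ν ∈ nearLattice z, z + y - latticePoint ν ∈ unitCube n := by
  refine ⟨fun i => ⌊z i + y i + 1 / 2⌋, ?_, fun i => ?_⟩
  · rw [nearLattice, Fintype.mem_piFinset]
    intro i
    have h := hy i
    have h1 := Int.floor_le (z i + 1 / 2)
    have h2 := Int.lt_floor_add_one (z i + 1 / 2)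
    rw [Finset.mem_Icc]
    constructor
    · rw [Int.le_floor]; push_cast; linarith [h.1]
    · rw [← Int.lt_add_one_iff, Int.floor_lt]; push_cast; linarith [h.2]
  · have h1 := Int.floor_le (z i + y i + 1 / 2)
    have h2 := Int.lt_floor_add_one (z i + y i + 1 / 2)
    simp only [latticePoint, PiLp.sub_apply, PiLp.add_apply, Set.mem_Ico]
    constructor <;> linarith

/-- The `L²` norm over any translate of the unit cube is controlled by `normL2ul`. -/
lemma lintegral_translate_phaseCube_le {F : Phase n → ℂ} (hF : Measurable F) (Z : Phase n) :
    ∫⁻ Y in phaseCube n, ‖F (Z + Y)‖ₑ ^ 2 ≤ ((27 : ℝ≥0∞) ^ n * normL2ul F) ^ 2 := by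
  set N : Finset ((Fin n → ℤ) × (Fin n → ℤ) × (Fin n → ℤ)) :=
    nearLattice Z.1 ×ˢ nearLattice Z.2.1 ×ˢ nearLattice Z.2.2 with hN
  set P : (Fin n → ℤ) × (Fin n → ℤ) × (Fin n → ℤ) → Phase n := fun ν =>
    (latticePoint ν.1, latticePoint ν.2.1, latticePoint ν.2.2) with hP
  have hcube := measurableSet_phaseCube (n := n)
  have h1 : ∀ ν, ∫⁻ X in phaseCube n, ‖F (X + P ν)‖ₑ ^ 2 ≤ normL2ul F ^ 2 := by
    intro ν
    rw [← rpow_half_sq (∫⁻ X in phaseCube n, ‖F (X + P ν)‖ₑ ^ 2)]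
    gcongr
    exact le_iSup (fun ν : (Fin n → ℤ) × (Fin n → ℤ) × (Fin n → ℤ) =>
      (∫⁻ X in phaseCube n, ‖F (X + P ν)‖ₑ ^ 2) ^ (1 / 2 : ℝ)) ν
  have h2 : ∀ Y, (phaseCube n).indicator (fun Y => ‖F (Z + Y)‖ₑ ^ 2) Y ≤
      ∑ ν ∈ N, (phaseCube n).indicator (fun X => ‖F (X + P ν)‖ₑ ^ 2) (Z - P ν + Y) := by
    intro Y
    by_cases hY : Y ∈ phaseCube n
    · obtain ⟨ν₀, hν₀, h0⟩ := exists_mem_nearLattice Z.1 hY.1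
      obtain ⟨ν₁, hν₁, h1⟩ := exists_mem_nearLattice Z.2.1 hY.2.1
      obtain ⟨ν₂, hν₂, h2⟩ := exists_mem_nearLattice Z.2.2 hY.2.2
      have hmem : (ν₀, ν₁, ν₂) ∈ N := by simp [hN, hν₀, hν₁, hν₂]
      have hcub : Z - P (ν₀, ν₁, ν₂) + Y ∈ phaseCube n := by
        rw [sub_add_eq_add_sub]
        exact ⟨h0, h1, h2⟩
      refine le_trans ?_ (Finset.single_le_sum
        (f := fun ν => (phaseCube n).indicator (fun X => ‖F (X + P ν)‖ₑ ^ 2) (Z - P ν + Y))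
        (fun _ _ => zero_le) hmem)
      rw [Set.indicator_of_mem hY, Set.indicator_of_mem hcub]
      refine le_of_eq ?_
      congr 3
      abel
    · rw [Set.indicator_of_notMem hY]; exact zero_le
  calc ∫⁻ Y in phaseCube n, ‖F (Z + Y)‖ₑ ^ 2
      = ∫⁻ Y, (phaseCube n).indicator (fun Y => ‖F (Z + Y)‖ₑ ^ 2) Y :=
        (lintegral_indicator hcube _).symm
    _ ≤ ∫⁻ Y, ∑ ν ∈ N, (phaseCube n).indicator (fun X => ‖F (X + P ν)‖ₑ ^ 2) (Z - P ν + Y) :=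
        lintegral_mono h2
    _ = ∑ ν ∈ N, ∫⁻ X in phaseCube n, ‖F (X + P ν)‖ₑ ^ 2 := by
        have hm : ∀ ν, Measurable fun Y =>
            (phaseCube n).indicator (fun X => ‖F (X + P ν)‖ₑ ^ 2) (Z - P ν + Y) := fun ν =>
          Measurable.comp (g := (phaseCube n).indicator (fun X => ‖F (X + P ν)‖ₑ ^ 2))
            (Measurable.indicator (by fun_prop) hcube) (by fun_prop)
        rw [lintegral_finsetSum _ fun ν _ => hm ν]
        refine Finset.sum_congr rfl fun ν _ => ?_
        rw [lintegral_add_left_eq_self ((phaseCube n).indicator (fun X => ‖F (X + P ν)‖ₑ ^ 2)),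
          lintegral_indicator hcube]
    _ ≤ ∑ ν ∈ N, normL2ul F ^ 2 := Finset.sum_le_sum fun ν _ => h1 ν
    _ = (27 : ℝ≥0∞) ^ n * normL2ul F ^ 2 := by
        -- Three candidates per coordinate, in 3n coordinates.
        have hcard : N.card = 27 ^ n := by
          rw [hN, Finset.card_product, Finset.card_product, card_nearLattice, card_nearLattice,
            card_nearLattice, ← mul_pow, ← mul_pow]
          norm_num
        rw [Finset.sum_const, hcard, nsmul_eq_mul]
        push_cast
        ring
    _ ≤ ((27 : ℝ≥0∞) ^ n * normL2ul F) ^ 2 := by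
        have h27 : (1 : ℝ≥0∞) ≤ 27 ^ n := one_le_pow₀ (by norm_num)
        rw [mul_pow]
        gcongr ?_ * _
        exact le_self_pow₀ h27 two_ne_zero

/-! ### Summation over the blocks -/

/-- This presents the pairing as a linear functional of the symbol given by an L¹ function on phase
space, the form in which the approximate identity can be tested. -/
lemma integral_mul_freqOp {F : Phase n → ℂ} (hF : Measurable F) {A : ℝ} (hA : ∀ X, ‖F X‖ ≤ A)
    {U a b : Rn n → ℂ} (hU : Integrable U) (ha : Integrable a) (hb : Integrable b) :
    ∫ x, U x * freqOp F a b x =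
      ∫ X : Phase n, (osc (inner ℝ X.1 (X.2.1 + X.2.2)) * (U X.1 * (a X.2.1 * b X.2.2))) * F X := by
  have hint : Integrable (fun X : Phase n =>
      (osc (inner ℝ X.1 (X.2.1 + X.2.2)) * (U X.1 * (a X.2.1 * b X.2.2))) * F X)
      ((volume : Measure (Rn n)).prod volume) := by
    have h1 : Integrable (fun X : Phase n => U X.1 * (a X.2.1 * b X.2.2))
        ((volume : Measure (Rn n)).prod volume) := hU.mul_prod (ha.mul_prod hb)
    refine (h1.bdd_mul (c := 1) ?_ ?_).mul_bdd (c := A) hF.aestronglyMeasurable (.of_forall hA)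
    · exact Continuous.aestronglyMeasurable (by fun_prop)
    · exact .of_forall fun p => by simp [norm_osc]
  rw [Measure.volume_eq_prod (Rn n) (Rn n × Rn n), integral_prod _ hint]
  refine integral_congr_ae (.of_forall fun x => ?_)
  simp only [freqOp]
  rw [← integral_const_mul]
  refine integral_congr_ae (.of_forall fun p => ?_)
  simp only; ring

/-- The norm of the class of symbols at a single scale, with the critical exponents. -/
def blockNorm (φ : 𝓢(Rn n, ℂ)) (τ : Phase n → ℂ) : ℝ≥0∞ :=
  ∑' k : ℕ × ℕ × ℕ, ((2 : ℝ≥0∞) ^ (n * (k.1 + k.2.1 + k.2.2))) ^ (1 / 2 : ℝ) *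
    normL2ul (deltaBlock φ k τ)

/-- For a merely bounded τ the block sums need not converge pointwise. The pairing with a fixed dual
function on a ball does converge, so each partial sum is bounded by the triangle inequality, the
limit is taken in the pairing, and the balls are then exhausted. -/
lemma exists_lintegral_freqOp_le_blockNorm {φ : 𝓢(Rn n, ℂ)} (hφ : IsLPGenerator φ)
    (K : ℕ) : ∃ C : ℝ≥0, ∀ (τ : Phase n → ℂ) (A : ℝ) (D : ℝ≥0∞) (a b : Rn n → ℂ)
      (B : ℝ) (w v : Rn n → ℝ≥0∞), Measurable τ → (∀ X, ‖τ X‖ ≤ A) →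
      IsBoundedIntegrable a B → IsBoundedIntegrable b B →
      IsModerateWeight K w → IsModerateWeight K v → (∀ τ, ∫⁻ μ, (w μ)⁻¹ * (v (τ - μ))⁻¹ ≤ D) →
      ∫⁻ x, ‖freqOp τ a b x‖ₑ ≤ C * blockNorm φ τ * D ^ (1 / 2 : ℝ) *
          ((∫⁻ ξ, w ξ * ‖a ξ‖ₑ ^ 2) * ∫⁻ η, v η * ‖b η‖ₑ ^ 2) ^ (1 / 2 : ℝ) := by
  obtain ⟨C, hC⟩ := exists_lintegral_freqOp_le hφ K
  refine ⟨C * 27 ^ n, fun τ A D a b B w v hτ hA ha hb hw hv hD => ?_⟩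
  set V := D ^ (1 / 2 : ℝ) * ((∫⁻ ξ, w ξ * ‖a ξ‖ₑ ^ 2) * ∫⁻ η, v η * ‖b η‖ₑ ^ 2) ^ (1 / 2 : ℝ) with hV
  set g := freqOp τ a b with hg
  have hgm := measurable_freqOp hτ ha.measurable hb.measurable
  have hblock : ∀ k, ∫⁻ x, ‖freqOp (deltaBlock φ k τ) a b x‖ₑ ≤
      (C * 27 ^ n * V) * (((2 : ℝ≥0∞) ^ (n * (k.1 + k.2.1 + k.2.2))) ^ (1 / 2 : ℝ) *
        normL2ul (deltaBlock φ k τ)) := by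
    intro k
    obtain ⟨A', hA'⟩ := isBandLimited_deltaBlock hφ k hτ hA
    refine (hC k _ A' _ D a b B w v hA' (lintegral_translate_phaseCube_le hA'.measurable) ha hb hw hv
      hD).trans (le_of_eq ?_)
    rw [hV]; ring
  have hball : ∀ R : ℕ, ∫⁻ x in Metric.ball (0 : Rn n) R, ‖g x‖ₑ ≤ (C * 27 ^ n * V) * blockNorm φ τ := by
    intro R
    obtain ⟨U, hUm, hU1, hU2⟩ := lintegral_enorm_eq_enorm_integral hgm
      (norm_freqOp_le hA ha.integrable hb.integrable) (Metric.isOpen_ball (x := (0 : Rn n)) (ε := R)).measurableSet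
      measure_ball_lt_top.ne
    have hUi : Integrable U := by
      refine Integrable.mono' (g := (Metric.ball (0 : Rn n) R).indicator 1) ?_
        hUm.aestronglyMeasurable (.of_forall hU1)
      exact (integrable_indicator_iff measurableSet_ball).2 (integrableOn_const measure_ball_lt_top.ne)
    have hUb : ∀ x, ‖U x‖ₑ ≤ 1 := fun x => by
      rw [← ofReal_norm]
      exact ENNReal.ofReal_le_one.2 ((hU1 x).trans (Set.indicator_le_self' (by simp) x))
    set W : Phase n → ℂ := fun X =>
      osc (inner ℝ X.1 (X.2.1 + X.2.2)) * (U X.1 * (a X.2.1 * b X.2.2)) with hW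
    have hWi : Integrable W := by
      have h1 : Integrable (fun X : Phase n => U X.1 * (a X.2.1 * b X.2.2))
          ((volume : Measure (Rn n)).prod volume) := hUi.mul_prod (ha.integrable.mul_prod hb.integrable)
      refine h1.bdd_mul (c := 1) ?_ ?_
      · exact Continuous.aestronglyMeasurable (by fun_prop)
      · exact .of_forall fun p => by simp [norm_osc]
    rw [hU2, integral_mul_freqOp hτ hA hUi ha.integrable hb.integrable]
    -- The blocks with all indices at most K sum to convolution with the kernel at scale K, an
    -- approximate identity.
    refine le_of_tendsto (tendsto_integral_tensorConv hφ hWi hτ hA).enorm (.of_forall fun K => ?_)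
    simp_rw [← sum_deltaBlock φ hτ hA, Finset.mul_sum]
    have hFi : ∀ k, Integrable fun X => W X * deltaBlock φ k τ X := fun k => by
      obtain ⟨A', hA'⟩ := isBandLimited_deltaBlock hφ k hτ hA
      exact hWi.mul_bdd (c := A') hA'.measurable.aestronglyMeasurable (.of_forall hA'.bound)
    rw [integral_finsetSum _ fun k _ => hFi k]
    refine (enorm_sum_le _ _).trans ?_
    have hk : ∀ k, ‖∫ X, W X * deltaBlock φ k τ X‖ₑ ≤ (C * 27 ^ n * V) *
        (((2 : ℝ≥0∞) ^ (n * (k.1 + k.2.1 + k.2.2))) ^ (1 / 2 : ℝ) * normL2ul (deltaBlock φ k τ)) := by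
      intro k
      obtain ⟨A', hA'⟩ := isBandLimited_deltaBlock hφ k hτ hA
      rw [← integral_mul_freqOp hA'.measurable hA'.bound hUi ha.integrable hb.integrable]
      refine (enorm_integral_le_lintegral_enorm _).trans (le_trans ?_ (hblock k))
      refine lintegral_mono fun x => ?_
      rw [enorm_mul]
      exact mul_le_of_le_one_left' (hUb x)
    refine (Finset.sum_le_sum fun k _ => hk k).trans ?_
    rw [← Finset.mul_sum]
    gcongr
    exact ENNReal.sum_le_tsum _
  have hsup : ∫⁻ x, ‖g x‖ₑ = ⨆ R : ℕ, ∫⁻ x in Metric.ball (0 : Rn n) R, ‖g x‖ₑ := by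
    rw [← setLIntegral_iUnion_of_directed, Metric.iUnion_ball_nat, setLIntegral_univ]
    exact Monotone.directed_le fun i j hij => Metric.ball_subset_ball (by exact_mod_cast hij)
  rw [hsup]
  refine (iSup_le hball).trans (le_of_eq ?_)
  rw [hV]; push_cast; ring

/-! ### Parabolic-free rescaling, frequency supports and scale weights -/

lemma freqOp_inv_smul (F : Phase n → ℂ) (a b : Rn n → ℂ) {r : ℝ} (hr : 0 < r) (x : Rn n) :
    freqOp F a b (r⁻¹ • x) = ((r ^ (2 * n) : ℝ) : ℂ) *
      freqOp (fun X => F (r⁻¹ • X.1, r • X.2.1, r • X.2.2)) (fun ξ => a (r • ξ))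
        (fun η => b (r • η)) x := by
  have h := Measure.integral_comp_smul (volume : Measure (Rn n × Rn n))
    (fun p : Rn n × Rn n => osc (inner ℝ (r⁻¹ • x) (p.1 + p.2)) * F (r⁻¹ • x, p.1, p.2) *
      a p.1 * b p.2) r
  have hfin : Module.finrank ℝ (Rn n × Rn n) = 2 * n := by simp; ring
  rw [hfin, abs_of_pos (by positivity), Complex.real_smul] at h
  have h0 : ((r ^ (2 * n) : ℝ) : ℂ) ≠ 0 := by exact_mod_cast (pow_pos hr _).ne'
  have h1 : freqOp (fun X => F (r⁻¹ • X.1, r • X.2.1, r • X.2.2)) (fun ξ => a (r • ξ))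
      (fun η => b (r • η)) x = ∫ p : Rn n × Rn n, (fun p : Rn n × Rn n =>
        osc (inner ℝ (r⁻¹ • x) (p.1 + p.2)) * F (r⁻¹ • x, p.1, p.2) * a p.1 * b p.2) (r • p) := by
    refine integral_congr_ae (.of_forall fun p => ?_)
    simp only [Prod.smul_fst, Prod.smul_snd, ← smul_add, real_inner_smul_left,
      real_inner_smul_right, mul_inv_cancel_left₀ hr.ne']
  rw [h1, h, Complex.ofReal_inv, mul_inv_cancel_left₀ h0]
  rfl

/-- The two frequency variables give r^{2n} and the output variable r^{-n}. The resulting r^n is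
exactly what normalizes the two dilated L² norms later. -/
lemma lintegral_enorm_freqOp_eq {F : Phase n → ℂ} {a b : Rn n → ℂ} (hF : Measurable F)
    (ha : Measurable a) (hb : Measurable b) {r : ℝ} (hr : 0 < r) :
    ∫⁻ x, ‖freqOp F a b x‖ₑ = ENNReal.ofReal (r ^ n) *
      ∫⁻ x, ‖freqOp (fun X => F (r⁻¹ • X.1, r • X.2.1, r • X.2.2)) (fun ξ => a (r • ξ))
        (fun η => b (r • η)) x‖ₑ := by
  have h := lintegral_comp_smul_Rn (measurable_freqOp hF ha hb).enorm (inv_pos.2 hr).ne'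
  have hrn : 0 < r ^ n := pow_pos hr n
  have h2 : ENNReal.ofReal |((r⁻¹) ^ n)⁻¹| = ENNReal.ofReal (r ^ n) := by
    rw [inv_pow, inv_inv, abs_of_pos hrn]
  have h0 : ENNReal.ofReal (r ^ n) ≠ 0 := (ENNReal.ofReal_pos.2 hrn).ne'
  rw [h2] at h
  simp_rw [freqOp_inv_smul F a b hr, enorm_mul] at h
  rw [lintegral_const_mul' _ _ (by simp)] at h
  have h3 : ‖((r ^ (2 * n) : ℝ) : ℂ)‖ₑ = ENNReal.ofReal (r ^ n) * ENNReal.ofReal (r ^ n) := by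
    rw [← ofReal_norm, Complex.norm_real, Real.norm_of_nonneg (by positivity),
      ← ENNReal.ofReal_mul hrn.le]
    congr 1; ring
  rw [h3, mul_assoc] at h
  exact ((ENNReal.mul_right_inj h0 ENNReal.ofReal_ne_top).1 h).symm

/-- Split according to whether η lies in E; if not, ξ must. Each summand thus has one input
restricted to the annular set, where dyadic pieces barely overlap. -/
lemma freqOp_eq_add_of_support {F : Phase n → ℂ} (hF : Measurable F) {A : ℝ}
    (hA : ∀ X, ‖F X‖ ≤ A) {S E : Set (Rn n)} (hS : MeasurableSet S) (hE : MeasurableSet E)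
    (hsupp : ∀ x ξ η, F (x, ξ, η) ≠ 0 → ξ ∈ S ∧ η ∈ S ∧ (ξ ∈ E ∨ η ∈ E)) {a b : Rn n → ℂ}
    (ha : Integrable a) (hb : Integrable b) (x : Rn n) :
    freqOp F a b x = freqOp F (S.indicator a) (E.indicator b) x +
      freqOp F (E.indicator a) ((S \ E).indicator b) x := by
  have h1 := integrable_freqOp_integrand hF hA (ha.indicator hS) (hb.indicator hE) x
  have h2 := integrable_freqOp_integrand hF hA (ha.indicator hE) (hb.indicator (hS.diff hE)) x
  simp only [freqOp]
  refine Eq.trans ?_ (integral_add h1 h2)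
  refine integral_congr_ae (.of_forall fun p => ?_)
  simp only
  by_cases h : F (x, p.1, p.2) = 0
  · simp [h]
  · obtain ⟨hξ, hη, hor⟩ := hsupp _ _ _ h
    by_cases hηE : p.2 ∈ E
    · simp [hξ, hηE]
    · simp [hη, hηE, hor.resolve_right hηE]

lemma IsBoundedIntegrable.comp_smul {a : Rn n → ℂ} {B : ℝ} (ha : IsBoundedIntegrable a B) {r : ℝ}
    (hr : r ≠ 0) : IsBoundedIntegrable (fun ξ => a (r • ξ)) B where
  measurable := ha.measurable.comp (measurable_const_smul r)
  integrable := ha.integrable.comp_smul hr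
  bound _ := ha.bound _

lemma IsBoundedIntegrable.indicator {a : Rn n → ℂ} {B : ℝ} (ha : IsBoundedIntegrable a B)
    {S : Set (Rn n)} (hS : MeasurableSet S) : IsBoundedIntegrable (S.indicator a) B where
  measurable := ha.measurable.indicator hS
  integrable := ha.integrable.indicator hS
  bound x := (norm_indicator_le_norm_self a x).trans (ha.bound x)

/-- A moderate weight with integrable inverse which is small on the ball of radius `N`. -/
def scaleWeight (N : ℝ) (ξ : Rn n) : ℝ≥0∞ :=
  ENNReal.ofReal (√((1 + ‖ξ‖) / N) * (1 + ‖ξ‖ / N) ^ (n + 1))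

lemma isModerateWeight_one (K : ℕ) : IsModerateWeight K (fun _ : Rn n => (1 : ℝ≥0∞)) where
  measurable := measurable_const
  ne_zero _ := one_ne_zero
  ne_top _ := ENNReal.one_ne_top
  moderate ξ s := by
    rw [mul_one, ENNReal.one_le_ofReal]
    exact one_le_pow₀ (by linarith [norm_nonneg s])

/-- The order is n+2: one power for the square root and n+1 for the polynomial factor. Taking N ≥ 1
makes the bound uniform in N. -/
lemma isModerateWeight_scaleWeight {N : ℝ} (hN : 1 ≤ N) :
    IsModerateWeight (n + 2) (scaleWeight (n := n) N) where
  measurable := by unfold scaleWeight; fun_prop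
  ne_zero ξ := by
    have h0 : 0 < N := by linarith
    exact (ENNReal.ofReal_pos.2 (by positivity)).ne'
  ne_top ξ := ENNReal.ofReal_ne_top
  moderate ξ s := by
    have h0 : 0 < N := by linarith
    have hs := norm_nonneg s
    have hξ := norm_nonneg ξ
    rw [scaleWeight, scaleWeight, ← ENNReal.ofReal_mul (by positivity)]
    refine ENNReal.ofReal_le_ofReal ?_
    have h1 : ‖ξ - s‖ ≤ ‖ξ‖ + ‖s‖ := norm_sub_le _ _
    have h2 : √((1 + ‖ξ - s‖) / N) ≤ (1 + ‖s‖) * √((1 + ‖ξ‖) / N) := by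
      rw [← Real.sqrt_sq (show 0 ≤ 1 + ‖s‖ by positivity), ← Real.sqrt_mul (by positivity)]
      refine Real.sqrt_le_sqrt ?_
      rw [← mul_div_assoc]
      gcongr
      nlinarith [mul_nonneg hs hξ, mul_nonneg hs (mul_nonneg hs hξ)]
    have h3 : 1 + ‖ξ - s‖ / N ≤ (1 + ‖s‖) * (1 + ‖ξ‖ / N) := by
      have h4 : ‖s‖ / N ≤ ‖s‖ := div_le_self hs hN
      have h5 : ‖ξ - s‖ / N ≤ ‖ξ‖ / N + ‖s‖ / N := by rw [← add_div]; gcongr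
      have h6 : 0 ≤ ‖s‖ * (‖ξ‖ / N) := by positivity
      nlinarith
    calc √((1 + ‖ξ - s‖) / N) * (1 + ‖ξ - s‖ / N) ^ (n + 1)
        ≤ ((1 + ‖s‖) * √((1 + ‖ξ‖) / N)) * ((1 + ‖s‖) * (1 + ‖ξ‖ / N)) ^ (n + 1) := by gcongr
      _ = _ := by rw [mul_pow]; ring

/-- The weight dominates a fixed profile evaluated at μ/N, and dilation yields N^n. The inverse
profile behaves like ‖u‖^{-1/2} at the origin, integrable because n ≥ 1, and the power n+1 handles
infinity. -/
lemma lintegral_inv_scaleWeight_le (hn : 1 ≤ n) : ∃ C : ℝ≥0, ∀ N : ℝ, 1 ≤ N →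
    ∫⁻ μ : Rn n, (scaleWeight N μ)⁻¹ ≤ C * ENNReal.ofReal (N ^ n) := by
  set G : Rn n → ℝ≥0∞ := fun u => (ENNReal.ofReal (√‖u‖ * (1 + ‖u‖) ^ (n + 1)))⁻¹ with hG
  have hGm : Measurable G := by fun_prop
  have hball : IntegrableOn (fun u : Rn n => ‖u‖ ^ (-(1 / 2) : ℝ)) (Metric.ball 0 1) := by
    refine integrableOn_ball_of_norm_le_rpow (C := 1) (α := 1 / 2) (by simpa using hn) ?_
      (.of_forall fun u => ?_)
      (measurable_norm.pow_const _).aestronglyMeasurable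
    · rw [finrank_Rn]
      have : (1 : ℝ) ≤ n := by exact_mod_cast hn
      linarith
    · rw [one_mul, Real.norm_of_nonneg (by positivity)]
  have hfin : ∫⁻ u, G u < ∞ := by
    rw [← lintegral_add_compl _ (measurableSet_ball (x := (0 : Rn n)) (ε := 1))]
    refine ENNReal.add_lt_top.2 ⟨?_, ?_⟩
    · refine lt_of_le_of_lt (lintegral_mono_ae ?_) hball.lintegral_lt_top
      have h0 : ∀ᵐ u : Rn n, u ≠ 0 := by
        have : Nonempty (Fin n) := ⟨⟨0, hn⟩⟩
        simp [ae_iff]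
      filter_upwards [ae_restrict_of_ae h0] with u hu
      have hu' : 0 < ‖u‖ := norm_pos_iff.2 hu
      rw [hG]
      simp only
      rw [← ENNReal.ofReal_inv_of_pos (by positivity), Real.rpow_neg hu'.le, ← Real.sqrt_eq_rpow]
      refine ENNReal.ofReal_le_ofReal (inv_anti₀ (by positivity) ?_)
      exact le_mul_of_one_le_right (by positivity) (one_le_pow₀ (by linarith))
    · refine lt_of_le_of_lt ?_ (lintegral_one_add_norm_inv_lt_top (n := n) (K := n + 1) (by omega))
      refine le_trans ?_ (setLIntegral_le_lintegral (Metric.ball (0 : Rn n) 1)ᶜ _)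
      refine setLIntegral_mono (by fun_prop) fun u hu => ?_
      have hu' : 1 ≤ ‖u‖ := by simpa using hu
      rw [hG]
      simp only
      rw [← ENNReal.ofReal_inv_of_pos (by positivity)]
      refine ENNReal.ofReal_le_ofReal (inv_anti₀ (by positivity) ?_)
      exact le_mul_of_one_le_left (by positivity) (Real.one_le_sqrt.2 hu')
  refine ⟨(∫⁻ u, G u).toNNReal, fun N hN => ?_⟩
  have h0 : 0 < N := by linarith
  rw [ENNReal.coe_toNNReal hfin.ne]
  have h := lintegral_comp_smul_Rn hGm (inv_pos.2 h0).ne'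
  rw [inv_pow, inv_inv, abs_of_pos (pow_pos h0 n)] at h
  rw [mul_comm, ← h]
  refine lintegral_mono fun μ => ?_
  rw [hG, scaleWeight]
  simp only
  refine ENNReal.inv_le_inv.2 (ENNReal.ofReal_le_ofReal ?_)
  rw [norm_smul, norm_inv, Real.norm_of_nonneg h0.le, inv_mul_eq_div]
  gcongr
  linarith

/-- The symbol rescaled by `r⁻¹` in space and by `r` in frequency. -/
def rescale (r : ℝ) (F : Phase n → ℂ) (X : Phase n) : ℂ := F (r⁻¹ • X.1, r • X.2.1, r • X.2.2)

lemma lintegral_weight_comp_smul {w : Rn n → ℝ≥0∞} (hw : Measurable w) {a : Rn n → ℂ}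
    (ha : Measurable a) {r : ℝ} (hr : 0 < r) :
    ENNReal.ofReal (r ^ n) * ∫⁻ ξ, w ξ * ‖a (r • ξ)‖ₑ ^ 2 = ∫⁻ ξ, w (r⁻¹ • ξ) * ‖a ξ‖ₑ ^ 2 := by
  have hm : Measurable fun ξ => w (r⁻¹ • ξ) * ‖a ξ‖ₑ ^ 2 := by fun_prop
  have h := lintegral_comp_smul_Rn hm hr.ne'
  simp only [smul_smul, inv_mul_cancel₀ hr.ne', one_smul] at h
  have hrn : 0 < r ^ n := pow_pos hr n
  rw [h, ← mul_assoc, ← ENNReal.ofReal_mul hrn.le, abs_of_pos (by positivity),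
    mul_inv_cancel₀ hrn.ne', ENNReal.ofReal_one, one_mul]

/-- Pairing `scaleWeight` with the constant weight 1 makes the convolution of inverse weights a
plain integral, of size N^n. Both assignments are needed, as either input may be the low-frequency
one. -/
lemma exists_lintegral_freqOp_le_rescale {φ : 𝓢(Rn n, ℂ)} (hφ : IsLPGenerator φ) (hn : 1 ≤ n) :
    ∃ C : ℝ≥0, ∀ (F : Phase n → ℂ) (A : ℝ) (a b : Rn n → ℂ) (B r N : ℝ), Measurable F →
      (∀ X, ‖F X‖ ≤ A) → IsBoundedIntegrable a B → IsBoundedIntegrable b B → 0 < r → 1 ≤ N →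
      ∫⁻ x, ‖freqOp F a b x‖ₑ ≤ C * blockNorm φ (rescale r F) * ENNReal.ofReal (N ^ n) ^ (1 / 2 : ℝ) *
        ((∫⁻ ξ, scaleWeight N (r⁻¹ • ξ) * ‖a ξ‖ₑ ^ 2) * ∫⁻ η, ‖b η‖ₑ ^ 2) ^ (1 / 2 : ℝ) ∧
      ∫⁻ x, ‖freqOp F a b x‖ₑ ≤ C * blockNorm φ (rescale r F) * ENNReal.ofReal (N ^ n) ^ (1 / 2 : ℝ) *
        ((∫⁻ ξ, ‖a ξ‖ₑ ^ 2) * ∫⁻ η, scaleWeight N (r⁻¹ • η) * ‖b η‖ₑ ^ 2) ^ (1 / 2 : ℝ) := by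
  obtain ⟨C, hC⟩ := exists_lintegral_freqOp_le_blockNorm hφ (n + 2)
  obtain ⟨C₀, hC₀⟩ := lintegral_inv_scaleWeight_le hn
  refine ⟨C * C₀ ^ (1 / 2 : ℝ), fun F A a b B r N hF hA ha hb hr hN => ?_⟩
  have hw := isModerateWeight_scaleWeight (n := n) hN
  have h1 := isModerateWeight_one (n := n) (n + 2)
  have hFr : Measurable (rescale r F) := by unfold rescale; fun_prop
  have hAr : ∀ X, ‖rescale r F X‖ ≤ A := fun X => hA _
  have hD := hC₀ N hN
  have key : ∀ w v : Rn n → ℝ≥0∞, IsModerateWeight (n + 2) w → IsModerateWeight (n + 2) v →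
      (∀ τ, ∫⁻ μ, (w μ)⁻¹ * (v (τ - μ))⁻¹ ≤ C₀ * ENNReal.ofReal (N ^ n)) →
      ∫⁻ x, ‖freqOp F a b x‖ₑ ≤ (C * C₀ ^ (1 / 2 : ℝ) : ℝ≥0) * blockNorm φ (rescale r F) *
        ENNReal.ofReal (N ^ n) ^ (1 / 2 : ℝ) *
        ((∫⁻ ξ, w (r⁻¹ • ξ) * ‖a ξ‖ₑ ^ 2) * ∫⁻ η, v (r⁻¹ • η) * ‖b η‖ₑ ^ 2) ^ (1 / 2 : ℝ) := by
    intro w v hw hv hwv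
    have h := hC (rescale r F) A _ _ _ B w v hFr hAr (ha.comp_smul hr.ne') (hb.comp_smul hr.ne')
      hw hv hwv
    rw [lintegral_enorm_freqOp_eq hF ha.measurable hb.measurable hr,
      ← lintegral_weight_comp_smul hw.measurable ha.measurable hr,
      ← lintegral_weight_comp_smul hv.measurable hb.measurable hr]
    refine (mul_le_mul_right h _).trans (le_of_eq ?_)
    set P := ∫⁻ ξ, w ξ * ‖a (r • ξ)‖ₑ ^ 2
    set Q := ∫⁻ ξ, v ξ * ‖b (r • ξ)‖ₑ ^ 2
    set R := ENNReal.ofReal (r ^ n)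
    have h2 : (R * P * (R * Q)) ^ (1 / 2 : ℝ) = R * (P * Q) ^ (1 / 2 : ℝ) := by
      rw [mul_mul_mul_comm, ENNReal.mul_rpow_of_nonneg _ _ (by norm_num), ← sq, sq_rpow_half]
    rw [h2, ENNReal.mul_rpow_of_nonneg _ _ (by norm_num), ENNReal.coe_mul,
      ENNReal.coe_rpow_of_nonneg _ (by norm_num)]
    ring
  constructor
  · have h := key (scaleWeight N) (fun _ => 1) hw h1 fun τ => by simpa using hD
    simpa only [one_mul] using h
  · have h := key (fun _ => 1) (scaleWeight N) h1 hw fun τ => by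
      simp only [inv_one, one_mul]
      rw [lintegral_sub_left_eq_self (fun μ => (scaleWeight N μ)⁻¹) τ]
      exact hD
    simpa only [one_mul] using h

/-- The bilinear operator estimate for a symbol supported where one of the two frequencies lies in
`E` and both lie in `S`. -/
lemma exists_lintegral_freqOp_le_of_support {φ : 𝓢(Rn n, ℂ)} (hφ : IsLPGenerator φ) (hn : 1 ≤ n) :
    ∃ C : ℝ≥0, ∀ (F : Phase n → ℂ) (A : ℝ) (S E : Set (Rn n)) (a b : Rn n → ℂ) (B r N : ℝ),
      Measurable F → (∀ X, ‖F X‖ ≤ A) → MeasurableSet S → MeasurableSet E →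
      (∀ x ξ η, F (x, ξ, η) ≠ 0 → ξ ∈ S ∧ η ∈ S ∧ (ξ ∈ E ∨ η ∈ E)) →
      IsBoundedIntegrable a B → IsBoundedIntegrable b B → 0 < r → 1 ≤ N →
      ∫⁻ x, ‖freqOp F a b x‖ₑ ≤ C * blockNorm φ (rescale r F) * ENNReal.ofReal (N ^ n) ^ (1 / 2 : ℝ) *
        (((∫⁻ ξ in S, scaleWeight N (r⁻¹ • ξ) * ‖a ξ‖ₑ ^ 2) * ∫⁻ η in E, ‖b η‖ₑ ^ 2) ^ (1 / 2 : ℝ) +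
        ((∫⁻ ξ in E, ‖a ξ‖ₑ ^ 2) *
          ∫⁻ η in S, scaleWeight N (r⁻¹ • η) * ‖b η‖ₑ ^ 2) ^ (1 / 2 : ℝ)) := by
  obtain ⟨C, hC⟩ := exists_lintegral_freqOp_le_rescale hφ hn
  refine ⟨C, fun F A S E a b B r N hF hA hS hE hsupp ha hb hr hN => ?_⟩
  have ind : ∀ (T : Set (Rn n)) (hT : MeasurableSet T) (w : Rn n → ℝ≥0∞) (c : Rn n → ℂ),
      ∫⁻ ξ, w ξ * ‖T.indicator c ξ‖ₑ ^ 2 = ∫⁻ ξ in T, w ξ * ‖c ξ‖ₑ ^ 2 := by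
    intro T hT w c
    rw [← lintegral_indicator hT]
    refine lintegral_congr fun ξ => ?_
    by_cases h : ξ ∈ T <;> simp [h]
  have ind' : ∀ (T : Set (Rn n)) (hT : MeasurableSet T) (c : Rn n → ℂ),
      ∫⁻ ξ, ‖T.indicator c ξ‖ₑ ^ 2 = ∫⁻ ξ in T, ‖c ξ‖ₑ ^ 2 := by
    intro T hT c
    simpa only [one_mul] using ind T hT (fun _ => 1) c
  have h1 := (hC F A _ _ B r N hF hA (ha.indicator hS) (hb.indicator hE) hr hN).1
  have h2 := (hC F A _ _ B r N hF hA (ha.indicator hE) (hb.indicator (hS.diff hE)) hr hN).2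
  rw [ind S hS, ind' E hE] at h1
  rw [ind _ (hS.diff hE), ind' E hE] at h2
  rw [mul_add]
  calc ∫⁻ x, ‖freqOp F a b x‖ₑ
      ≤ ∫⁻ x, (‖freqOp F (S.indicator a) (E.indicator b) x‖ₑ +
          ‖freqOp F (E.indicator a) ((S \ E).indicator b) x‖ₑ) := by
        refine lintegral_mono fun x => ?_
        rw [freqOp_eq_add_of_support hF hA hS hE hsupp ha.integrable hb.integrable]
        exact enorm_add_le _ _
    _ = _ := lintegral_add_left (measurable_freqOp hF (ha.measurable.indicator hS)
        (hb.measurable.indicator hE)).enorm _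
    _ ≤ _ := by
        refine add_le_add h1 (h2.trans ?_)
        gcongr
        exact Set.sdiff_subset

/-! ### Bounded overlap of the dyadic weights -/

/-- The truncated sequence `h` is decreasing and drops by at least a quarter of its value at every
active index, so the sum telescopes to at most 4√2. -/
lemma sum_sqrt_div_two_pow_le {t : ℝ} (ht : 0 ≤ t) (J : ℕ) :
    ∑ j ∈ Finset.range J, (if t ≤ 2 ^ (j + 1) then √(t / 2 ^ j) else 0) ≤ 8 := by
  set h : ℕ → ℝ := fun j => min √(t / 2 ^ j) √2 with hh
  have hanti : ∀ j, h (j + 1) ≤ h j := fun j => by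
    refine min_le_min_right _ (Real.sqrt_le_sqrt ?_)
    gcongr
    · norm_num
    · omega
  have hj : ∀ j, (if t ≤ 2 ^ (j + 1) then √(t / 2 ^ j) else 0) ≤ 4 * (h j - h (j + 1)) := by
    intro j
    split_ifs with hle
    · have h2 : t / 2 ^ j ≤ 2 := by
        rw [div_le_iff₀ (by positivity)]; rwa [pow_succ, mul_comm] at hle
      have h3 : h j = √(t / 2 ^ j) := min_eq_left (Real.sqrt_le_sqrt h2)
      -- The constant 3/4 is a rational upper bound for 1/√2.
      have h4 : h (j + 1) ≤ √(t / 2 ^ j) * (3 / 4) := by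
        refine (min_le_left _ _).trans ?_
        rw [← Real.sqrt_sq (show (0 : ℝ) ≤ 3 / 4 by norm_num), ← Real.sqrt_mul (by positivity)]
        refine Real.sqrt_le_sqrt ?_
        have h5 : t / 2 ^ (j + 1) = t / 2 ^ j * (1 / 2) := by rw [pow_succ]; field_simp
        rw [h5]
        gcongr
        norm_num
      rw [h3]; linarith
    · linarith [hanti j]
  calc _ ≤ ∑ j ∈ Finset.range J, 4 * (h j - h (j + 1)) := Finset.sum_le_sum fun j _ => hj j
    _ = 4 * (h 0 - h J) := by rw [← Finset.mul_sum, Finset.sum_range_sub']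
    _ ≤ 8 := by
        have h0 : h 0 ≤ √2 := min_le_right _ _
        have hJ : 0 ≤ h J := le_min (Real.sqrt_nonneg _) (Real.sqrt_nonneg _)
        have h2 : √2 ≤ 2 := by rw [Real.sqrt_le_left (by norm_num)]; norm_num
        linarith

/-- The ball supporting the `j`-th dyadic piece. -/
def dyadicBall (n j : ℕ) : Set (Rn n) := {ξ | ‖ξ‖ ≤ 2 ^ (j + 1)}

/-- The annulus which contains one of the two frequencies of the `j`-th dyadic piece. -/
def dyadicAnnulus (n j : ℕ) : Set (Rn n) := {ξ | ‖ξ‖ ≤ 2 ^ (j + 1) ∧ (j = 0 ∨ 2 ^ j ≤ 4 * ‖ξ‖)}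

lemma measurableSet_dyadicBall (j : ℕ) : MeasurableSet (dyadicBall n j) :=
  measurableSet_le measurable_norm measurable_const

lemma measurableSet_dyadicAnnulus (j : ℕ) : MeasurableSet (dyadicAnnulus n j) := by
  refine (measurableSet_le measurable_norm measurable_const).inter
    (s₂ := {ξ : Rn n | j = 0 ∨ 2 ^ j ≤ 4 * ‖ξ‖}) ?_
  by_cases h : j = 0
  · simp [h]
  · simp only [h, false_or]
    exact measurableSet_le measurable_const (measurable_norm.const_mul 4)

/-- On an annulus with j ≥ 1 the root of ‖ξ‖/2^j is at least 1/2, so the previous sum bounds the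
overlap; 17 = 1 + 2·8, with 1 for j = 0. -/
lemma sum_indicator_dyadicAnnulus_le (ξ : Rn n) (J : ℕ) :
    ∑ j ∈ Finset.range J, (dyadicAnnulus n j).indicator (fun _ => (1 : ℝ≥0∞)) ξ ≤ 17 := by
  have hj : ∀ j, (dyadicAnnulus n j).indicator (fun _ => (1 : ℝ≥0∞)) ξ ≤
      ENNReal.ofReal ((if j = 0 then 1 else 0) +
        2 * (if ‖ξ‖ ≤ 2 ^ (j + 1) then √(‖ξ‖ / 2 ^ j) else 0)) := by
    intro j
    by_cases h : ξ ∈ dyadicAnnulus n j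
    · rw [Set.indicator_of_mem h, ENNReal.one_le_ofReal, if_pos h.1]
      rcases h.2 with h0 | h0
      · rw [if_pos h0]; linarith [Real.sqrt_nonneg (‖ξ‖ / 2 ^ j)]
      · have h1 : (1 / 2 : ℝ) ≤ √(‖ξ‖ / 2 ^ j) := by
          refine Real.le_sqrt_of_sq_le ?_
          rw [le_div_iff₀ (by positivity)]
          linarith
        have h2 : (0 : ℝ) ≤ if j = 0 then 1 else 0 := by split_ifs <;> norm_num
        linarith
    · rw [Set.indicator_of_notMem h]; exact zero_le
  refine (Finset.sum_le_sum fun j _ => hj j).trans ?_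
  rw [← ENNReal.ofReal_sum_of_nonneg fun j _ => by positivity]
  rw [show (17 : ℝ≥0∞) = ENNReal.ofReal 17 by simp]
  refine ENNReal.ofReal_le_ofReal ?_
  rw [Finset.sum_add_distrib, ← Finset.mul_sum]
  have h1 := sum_sqrt_div_two_pow_le (norm_nonneg ξ) J
  have h2 : ∑ j ∈ Finset.range J, (if j = 0 then (1 : ℝ) else 0) ≤ 1 := by
    rw [Finset.sum_ite_eq']; split_ifs <;> norm_num
  linarith

/-- On the j-th ball the polynomial factor is at most 3^{n+1}, and the root is at most q^j +
√(‖ξ‖/2^j). The first term is geometric precisely because ρ < 1; the second is summed by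
`sum_sqrt_div_two_pow_le`. -/
lemma exists_sum_indicator_scaleWeight_le {ρ : ℝ} (hρ : ρ < 1) :
    ∃ C : ℝ≥0, ∀ (ξ : Rn n) (J : ℕ), ∑ j ∈ Finset.range J, (dyadicBall n j).indicator (fun ξ =>
      scaleWeight ((2 : ℝ) ^ (j * (1 - ρ))) (((2 : ℝ) ^ (j * ρ))⁻¹ • ξ)) ξ ≤ C := by
  set q : ℝ := √((2 : ℝ) ^ (1 - ρ))⁻¹ with hq
  have hp1 : (1 : ℝ) < 2 ^ (1 - ρ) := Real.one_lt_rpow one_lt_two (by linarith)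
  have hq0 : 0 ≤ q := Real.sqrt_nonneg _
  have hq1 : q < 1 := by
    rw [hq, Real.sqrt_lt' one_pos, one_pow]
    exact inv_lt_one_of_one_lt₀ hp1
  set C : ℝ := ((1 - q)⁻¹ + 8) * 3 ^ (n + 1) with hC
  refine ⟨C.toNNReal, fun ξ J => ?_⟩
  have hj : ∀ j : ℕ, (dyadicBall n j).indicator (fun ξ =>
      scaleWeight ((2 : ℝ) ^ (j * (1 - ρ))) (((2 : ℝ) ^ (j * ρ))⁻¹ • ξ)) ξ ≤
      ENNReal.ofReal ((q ^ j + (if ‖ξ‖ ≤ 2 ^ (j + 1) then √(‖ξ‖ / 2 ^ j) else 0)) *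
        3 ^ (n + 1)) := by
    intro j
    by_cases h : ξ ∈ dyadicBall n j
    · have h' : ‖ξ‖ ≤ 2 ^ (j + 1) := h
      rw [Set.indicator_of_mem h, if_pos h', scaleWeight]
      refine ENNReal.ofReal_le_ofReal ?_
      set r : ℝ := (2 : ℝ) ^ (j * ρ) with hr
      set N : ℝ := (2 : ℝ) ^ (j * (1 - ρ)) with hN
      have hr0 : 0 < r := by positivity
      have hN0 : 0 < N := by positivity
      have hrN : r * N = 2 ^ j := by
        rw [hr, hN, ← Real.rpow_add two_pos, ← Real.rpow_natCast]
        congr 1; ring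
      have hN' : N⁻¹ = ((2 : ℝ) ^ (1 - ρ))⁻¹ ^ j := by
        rw [hN, inv_pow, ← Real.rpow_natCast, ← Real.rpow_mul zero_le_two, mul_comm]
      have hnorm : ‖r⁻¹ • ξ‖ / N = ‖ξ‖ / 2 ^ j := by
        rw [norm_smul, norm_inv, Real.norm_of_nonneg hr0.le, ← hrN]
        field_simp
      rw [add_div, hnorm, one_div]
      have h2 : ‖ξ‖ / 2 ^ j ≤ 2 := by
        rw [div_le_iff₀ (by positivity)]; rwa [pow_succ, mul_comm] at h'
      have h3 : √(N⁻¹ + ‖ξ‖ / 2 ^ j) ≤ q ^ j + √(‖ξ‖ / 2 ^ j) := by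
        have hqN : (q ^ j) ^ 2 = N⁻¹ := by
          rw [hN', hq, ← pow_mul, mul_comm, pow_mul, Real.sq_sqrt (by positivity)]
        rw [Real.sqrt_le_left (by positivity), add_sq, hqN, Real.sq_sqrt (by positivity)]
        have : 0 ≤ 2 * q ^ j * √(‖ξ‖ / 2 ^ j) := by positivity
        linarith
      have h4 : 1 + ‖ξ‖ / 2 ^ j ≤ 3 := by linarith
      gcongr
    · rw [Set.indicator_of_notMem h]; exact zero_le
  refine (Finset.sum_le_sum fun j _ => hj j).trans ?_
  rw [← ENNReal.ofReal_sum_of_nonneg fun j _ => by positivity]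
  refine ENNReal.ofReal_le_ofReal ?_
  rw [← Finset.sum_mul, Finset.sum_add_distrib, hC]
  gcongr
  · rw [← tsum_geometric_of_lt_one hq0 hq1]
    exact (summable_geometric_of_lt_one hq0 hq1).sum_le_tsum _ fun j _ => by positivity
  · exact sum_sqrt_div_two_pow_le (norm_nonneg ξ) J

lemma sum_setLIntegral_mul_le {S : ℕ → Set (Rn n)} (hS : ∀ j, MeasurableSet (S j))
    {w : ℕ → Rn n → ℝ≥0∞} (hw : ∀ j, Measurable (w j)) {C : ℝ≥0∞} {J : ℕ}
    (hC : ∀ ξ, ∑ j ∈ Finset.range J, (S j).indicator (w j) ξ ≤ C) {h : Rn n → ℝ≥0∞}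
    (hh : Measurable h) :
    ∑ j ∈ Finset.range J, ∫⁻ ξ in S j, w j ξ * h ξ ≤ C * ∫⁻ ξ, h ξ := by
  have h1 : ∀ j, ∫⁻ ξ in S j, w j ξ * h ξ = ∫⁻ ξ, (S j).indicator (w j) ξ * h ξ := fun j => by
    rw [← lintegral_indicator (hS j)]
    refine lintegral_congr fun ξ => ?_
    by_cases hξ : ξ ∈ S j <;> simp [hξ]
  simp_rw [h1]
  have h2 : ∀ j, Measurable fun ξ => (S j).indicator (w j) ξ * h ξ := fun j =>
    ((hw j).indicator (hS j)).mul hh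
  rw [← lintegral_finsetSum _ fun j _ => h2 j, ← lintegral_const_mul _ hh]
  refine lintegral_mono fun ξ => ?_
  rw [← Finset.sum_mul]
  gcongr
  exact hC ξ

lemma sum_rpow_half_mul_le (J : Finset ℕ) (A B : ℕ → ℝ≥0∞) :
    ∑ j ∈ J, (A j * B j) ^ (1 / 2 : ℝ) ≤ ((∑ j ∈ J, A j) * ∑ j ∈ J, B j) ^ (1 / 2 : ℝ) := by
  have h := ENNReal.inner_le_Lp_mul_Lq J (fun j => A j ^ (1 / 2 : ℝ)) (fun j => B j ^ (1 / 2 : ℝ))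
    (p := 2) (q := 2) .two_two
  simp only [← ENNReal.rpow_mul] at h
  norm_num at h
  simp_rw [ENNReal.mul_rpow_of_nonneg _ _ (show (0 : ℝ) ≤ 1 / 2 by norm_num)]
  simpa using h

/-! ### Dyadic decomposition of the symbol in frequency -/

section LittlewoodPaley

variable {V : Type*} [NormedAddCommGroup V] [NormedSpace ℝ V]

lemma sum_lpPiece (Φ : 𝓢(V, ℂ)) (J : ℕ) (ζ : V) :
    ∑ j ∈ Finset.range (J + 1), lpPiece Φ j ζ = Φ (((2 : ℝ) ^ J)⁻¹ • ζ) := by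
  induction J with
  | zero => simp [lpPiece]
  | succ J ih =>
    have h : (2 : ℝ) • ((2 : ℝ) ^ (J + 1))⁻¹ • ζ = ((2 : ℝ) ^ J)⁻¹ • ζ := by
      rw [smul_smul]; congr 1; rw [pow_succ]; field_simp
    rw [Finset.sum_range_succ, ih, lpPiece, if_neg (Nat.succ_ne_zero J), h]
    ring

lemma IsLPGenerator.apply_smul_eq_one {Φ : 𝓢(V, ℂ)} (hΦ : IsLPGenerator Φ) {J : ℕ} {ζ : V}
    (h : ‖ζ‖ ≤ 2 ^ J) : Φ (((2 : ℝ) ^ J)⁻¹ • ζ) = 1 := by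
  refine hΦ.eq_one _ ?_
  rwa [norm_smul, norm_inv, norm_pow, Real.norm_of_nonneg zero_le_two,
    inv_mul_le_iff₀ (by positivity), mul_one]

lemma IsLPGenerator.apply_smul_eq_zero {Φ : 𝓢(V, ℂ)} (hΦ : IsLPGenerator Φ) {J : ℕ} {ζ : V}
    (h : 2 ^ (J + 1) < ‖ζ‖) : Φ (((2 : ℝ) ^ J)⁻¹ • ζ) = 0 := by
  by_contra h0
  have h1 := hΦ.supp (subset_tsupport _ h0)
  rw [mem_closedBall_zero_iff, norm_smul, norm_inv, norm_pow, Real.norm_of_nonneg zero_le_two,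
    inv_mul_le_iff₀ (by positivity), ← pow_succ] at h1
  linarith

lemma norm_of_lpPiece_ne_zero {Φ : 𝓢(V, ℂ)} (hΦ : IsLPGenerator Φ) {j : ℕ} {ζ : V}
    (h : lpPiece Φ j ζ ≠ 0) : ‖ζ‖ ≤ 2 ^ (j + 1) ∧ (j = 0 ∨ 2 ^ j ≤ 2 * ‖ζ‖) := by
  cases j with
  | zero =>
    refine ⟨?_, .inl rfl⟩
    by_contra h1
    exact h (by simpa [lpPiece] using hΦ.apply_smul_eq_zero (J := 0) (not_le.1 h1))
  | succ j =>
    have h2 : (2 : ℝ) • ((2 : ℝ) ^ (j + 1))⁻¹ • ζ = ((2 : ℝ) ^ j)⁻¹ • ζ := by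
      rw [smul_smul]; congr 1; rw [pow_succ]; field_simp
    rw [lpPiece, if_neg (Nat.succ_ne_zero j), h2] at h
    refine ⟨?_, .inr ?_⟩
    · by_contra h1
      rw [not_le] at h1
      refine h ?_
      rw [hΦ.apply_smul_eq_zero h1, hΦ.apply_smul_eq_zero (lt_trans ?_ h1), sub_zero]
      gcongr <;> norm_num
    · by_contra h1
      rw [not_le, pow_succ, mul_comm] at h1
      have h3 : ‖ζ‖ ≤ 2 ^ j := by linarith
      refine h ?_
      rw [hΦ.apply_smul_eq_one h3, hΦ.apply_smul_eq_one (h3.trans ?_), sub_self]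
      gcongr <;> norm_num

lemma continuous_lpPiece (Φ : 𝓢(V, ℂ)) (j : ℕ) : Continuous (lpPiece Φ j) := by
  unfold lpPiece
  split_ifs <;> fun_prop

lemma exists_norm_le_of_schwartz (Φ : 𝓢(V, ℂ)) : ∃ M, ∀ ζ, ‖Φ ζ‖ ≤ M := by
  obtain ⟨M, hM⟩ := Φ.decay 0 0
  exact ⟨M, fun ζ => by simpa using hM.2 ζ⟩

lemma exists_norm_lpPiece_le (Φ : 𝓢(V, ℂ)) : ∃ M, ∀ j ζ, ‖lpPiece Φ j ζ‖ ≤ M := by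
  obtain ⟨M, hM⟩ := exists_norm_le_of_schwartz Φ
  have hM0 : 0 ≤ M := (norm_nonneg _).trans (hM 0)
  refine ⟨M + M, fun j ζ => ?_⟩
  unfold lpPiece
  split_ifs
  · linarith [hM ζ]
  · exact (norm_sub_le _ _).trans (add_le_add (hM _) (hM _))

end LittlewoodPaley

lemma fourierHat_eq_osc (f : Rn n → ℂ) (ξ : Rn n) :
    fourierHat f ξ = ∫ x, osc (inner ℝ (-ξ) x) * f x := by
  refine integral_congr_ae (.of_forall fun x => ?_)
  simp only [osc, inner_neg_left, Complex.ofReal_neg, mul_neg, real_inner_comm]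

lemma fourierHat_eq_checkS (f : 𝓢(Rn n, ℂ)) (ξ : Rn n) :
    fourierHat f ξ = (2 * (Real.pi : ℂ)) ^ n * checkS f (-ξ) := by
  have h0 : (2 * (Real.pi : ℂ)) ^ n ≠ 0 :=
    pow_ne_zero _ (mul_ne_zero two_ne_zero (by exact_mod_cast Real.pi_ne_zero))
  rw [fourierHat_eq_osc, checkS_apply, fourierCheck, one_div, mul_inv_cancel_left₀ h0]
  rfl

lemma exists_isBoundedIntegrable_fourierHat (f : 𝓢(Rn n, ℂ)) :
    ∃ B, ∀ B' ≥ B, IsBoundedIntegrable (fourierHat f) B' := by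
  obtain ⟨M, hM⟩ := exists_norm_le_of_schwartz (checkS f)
  have h : fourierHat f = fun ξ => (2 * (Real.pi : ℂ)) ^ n * checkS f (-ξ) :=
    funext (fourierHat_eq_checkS f)
  refine ⟨‖(2 * (Real.pi : ℂ)) ^ n‖ * M, fun B' hB' => ⟨?_, ?_, fun ξ => ?_⟩⟩
  · rw [h]; exact Continuous.measurable (by fun_prop)
  · rw [h]; exact (checkS f).integrable.comp_neg.const_mul _
  · rw [h]
    simp only
    rw [norm_mul]
    refine le_trans ?_ hB'
    gcongr
    exact hM _

lemma lintegral_fourierHat_sq (f : 𝓢(Rn n, ℂ)) :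
    ∫⁻ ξ, ‖fourierHat f ξ‖ₑ ^ 2 = ENNReal.ofReal ((2 * Real.pi) ^ n) * ∫⁻ x, ‖f x‖ₑ ^ 2 := by
  simp_rw [fourierHat_eq_osc]
  rw [lintegral_neg_eq_self (fun ξ : Rn n => ‖∫ x, osc (inner ℝ ξ x) * f x‖ₑ ^ 2)]
  exact lintegral_enorm_osc_sq f.integrable (f.memLp 2)

/-- The part of the symbol at the dyadic frequency `2 ^ j`. -/
def dyadicSymbol (Φ : 𝓢(Rn2 n, ℂ)) (j : ℕ) (σ : Phase n → ℂ) (X : Phase n) : ℂ :=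
  σ X * lpPiece Φ j (WithLp.toLp 2 (X.2.1, X.2.2))

lemma rescaledPiece_eq_rescale (Φ : 𝓢(Rn2 n, ℂ)) (ρ : ℝ) (j : ℕ) (σ : Phase n → ℂ) :
    rescaledPiece Φ ρ j σ = rescale ((2 : ℝ) ^ (j * ρ)) (dyadicSymbol Φ j σ) := by
  ext X
  simp only [rescaledPiece, rescale, dyadicSymbol, Real.rpow_neg zero_le_two]

lemma measurable_dyadicSymbol (Φ : 𝓢(Rn2 n, ℂ)) (j : ℕ) {σ : Phase n → ℂ} (hσ : Measurable σ) :
    Measurable (dyadicSymbol Φ j σ) := by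
  have h : Continuous fun X : Phase n => lpPiece Φ j (WithLp.toLp 2 (X.2.1, X.2.2)) :=
    (continuous_lpPiece Φ j).comp (by fun_prop)
  exact hσ.mul h.measurable

lemma exists_norm_dyadicSymbol_le (Φ : 𝓢(Rn2 n, ℂ)) {σ : Phase n → ℂ} {A : ℝ}
    (hA : ∀ X, ‖σ X‖ ≤ A) : ∃ A', ∀ j X, ‖dyadicSymbol Φ j σ X‖ ≤ A' := by
  obtain ⟨M, hM⟩ := exists_norm_lpPiece_le Φ
  refine ⟨A * M, fun j X => ?_⟩
  rw [dyadicSymbol, norm_mul]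
  exact mul_le_mul (hA X) (hM _ _) (norm_nonneg _) ((norm_nonneg _).trans (hA X))

/-- The larger of ‖ξ‖, ‖η‖ is at least half the norm of the pair, whence the factor 4 in
`dyadicAnnulus` against the factor 2 in `norm_of_lpPiece_ne_zero`. -/
lemma dyadicSymbol_support {Φ : 𝓢(Rn2 n, ℂ)} (hΦ : IsLPGenerator Φ) {j : ℕ} {σ : Phase n → ℂ}
    {x ξ η : Rn n} (h : dyadicSymbol Φ j σ (x, ξ, η) ≠ 0) :
    ξ ∈ dyadicBall n j ∧ η ∈ dyadicBall n j ∧ (ξ ∈ dyadicAnnulus n j ∨ η ∈ dyadicAnnulus n j) := by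
  obtain ⟨h1, h2⟩ := norm_of_lpPiece_ne_zero hΦ (right_ne_zero_of_mul h)
  have hsq : ‖(WithLp.toLp 2 (ξ, η) : Rn2 n)‖ ^ 2 = ‖ξ‖ ^ 2 + ‖η‖ ^ 2 :=
    WithLp.prod_norm_sq_eq_of_L2 _
  set ζ : Rn2 n := WithLp.toLp 2 (ξ, η) with hζ
  have hξ : ‖ξ‖ ≤ ‖ζ‖ := abs_le_of_sq_le_sq' (by nlinarith [norm_nonneg η]) (norm_nonneg _) |>.2
  have hη : ‖η‖ ≤ ‖ζ‖ := abs_le_of_sq_le_sq' (by nlinarith [norm_nonneg ξ]) (norm_nonneg _) |>.2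
  have hadd : ‖ζ‖ ≤ ‖ξ‖ + ‖η‖ := abs_le_of_sq_le_sq'
    (by nlinarith [mul_nonneg (norm_nonneg ξ) (norm_nonneg η)]) (by positivity) |>.2
  refine ⟨hξ.trans h1, hη.trans h1, ?_⟩
  rcases h2 with h2 | h2
  · exact .inl ⟨hξ.trans h1, .inl h2⟩
  · rcases le_total ‖ξ‖ ‖η‖ with h3 | h3
    · exact .inr ⟨hη.trans h1, .inr (by linarith)⟩
    · exact .inl ⟨hξ.trans h1, .inr (by linarith)⟩

/-- The critical weights 2^{nkᵢ/2} are dominated by those of the class; the factor 2^{jm} undoes the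
normalization by 2^{-jm}. -/
lemma blockNorm_rescaledPiece_le (φ : 𝓢(Rn n, ℂ)) (Φ : 𝓢(Rn2 n, ℂ)) (ρ m : ℝ) {s₀ s₁ s₂ : ℝ}
    (hs₀ : (n : ℝ) / 2 ≤ s₀) (hs₁ : (n : ℝ) / 2 ≤ s₁) (hs₂ : (n : ℝ) / 2 ≤ s₂) (σ : Phase n → ℂ)
    (j : ℕ) : blockNorm φ (rescaledPiece Φ ρ j σ) ≤
      ENNReal.ofReal ((2 : ℝ) ^ (j * m)) * normBS φ Φ ρ m s₀ s₁ s₂ σ := by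
  refine le_trans ?_ (mul_le_mul_right (le_iSup (fun j : ℕ => ∑' k : ℕ × ℕ × ℕ,
    ENNReal.ofReal ((2 : ℝ) ^ (-(j * m) + (k.1 * s₀ + k.2.1 * s₁ + k.2.2 * s₂))) *
      normL2ul (deltaBlock φ k (rescaledPiece Φ ρ j σ))) j) _)
  rw [← ENNReal.tsum_mul_left]
  refine ENNReal.tsum_le_tsum fun k => ?_
  rw [← mul_assoc, ← ENNReal.ofReal_mul (by positivity), ← Real.rpow_add two_pos,
    add_neg_cancel_left]
  gcongr
  have h2 : ((2 : ℝ≥0∞) ^ (n * (k.1 + k.2.1 + k.2.2))) ^ (1 / 2 : ℝ) =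
      ENNReal.ofReal ((2 : ℝ) ^ ((n * (k.1 + k.2.1 + k.2.2) : ℝ) * (1 / 2))) := by
    rw [Real.rpow_mul zero_le_two, ← ENNReal.ofReal_rpow_of_nonneg (by positivity) (by norm_num)]
    congr 1
    rw [← ENNReal.ofReal_rpow_of_pos two_pos, ENNReal.ofReal_ofNat, ← ENNReal.rpow_natCast]
    push_cast
    rfl
  rw [h2]
  refine ENNReal.ofReal_le_ofReal (Real.rpow_le_rpow_of_exponent_le one_le_two ?_)
  have h3 := mul_le_mul_of_nonneg_left hs₀ (Nat.cast_nonneg (α := ℝ) k.1)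
  have h4 := mul_le_mul_of_nonneg_left hs₁ (Nat.cast_nonneg (α := ℝ) k.2.1)
  have h5 := mul_le_mul_of_nonneg_left hs₂ (Nat.cast_nonneg (α := ℝ) k.2.2)
  linarith

/-! ### Summation over the dyadic pieces -/

lemma exists_sum_lintegral_freqOp_dyadicSymbol_le {φ : 𝓢(Rn n, ℂ)} (hφ : IsLPGenerator φ)
    (hn : 1 ≤ n) {ρ : ℝ} (hρ : ρ < 1) : ∃ C : ℝ≥0, ∀ (Φ : 𝓢(Rn2 n, ℂ)) (s₀ s₁ s₂ : ℝ)
      (σ : Phase n → ℂ) (A B : ℝ) (a b : Rn n → ℂ) (J : ℕ), IsLPGenerator Φ →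
      (n : ℝ) / 2 ≤ s₀ → (n : ℝ) / 2 ≤ s₁ → (n : ℝ) / 2 ≤ s₂ → Measurable σ → (∀ X, ‖σ X‖ ≤ A) →
      IsBoundedIntegrable a B → IsBoundedIntegrable b B →
      ∑ j ∈ Finset.range J, ∫⁻ x, ‖freqOp (dyadicSymbol Φ j σ) a b x‖ₑ ≤
        C * normBS φ Φ ρ (-((1 - ρ) * n / 2)) s₀ s₁ s₂ σ *
          ((∫⁻ ξ, ‖a ξ‖ₑ ^ 2) * ∫⁻ η, ‖b η‖ₑ ^ 2) ^ (1 / 2 : ℝ) := by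
  obtain ⟨C₁, hC₁⟩ := exists_lintegral_freqOp_le_of_support hφ hn
  obtain ⟨C₂, hC₂⟩ := exists_sum_indicator_scaleWeight_le (n := n) hρ
  refine ⟨C₁ * (2 * (C₂ * 17) ^ (1 / 2 : ℝ)),
    fun Φ s₀ s₁ s₂ σ A B a b J hΦ hs₀ hs₁ hs₂ hσ hA ha hb => ?_⟩
  set M := normBS φ Φ ρ (-((1 - ρ) * n / 2)) s₀ s₁ s₂ σ with hM
  obtain ⟨A', hA'⟩ := exists_norm_dyadicSymbol_le Φ hA
  set W : ℕ → Rn n → ℝ≥0∞ := fun j ξ =>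
    scaleWeight ((2 : ℝ) ^ (j * (1 - ρ))) (((2 : ℝ) ^ (j * ρ))⁻¹ • ξ) with hW
  have hWm : ∀ j, Measurable (W j) := fun j => by rw [hW]; unfold scaleWeight; fun_prop
  set P : (Rn n → ℂ) → ℕ → ℝ≥0∞ := fun a j => ∫⁻ ξ in dyadicBall n j, W j ξ * ‖a ξ‖ₑ ^ 2 with hP
  set Q : (Rn n → ℂ) → ℕ → ℝ≥0∞ := fun a j => ∫⁻ ξ in dyadicAnnulus n j, ‖a ξ‖ₑ ^ 2 with hQ
  have hPs : ∀ a : Rn n → ℂ, Measurable a →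
      ∑ j ∈ Finset.range J, P a j ≤ C₂ * ∫⁻ ξ, ‖a ξ‖ₑ ^ 2 := fun a ha =>
    sum_setLIntegral_mul_le measurableSet_dyadicBall hWm (fun ξ => hC₂ ξ J) (by fun_prop)
  have hQs : ∀ a : Rn n → ℂ, Measurable a →
      ∑ j ∈ Finset.range J, Q a j ≤ 17 * ∫⁻ ξ, ‖a ξ‖ₑ ^ 2 := fun a ha => by
    have := sum_setLIntegral_mul_le (h := fun ξ => ‖a ξ‖ₑ ^ 2) measurableSet_dyadicAnnulus
      (fun _ => measurable_const) (fun ξ => sum_indicator_dyadicAnnulus_le ξ J) (by fun_prop)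
    simpa only [one_mul] using this
  have hj : ∀ j : ℕ, ∫⁻ x, ‖freqOp (dyadicSymbol Φ j σ) a b x‖ₑ ≤
      C₁ * M * ((P a j * Q b j) ^ (1 / 2 : ℝ) + (Q a j * P b j) ^ (1 / 2 : ℝ)) := by
    intro j
    have hN : (1 : ℝ) ≤ 2 ^ (j * (1 - ρ)) :=
      Real.one_le_rpow one_le_two (mul_nonneg (Nat.cast_nonneg j) (by linarith))
    have h1 := hC₁ (dyadicSymbol Φ j σ) A' (dyadicBall n j) (dyadicAnnulus n j) a b B
      ((2 : ℝ) ^ (j * ρ)) ((2 : ℝ) ^ (j * (1 - ρ))) (measurable_dyadicSymbol Φ j hσ) (hA' j)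
      (measurableSet_dyadicBall j) (measurableSet_dyadicAnnulus j)
      (fun x ξ η h => dyadicSymbol_support hΦ h) ha hb (by positivity) hN
    rw [← rescaledPiece_eq_rescale] at h1
    refine h1.trans ?_
    have h2 := blockNorm_rescaledPiece_le φ Φ ρ (-((1 - ρ) * n / 2)) hs₀ hs₁ hs₂ σ j
    -- The loss N^{n/2} with N = 2^{j(1-ρ)} cancels 2^{jm} exactly; this determines the order m.
    have h3 : ENNReal.ofReal (((2 : ℝ) ^ (j * (1 - ρ))) ^ n) ^ (1 / 2 : ℝ) *
        ENNReal.ofReal ((2 : ℝ) ^ (j * -((1 - ρ) * n / 2))) = 1 := by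
      rw [ENNReal.ofReal_rpow_of_nonneg (by positivity) (by norm_num),
        ← ENNReal.ofReal_mul (by positivity), ← Real.rpow_natCast, ← Real.rpow_mul zero_le_two,
        ← Real.rpow_mul zero_le_two, ← Real.rpow_add two_pos]
      ring_nf
      simp
    gcongr ?_ * _
    calc C₁ * blockNorm φ (rescaledPiece Φ ρ j σ) *
          ENNReal.ofReal (((2 : ℝ) ^ (j * (1 - ρ))) ^ n) ^ (1 / 2 : ℝ)
        ≤ C₁ * (ENNReal.ofReal ((2 : ℝ) ^ (j * -((1 - ρ) * n / 2))) * M) *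
          ENNReal.ofReal (((2 : ℝ) ^ (j * (1 - ρ))) ^ n) ^ (1 / 2 : ℝ) := by gcongr
      _ = C₁ * M * (ENNReal.ofReal (((2 : ℝ) ^ (j * (1 - ρ))) ^ n) ^ (1 / 2 : ℝ) *
          ENNReal.ofReal ((2 : ℝ) ^ (j * -((1 - ρ) * n / 2)))) := by ring
      _ = C₁ * M := by rw [h3, mul_one]
  set X := ((∫⁻ ξ, ‖a ξ‖ₑ ^ 2) * ∫⁻ η, ‖b η‖ₑ ^ 2) with hX
  have hsum1 : ∑ j ∈ Finset.range J, (P a j * Q b j) ^ (1 / 2 : ℝ) ≤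
      (C₂ * 17 : ℝ≥0∞) ^ (1 / 2 : ℝ) * X ^ (1 / 2 : ℝ) := by
    refine (sum_rpow_half_mul_le _ _ _).trans ?_
    rw [← ENNReal.mul_rpow_of_nonneg _ _ (by norm_num), hX, mul_mul_mul_comm]
    gcongr
    · exact hPs a ha.measurable
    · exact hQs b hb.measurable
  have hsum2 : ∑ j ∈ Finset.range J, (Q a j * P b j) ^ (1 / 2 : ℝ) ≤
      (C₂ * 17 : ℝ≥0∞) ^ (1 / 2 : ℝ) * X ^ (1 / 2 : ℝ) := by
    refine (sum_rpow_half_mul_le _ _ _).trans ?_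
    rw [← ENNReal.mul_rpow_of_nonneg _ _ (by norm_num), hX, mul_comm (C₂ : ℝ≥0∞), mul_mul_mul_comm]
    gcongr
    · exact hQs a ha.measurable
    · exact hPs b hb.measurable
  refine (Finset.sum_le_sum fun j _ => hj j).trans ?_
  rw [← Finset.mul_sum, Finset.sum_add_distrib]
  refine (mul_le_mul_right (add_le_add hsum1 hsum2) _).trans (le_of_eq ?_)
  rw [ENNReal.coe_mul, ENNReal.coe_mul, ENNReal.coe_rpow_of_nonneg _ (by norm_num)]
  push_cast
  ring

/-- The partial sums of the pieces converge pointwise in x by dominated convergence, so Fatou's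
lemma carries a uniform L¹ bound to the full operator. -/
lemma lintegral_freqOp_le_of_dyadic {Φ : 𝓢(Rn2 n, ℂ)} (hΦ : IsLPGenerator Φ) {σ : Phase n → ℂ}
    (hσ : Measurable σ) {A : ℝ} (hA : ∀ X, ‖σ X‖ ≤ A) {a b : Rn n → ℂ} {B : ℝ}
    (ha : IsBoundedIntegrable a B) (hb : IsBoundedIntegrable b B) {M : ℝ≥0∞}
    (hM : ∀ J, ∑ j ∈ Finset.range J, ∫⁻ x, ‖freqOp (dyadicSymbol Φ j σ) a b x‖ₑ ≤ M) :
    ∫⁻ x, ‖freqOp σ a b x‖ₑ ≤ M := by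
  obtain ⟨A', hA'⟩ := exists_norm_dyadicSymbol_le Φ hA
  obtain ⟨M₀, hM₀⟩ := exists_norm_le_of_schwartz Φ
  have hm := fun j => measurable_dyadicSymbol Φ j hσ
  set S : ℕ → Rn n → ℂ := fun J x =>
    ∑ j ∈ Finset.range (J + 1), freqOp (dyadicSymbol Φ j σ) a b x with hS
  have hSm : ∀ J, Measurable (S J) := fun J =>
    Finset.measurable_sum _ fun j _ => measurable_freqOp (hm j) ha.measurable hb.measurable
  have hlim : ∀ x, Filter.Tendsto (fun J => S J x) Filter.atTop (nhds (freqOp σ a b x)) := by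
    intro x
    have hSeq : ∀ J, S J x = ∫ p : Rn n × Rn n, Φ (((2 : ℝ) ^ J)⁻¹ • WithLp.toLp 2 (p.1, p.2)) *
        (osc (inner ℝ x (p.1 + p.2)) * σ (x, p.1, p.2) * a p.1 * b p.2) := by
      intro J
      simp only [hS, freqOp]
      refine (integral_finsetSum _ fun j _ => integrable_freqOp_integrand (hm j) (hA' j)
        ha.integrable hb.integrable x).symm.trans (integral_congr_ae (.of_forall fun p => ?_))
      simp only [dyadicSymbol]
      rw [← sum_lpPiece, Finset.sum_mul]
      refine Finset.sum_congr rfl fun j _ => ?_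
      ring
    simp_rw [hSeq]
    have hint := integrable_freqOp_integrand hσ hA ha.integrable hb.integrable x
    refine tendsto_integral_of_dominated_convergence (fun p => M₀ *
      ‖osc (inner ℝ x (p.1 + p.2)) * σ (x, p.1, p.2) * a p.1 * b p.2‖) (fun J => ?_)
      (hint.norm.const_mul M₀) (fun J => .of_forall fun p => ?_) (.of_forall fun p => ?_)
    · refine Continuous.aestronglyMeasurable ?_ |>.mul hint.aestronglyMeasurable
      exact Φ.continuous.comp (by fun_prop)
    · rw [norm_mul]
      gcongr
      exact hM₀ _
    · obtain ⟨J₀, hJ₀⟩ := pow_unbounded_of_one_lt ‖(WithLp.toLp 2 (p.1, p.2) : Rn2 n)‖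
        (one_lt_two (α := ℝ))
      refine tendsto_const_nhds.congr' ?_
      filter_upwards [Filter.eventually_ge_atTop J₀] with J hJ
      rw [hΦ.apply_smul_eq_one (hJ₀.le.trans (pow_le_pow_right₀ one_le_two hJ)), one_mul]
  have hbound : ∀ J, ∫⁻ x, ‖S J x‖ₑ ≤ M := by
    intro J
    refine le_trans ?_ (hM (J + 1))
    rw [← lintegral_finsetSum _ fun j _ => (measurable_freqOp (hm j) ha.measurable hb.measurable).enorm]
    exact lintegral_mono fun x => enorm_sum_le _ _
  calc ∫⁻ x, ‖freqOp σ a b x‖ₑ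
      = ∫⁻ x, Filter.liminf (fun J => ‖S J x‖ₑ) Filter.atTop :=
        lintegral_congr fun x => ((hlim x).enorm.liminf_eq).symm
    _ ≤ Filter.liminf (fun J => ∫⁻ x, ‖S J x‖ₑ) Filter.atTop :=
        lintegral_liminf_le fun J => (hSm J).enorm
    _ ≤ M := Filter.liminf_le_of_le (by isBoundedDefault) fun c hc => by
        obtain ⟨J, hJ⟩ := hc.exists
        exact hJ.trans (hbound J)

/-! ### Passage to a bounded Borel representative and conclusion -/

lemma exists_measurable_bounded_ae_eq {σ : Phase n → ℂ} (hσ : MemLp σ ∞) :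
    ∃ (τ : Phase n → ℂ) (A : ℝ), Measurable τ ∧ (∀ X, ‖τ X‖ ≤ A) ∧ σ =ᵐ[volume] τ := by
  have hσm := hσ.aestronglyMeasurable
  set A := (eLpNorm σ ∞ volume).toReal
  have hbd : ∀ᵐ X, ‖σ X‖ ≤ A := by
    have h1 : eLpNorm σ ∞ volume = eLpNormEssSup σ volume := eLpNorm_exponent_top
    filter_upwards [enorm_ae_le_eLpNormEssSup σ volume] with X hX
    rw [← h1] at hX
    rw [← toReal_enorm]
    exact ENNReal.toReal_mono hσ.eLpNorm_ne_top hX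
  set τ : Phase n → ℂ := {X | ‖hσm.mk σ X‖ ≤ A}.indicator (hσm.mk σ) with hτ
  have hmk : Measurable (hσm.mk σ) := hσm.stronglyMeasurable_mk.measurable
  refine ⟨τ, A, hmk.indicator (measurableSet_le hmk.norm measurable_const), fun X => ?_, ?_⟩
  · by_cases hX : ‖hσm.mk σ X‖ ≤ A
    · rw [hτ, Set.indicator_of_mem (by exact hX)]; exact hX
    · rw [hτ, Set.indicator_of_notMem (by exact hX), norm_zero]; exact ENNReal.toReal_nonneg
  · filter_upwards [hbd, hσm.ae_eq_mk] with X h1 h2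
    rw [hτ, Set.indicator_of_mem (by rw [Set.mem_ofPred_eq, ← h2]; exact h1), h2]

lemma rescaledPiece_congr_ae (Φ : 𝓢(Rn2 n, ℂ)) (ρ : ℝ) (j : ℕ) {σ τ : Phase n → ℂ}
    (h : σ =ᵐ[volume] τ) : rescaledPiece Φ ρ j σ =ᵐ[volume] rescaledPiece Φ ρ j τ := by
  have hsmul : ∀ c : ℝ, 0 < c → Measure.QuasiMeasurePreserving (fun x : Rn n => c • x) volume volume := by
    intro c hc
    refine ⟨by fun_prop, ?_⟩
    rw [Measure.map_addHaar_smul _ hc.ne']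
    exact Measure.smul_absolutelyContinuous
  have h1 := hsmul ((2 : ℝ) ^ (-(j * ρ))) (by positivity)
  have h2 := hsmul ((2 : ℝ) ^ (j * ρ)) (by positivity)
  filter_upwards [(QuasiMeasurePreserving.prodMap h1 (QuasiMeasurePreserving.prodMap h2 h2)).ae h] with X hX
  have hX' : σ ((2 : ℝ) ^ (-(j * ρ)) • X.1, (2 : ℝ) ^ (j * ρ) • X.2.1, (2 : ℝ) ^ (j * ρ) • X.2.2) =
    τ ((2 : ℝ) ^ (-(j * ρ)) • X.1, (2 : ℝ) ^ (j * ρ) • X.2.1, (2 : ℝ) ^ (j * ρ) • X.2.2) := hX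
  rw [rescaledPiece, rescaledPiece, hX']

/-- Every block is an integral against the symbol, so changing the symbol on a null set leaves the
blocks unchanged at every point. -/
lemma normBS_congr_ae (φ : 𝓢(Rn n, ℂ)) (Φ : 𝓢(Rn2 n, ℂ)) (ρ m s₀ s₁ s₂ : ℝ) {σ τ : Phase n → ℂ}
    (h : σ =ᵐ[volume] τ) : normBS φ Φ ρ m s₀ s₁ s₂ σ = normBS φ Φ ρ m s₀ s₁ s₂ τ := by
  have hdelta : ∀ j k, deltaBlock φ k (rescaledPiece Φ ρ j σ) =
      deltaBlock φ k (rescaledPiece Φ ρ j τ) := by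
    intro j k
    ext X
    refine integral_congr_ae ?_
    filter_upwards [(quasiMeasurePreserving_sub_left volume X).ae (rescaledPiece_congr_ae Φ ρ j h)]
      with Y hY
    rw [hY]
  simp only [normBS, hdelta]

lemma freqOp_congr_ae {σ τ : Phase n → ℂ} (h : σ =ᵐ[volume] τ) (a b : Rn n → ℂ) :
    freqOp σ a b =ᵐ[volume] freqOp τ a b := by
  have h1 : ∀ᵐ x : Rn n, ∀ᵐ p : Rn n × Rn n, σ (x, p) = τ (x, p) :=
    Measure.ae_ae_of_ae_prod h
  filter_upwards [h1] with x hx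
  refine integral_congr_ae ?_
  filter_upwards [hx] with p hp
  rw [hp]

lemma bilinearPDO_eq (σ : Phase n → ℂ) (f g : 𝓢(Rn n, ℂ)) (x : Rn n) :
    bilinearPDO σ f g x =
      (1 / (2 * (Real.pi : ℂ)) ^ (2 * n)) * freqOp σ (fourierHat f) (fourierHat g) x := rfl

lemma eLpNorm_two_eq (f : Rn n → ℂ) : eLpNorm f 2 volume = (∫⁻ x, ‖f x‖ₑ ^ 2) ^ (1 / 2 : ℝ) := by
  rw [eLpNorm_eq_lintegral_rpow_enorm_toReal two_ne_zero ENNReal.ofNat_ne_top]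
  simp

end

theorem mainTheorem5 (n : ℕ) (hn : 1 ≤ n) (ρ : ℝ) (hρ₀ : 0 ≤ ρ) (hρ₁ : ρ < 1)
    (m : ℝ) (hm : m = -((1 - ρ) * n / 2))
    (s₀ s₁ s₂ : ℝ) (hs₀ : (n : ℝ) / 2 ≤ s₀) (hs₁ : (n : ℝ) / 2 ≤ s₁) (hs₂ : (n : ℝ) / 2 ≤ s₂)
    (φ : 𝓢(Rn n, ℂ)) (hφ : IsLPGenerator φ) (Φ : 𝓢(Rn2 n, ℂ)) (hΦ : IsLPGenerator Φ)
    (σ : Phase n → ℂ) (hσ : MemBS φ Φ ρ m s₀ s₁ s₂ σ) :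
    BoundedLpLqLr (bilinearPDO σ) 2 2 1 := by
  subst hm
  obtain ⟨hσ_top, hσfin⟩ := hσ
  obtain ⟨τ, A, hτm, hτA, hστ⟩ := exists_measurable_bounded_ae_eq hσ_top
  obtain ⟨C, hC⟩ := exists_sum_lintegral_freqOp_dyadicSymbol_le hφ hn hρ₁
  rw [normBS_congr_ae φ Φ _ _ _ _ _ hστ] at hσfin
  set M := normBS φ Φ ρ (-((1 - ρ) * n / 2)) s₀ s₁ s₂ τ with hM
  set c : ℂ := 1 / (2 * (Real.pi : ℂ)) ^ (2 * n) with hc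
  set R : ℝ≥0∞ := ENNReal.ofReal ((2 * Real.pi) ^ n) with hR
  set D : ℝ≥0∞ := ‖c‖ₑ * (C * M * R) with hD
  have hDfin : D ≠ ∞ := ENNReal.mul_ne_top (by simp) (ENNReal.mul_ne_top
    (ENNReal.mul_ne_top (by simp) hσfin.ne) ENNReal.ofReal_ne_top)
  refine ⟨D.toNNReal, fun f g => ?_⟩
  obtain ⟨B₁, hB₁⟩ := exists_isBoundedIntegrable_fourierHat f
  obtain ⟨B₂, hB₂⟩ := exists_isBoundedIntegrable_fourierHat g
  have ha := hB₁ (max B₁ B₂) (le_max_left _ _)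
  have hb := hB₂ (max B₁ B₂) (le_max_right _ _)
  have hae : bilinearPDO σ f g =ᵐ[volume]
      fun x => c * freqOp τ (fourierHat f) (fourierHat g) x := by
    filter_upwards [freqOp_congr_ae hστ (fourierHat f) (fourierHat g)] with x hx
    rw [bilinearPDO_eq, hx]
  have hmeas := (measurable_freqOp hτm ha.measurable hb.measurable).const_mul c
  have hle := lintegral_freqOp_le_of_dyadic hΦ hτm hτA ha hb fun J =>
    hC Φ s₀ s₁ s₂ τ A _ _ _ J hΦ hs₀ hs₁ hs₂ hτm hτA ha hb
  have hnorm : eLpNorm (bilinearPDO σ f g) 1 volume ≤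
      D.toNNReal * eLpNorm f 2 volume * eLpNorm g 2 volume := by
    rw [eLpNorm_congr_ae hae, eLpNorm_one_eq_lintegral_enorm, ENNReal.coe_toNNReal hDfin,
      eLpNorm_two_eq, eLpNorm_two_eq]
    simp_rw [enorm_mul]
    rw [lintegral_const_mul' _ _ (by simp), mul_assoc, ← ENNReal.mul_rpow_of_nonneg _ _ (by norm_num),
      hD, mul_assoc]
    refine mul_le_mul_right (hle.trans (le_of_eq ?_)) _
    -- Plancherel contributes (2π)^n for each input; under the square root these combine to the
    -- single factor R.
    rw [lintegral_fourierHat_sq, lintegral_fourierHat_sq, mul_mul_mul_comm,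
      ENNReal.mul_rpow_of_nonneg _ _ (by norm_num), ← sq, sq_rpow_half]
    ring
  have hf : eLpNorm f 2 volume < ∞ := (f.memLp 2 volume).eLpNorm_lt_top
  have hg : eLpNorm g 2 volume < ∞ := (g.memLp 2 volume).eLpNorm_lt_top
  have hfin : (D.toNNReal : ℝ≥0∞) * eLpNorm f 2 volume * eLpNorm g 2 volume < ∞ :=
    ENNReal.mul_lt_top (ENNReal.mul_lt_top ENNReal.coe_lt_top hf) hg
  have hmem : AEStronglyMeasurable (bilinearPDO σ f g) volume :=
    hmeas.aestronglyMeasurable.congr hae.symm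
  exact ⟨⟨hmem, hnorm.trans_lt hfin⟩, hnorm⟩
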